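/- Let $M^{n+1}$ be a smooth, compact, connected manifold with boundary $\partial M$, let $\overline{g}$ be a smooth Riemannian metric on $M$ (smooth up to the boundary), let $h=\overline{g}|_{T\partial M}$, and let $r$ be the $\overline{g}$-distance to $\partial M$. Identify a neighbourhood of $\partial M$ with $[0,\delta)_r\times\partial M$ by the normal exponential map of $\overline{g}$, so that $\overline{g}=dr^2+h_r$ there, with $h_0=h$. Let $u$ be a continuous function on $M$ that is smooth and positive in the interior, vanishes on $\partial M$, and satisfies $u=r+o(r)$ at $\partial M$ (equivalently, $|du|_{\overline{g}}=1$ on $\partial M$), so that $g=u^{-2}\overline{g}$ is an asymptotically hyperbolic metric on the interior of $M$ with compactification $\overline{g}$. (It is not assumed that $g=r^{-2}\overline{g}$.) Suppose that $g$ has renormalized volume coefficients $v^{(0)},\dots,v^{(n)}\in C^\infty(\partial M)$ relative to $\overline{g}$, that is, in the above identification, $$dv_g=r^{-n-1}\big[v^{(0)}+v^{(1)}r+\cdots+v^{(n)}r^n+O(r^{n+1}\log r)\big]\,dr\,dv_{h},$$ uniformly on $\partial M$ as $r\to 0$. For a smooth metric $\widehat g$ on $M$ conformal to $\overline{g}$,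 with $\widehat r$ the $\widehat g$-distance to $\partial M$, the renormalized volume $V(g,\widehat g)$ is the constant term in the expansion $$\operatorname{Vol}_g(\{\widehat r>\epsilon\})=c_0\epsilon^{-n}+c_1\epsilon^{-n+1}+\cdots+c_{n-1}\epsilon^{-1}+\mathcal{E}\log\frac1\epsilon+V(g,\widehat g)+o(1),\qquad \epsilon\to0^+.$$ Let $\omega\in C^\infty(M)$. Then for every $t\in\mathbb{R}$ the expansion exists for $\widehat g=e^{2t\omega}\overline{g}$, the function $t\mapsto V(g,e^{2t\omega}\overline{g})$ is differentiable at $t=0$, and $$\partial_t|_{t=0}V(g,e^{2t\omega}\overline{g})=\int_{\partial M}\Bigg(\sum_{j=0}^n\frac{v^{(n-j)}}{(j+1)!}\,\partial_r^j\omega\big|_{r=0}\Bigg)\,dv_h.$$ -/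

import Mathlib

open Set Filter Topology MeasureTheory Bundle
open scoped Manifold ContDiff ENNReal

noncomputable section

namespace RenormVol

section RiemannianVolume

variable {m : ℕ} {H : Type*} [TopologicalSpace H]
  (I : ModelWithCorners ℝ (EuclideanSpace ℝ (Fin m)) H)
  {M : Type*} [TopologicalSpace M] [ChartedSpace H M]

/-- A (not necessarily smooth) field of bilinear forms on the tangent spaces of `M`. -/
abbrev FormField (M : Type*) [TopologicalSpace M] [ChartedSpace H M] : Type _ :=
  ∀ x : M, TangentSpace I x → TangentSpace I x → ℝ

/-- The coordinate vector field `∂_i` of the preferred chart at `x₀`, at the point with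
coordinates `y`. -/
def coordVec (x₀ : M) (y : EuclideanSpace ℝ (Fin m)) (i : Fin m) :
    TangentSpace I ((extChartAt I x₀).symm y) :=
  mfderivWithin 𝓘(ℝ, EuclideanSpace ℝ (Fin m)) I (extChartAt I x₀).symm (range I) y
    (EuclideanSpace.single i (1 : ℝ))

/-- The matrix `g_ij = g(∂_i, ∂_j)` of `g` in the preferred chart at `x₀`. -/
def gramMatrix (g : FormField I M) (x₀ : M) (y : EuclideanSpace ℝ (Fin m)) :
    Matrix (Fin m) (Fin m) ℝ :=
  Matrix.of fun i j => g ((extChartAt I x₀).symm y) (coordVec I x₀ y i) (coordVec I x₀ y j)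

/-- The measure `√(det g_ij) dy` of the chart domain at `x₀`, as a measure on `M`
(zero outside the chart domain). -/
def chartVolume [MeasurableSpace M] (g : FormField I M) (x₀ : M) : Measure M :=
  Measure.map (extChartAt I x₀).symm
    ((volume.restrict (extChartAt I x₀).target).withDensity
      fun y => ENNReal.ofReal (Real.sqrt (gramMatrix I g x₀ y).det))

/-- The Riemannian volume measure `dv_g`: the least measure dominating all the chart measures.
On overlaps of charts the chart measures agree, so that (for second countable `M`) this is the
measure that restricts to `√(det g_ij) dy` on every chart domain. -/
def riemannianVolume [MeasurableSpace M] (g : FormField I M) : Measure M :=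
  ⨆ x₀ : M, chartVolume I g x₀

end RiemannianVolume

section Metric

variable {m : ℕ} {H : Type*} [TopologicalSpace H]
  (I : ModelWithCorners ℝ (EuclideanSpace ℝ (Fin m)) H)
  (M : Type*) [TopologicalSpace M] [ChartedSpace H M] [IsManifold I ∞ M]

/-- Smooth Riemannian metrics on `M` (smooth up to the boundary). -/
abbrev SmoothMetric : Type _ :=
  ContMDiffRiemannianMetric I ∞ (EuclideanSpace ℝ (Fin m)) (fun x : M => TangentSpace I x)

variable {I M}

/-- The conformal rescaling `e^{2 f} ḡ` of a smooth metric, for a smooth function `f`. -/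
def SmoothMetric.conformal (gbar : SmoothMetric I M) (f : M → ℝ) (hf : ContMDiff I 𝓘(ℝ, ℝ) ∞ f) :
    SmoothMetric I M where
  inner x := Real.exp (2 * f x) • gbar.inner x
  symm x v w := by simp [gbar.symm x v w]
  pos x v hv := by
    have := gbar.pos x v hv
    simp only [_root_.smul_apply, smul_eq_mul]
    positivity
  isVonNBounded x := by
    have h := (gbar.isVonNBounded x).image (σ := RingHom.id ℝ)
      ((Real.exp (-f x)) • ContinuousLinearMap.id ℝ (TangentSpace I x))
    refine Bornology.IsVonNBounded.subset (fun v hv => ?_) h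
    refine (Set.mem_image _ _ _).2 ⟨Real.exp (f x) • v, ?_, ?_⟩
    · have h2 : Real.exp (2 * f x) = Real.exp (f x) * Real.exp (f x) := by
        rw [← Real.exp_add]; ring_nf
      simp only [mem_ofPred_eq, _root_.smul_apply, smul_eq_mul, h2] at hv
      simpa [mul_assoc] using hv
    · simp [smul_smul, ← Real.exp_add]
  contMDiff := by
    have h : ContMDiff I 𝓘(ℝ, ℝ) ∞ fun x => Real.exp (2 * f x) :=
      Real.contDiff_exp.comp_contMDiff (contMDiff_const.mul hf)
    intro x
    have hg := gbar.contMDiff x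
    rw [contMDiffAt_section] at hg ⊢
    refine ((h x).smul hg).congr_of_eventuallyEq (Filter.Eventually.of_forall fun y => ?_)
    simp only [hom_trivializationAt_apply, ContinuousLinearMap.inCoordinates]
    ext v w
    simp

/-- The Riemannian distance to the boundary `∂M`: the infimum of the lengths of the `C¹` paths
in `M` from the point to `∂M`. -/
def distBoundary (gbar : SmoothMetric I M) (p : M) : ℝ≥0∞ :=
  letI : RiemannianBundle (fun x : M => TangentSpace I x) := ⟨gbar.toRiemannianMetric⟩
  ⨅ q ∈ I.boundary M, Manifold.riemannianEDist I p q

/-- The form field of the metric `u⁻² ḡ`. (At the points where `u = 0` it is zero by convention;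
it is only meant as a metric on the interior of `M`.) -/
def singularMetric (gbar : SmoothMetric I M) (u : M → ℝ) : FormField I M :=
  fun x v w => (u x ^ 2)⁻¹ * gbar.inner x v w

/-- `u` is a defining function for `∂M`, smooth in the interior, and
`u⁻² ḡ` is asymptotically hyperbolic, i.e. `|du|_ḡ = 1` on `∂M`. Since `u = 0` on `∂M` the latter
says that `u = r + o(r)` at `∂M`, with `r` the `ḡ`-distance to `∂M`. -/
structure IsAsymptoticallyHyperbolic (gbar : SmoothMetric I M) (u : M → ℝ) : Prop where
  continuous : Continuous u
  smooth : ContMDiffOn I 𝓘(ℝ, ℝ) ∞ u (I.interior M)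
  pos : ∀ p ∈ I.interior M, 0 < u p
  zero : ∀ p ∈ I.boundary M, u p = 0
  unit : Tendsto (fun p => u p / (distBoundary gbar p).toReal)
    (𝓝ˢ (I.boundary M) ⊓ 𝓟 (I.interior M)) (𝓝 1)

/-- `V` is the constant term of the expansion
`Vol_g {r > ε} = c₀ ε⁻ⁿ + ⋯ + c_{n-1} ε⁻¹ + 𝓔 log (1/ε) + V + o(1)`, `ε → 0⁺`,
where `r` is the `ḡ`-distance to `∂M`. -/
def IsRenormalizedVolume [MeasurableSpace M] (n : ℕ) (g : FormField I M) (gbar : SmoothMetric I M)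
    (V : ℝ) : Prop :=
  (∀ ε : ℝ, 0 < ε → riemannianVolume I g {p | ENNReal.ofReal ε < distBoundary gbar p} ≠ ⊤) ∧
  ∃ (c : ℕ → ℝ) (E : ℝ), Tendsto (fun ε : ℝ =>
      (riemannianVolume I g {p | ENNReal.ofReal ε < distBoundary gbar p}).toReal
        - ((∑ j ∈ Finset.range n, c j / ε ^ (n - j)) + E * Real.log (1 / ε)))
    (𝓝[>] 0) (𝓝 V)

/-- The renormalized volume `V(g, ḡ)` (meaningful when the expansion exists). -/
def renormalizedVolume [MeasurableSpace M] (n : ℕ) (g : FormField I M) (gbar : SmoothMetric I M) :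
    ℝ :=
  Classical.epsilon (IsRenormalizedVolume n g gbar)

end Metric

section Uniqueness

theorem const_eq_zero_of_tendsto (n : ℕ) : ∀ (c : ℕ → ℝ) (E L : ℝ),
    Tendsto (fun ε : ℝ => (∑ j ∈ Finset.range n, c j / ε ^ (n - j)) + E * Real.log (1 / ε))
      (𝓝[>] 0) (𝓝 L) → L = 0 := by
  induction n with
  | zero =>
    intro c E L h
    have hlog : Tendsto (fun ε : ℝ => Real.log (1 / ε)) (𝓝[>] 0) atTop := by
      simpa using (Real.tendsto_log_nhdsGT_zero)
    simp only [Finset.range_zero, Finset.sum_empty, zero_add] at h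
    rcases lt_trichotomy E 0 with hE | hE | hE
    · exact absurd h (not_tendsto_nhds_of_tendsto_atBot (hlog.const_mul_atTop_of_neg hE) L)
    · subst hE
      simp only [zero_mul] at h
      exact (tendsto_nhds_unique h tendsto_const_nhds)
    · exact absurd h (not_tendsto_nhds_of_tendsto_atTop (hlog.const_mul_atTop hE) L)
  | succ n ih =>
    intro c E L h
    have hε : Tendsto (fun ε : ℝ => ε) (𝓝[>] 0) (𝓝 0) := tendsto_nhdsWithin_of_tendsto_nhds tendsto_id
    have h1 : Tendsto (fun ε : ℝ => ε ^ (n + 1) *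
        ((∑ j ∈ Finset.range (n + 1), c j / ε ^ (n + 1 - j)) + E * Real.log (1 / ε)))
        (𝓝[>] 0) (𝓝 0) := by
      simpa using (hε.pow (n + 1)).mul h
    have hl : Tendsto (fun ε : ℝ => Real.log ε * ε) (𝓝[>] 0) (𝓝 0) :=
      by simpa using tendsto_log_mul_rpow_nhdsGT_zero (r := 1) one_pos
    have h2 : Tendsto (fun ε : ℝ => (∑ j ∈ Finset.range n, c (j + 1) * ε ^ (j + 1)) + c 0
        - E * ε ^ n * (Real.log ε * ε)) (𝓝[>] 0)
        (𝓝 ((∑ j ∈ Finset.range n, c (j + 1) * 0 ^ (j + 1)) + c 0 - E * 0 ^ n * 0)) :=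
      ((tendsto_finsetSum _ fun j _ => (hε.pow (j + 1)).const_mul _).add_const _).sub
        (((hε.pow n).const_mul E).mul hl)
    have h3 := tendsto_nhds_unique (h1.congr' ?_) h2
    · have hc : c 0 = 0 := by simpa using h3.symm
      refine ih (fun j => c (j + 1)) E L (h.congr fun ε => ?_)
      rw [Finset.sum_range_succ']
      simp [hc]
    · filter_upwards [self_mem_nhdsWithin] with ε (hpos : 0 < ε)
      rw [Finset.sum_range_succ', mul_add, mul_add, Finset.mul_sum]
      have e1 : ∀ j ∈ Finset.range n, ε ^ (n + 1) * (c (j + 1) / ε ^ (n + 1 - (j + 1)))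
          = c (j + 1) * ε ^ (j + 1) := by
        intro j hj
        have hj' := Finset.mem_range.1 hj
        have : ε ^ (n + 1) = ε ^ (n + 1 - (j + 1)) * ε ^ (j + 1) := by
          rw [← pow_add]; congr 1; omega
        rw [this]; field_simp
      rw [Finset.sum_congr rfl e1]
      have e2 : Real.log (1 / ε) = - Real.log ε := by simp
      rw [e2]
      field_simp
      simp only [Nat.sub_zero]
      ring

/-- The constant term of the volume expansion is unique. -/
theorem IsRenormalizedVolume.unique {m : ℕ} {H : Type*} [TopologicalSpace H]
    {I : ModelWithCorners ℝ (EuclideanSpace ℝ (Fin m)) H}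
    {M : Type*} [TopologicalSpace M] [ChartedSpace H M] [IsManifold I ∞ M] [MeasurableSpace M]
    {n : ℕ} {g : FormField I M} {gbar : SmoothMetric I M} {V V' : ℝ}
    (h : IsRenormalizedVolume n g gbar V) (h' : IsRenormalizedVolume n g gbar V') : V = V' := by
  obtain ⟨-, c, E, h⟩ := h
  obtain ⟨-, c', E', h'⟩ := h'
  refine sub_eq_zero.1 (const_eq_zero_of_tendsto n (fun j => c' j - c j) (E' - E) _
    ((h.sub h').congr fun ε => ?_))
  simp only [sub_div, Finset.sum_sub_distrib]
  ring

end Uniqueness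

section Collar

variable {n : ℕ}
  {M : Type*} [TopologicalSpace M] [ChartedSpace (EuclideanHalfSpace (n + 1)) M]
  [IsManifold (𝓡∂ (n + 1)) ∞ M]
  {N : Type*} [TopologicalSpace N] [ChartedSpace (EuclideanSpace ℝ (Fin n)) N]

/-- The metric `h = ι^* ḡ` induced on the boundary, where `ι : N → M` is the inclusion of `∂M`. -/
def inducedMetric (gbar : SmoothMetric (𝓡∂ (n + 1)) M) (ι : N → M) : FormField (𝓡 n) N :=
  fun x v w => gbar.inner (ι x) (mfderiv (𝓡 n) (𝓡∂ (n + 1)) ι x v)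
    (mfderiv (𝓡 n) (𝓡∂ (n + 1)) ι x w)

/-- The differential of a map `Φ : N × [0, δ) → M` at `(x, s)`, applied to `v + a ∂_r`. -/
def collarDeriv (Φ : N × ℝ → M) (δ : ℝ) (x : N) (s : ℝ) (v : TangentSpace (𝓡 n) x) (a : ℝ) :
    TangentSpace (𝓡∂ (n + 1)) (Φ (x, s)) :=
  mfderivWithin ((𝓡 n).prod 𝓘(ℝ, ℝ)) (𝓡∂ (n + 1)) Φ (univ ×ˢ Ico 0 δ) (x, s)
    ((v, a) : EuclideanSpace ℝ (Fin n) × ℝ)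

/-- `Φ` is the identification of `[0, δ)_r × ∂M` with a neighbourhood of `∂M` in which
`ḡ` has the geodesic normal form `ḡ = dr² + h_r`: a diffeomorphism onto an open
neighbourhood of `∂M`, restricting to the inclusion `ι` of `∂M` at `r = 0`, for which the pullback
of `ḡ` is `dr² + h_r`. The curves `r ↦ Φ (x, r)` are then the unit speed geodesics normal to `∂M`,
i.e. `Φ` is the normal exponential map of `ḡ`. -/
structure IsGeodesicCollar (gbar : SmoothMetric (𝓡∂ (n + 1)) M) (ι : N → M) (δ : ℝ)
    (Φ : PartialEquiv (N × ℝ) M) : Prop where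
  pos : 0 < δ
  source : Φ.source = univ ×ˢ Ico 0 δ
  isOpen_target : IsOpen Φ.target
  smooth : ContMDiffOn ((𝓡 n).prod 𝓘(ℝ, ℝ)) (𝓡∂ (n + 1)) ∞ Φ (univ ×ˢ Ico 0 δ)
  smooth_symm : ContMDiffOn (𝓡∂ (n + 1)) ((𝓡 n).prod 𝓘(ℝ, ℝ)) ∞ Φ.symm Φ.target
  zero : ∀ x : N, Φ (x, 0) = ι x
  normal_form : ∀ (x : N), ∀ s ∈ Ico 0 δ, ∀ (v w : TangentSpace (𝓡 n) x) (a b : ℝ),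
    gbar.inner (Φ (x, s)) (collarDeriv Φ δ x s v a) (collarDeriv Φ δ x s w b)
      = a * b + gbar.inner (Φ (x, s)) (collarDeriv Φ δ x s v 0) (collarDeriv Φ δ x s w 0)

/-- `v 0, …, v n` are the renormalized volume coefficients of `g` relative to `ḡ`: in the
identification `Φ` of a neighbourhood of `∂M` with `[0, δ)_r × ∂M`,
`dv_g = r^{-n-1} [v⁽⁰⁾ + v⁽¹⁾ r + ⋯ + v⁽ⁿ⁾ rⁿ + O(r^{n+1} log r)] dr dv_h`
with smooth functions `v⁽ʲ⁾` on `∂M`. Here `D` is the expression in brackets. -/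
structure IsRenormalizedVolumeCoeffs [MeasurableSpace M] [MeasurableSpace N]
    (g : FormField (𝓡∂ (n + 1)) M) (gbar : SmoothMetric (𝓡∂ (n + 1)) M) (ι : N → M) (δ : ℝ)
    (Φ : PartialEquiv (N × ℝ) M) (v : ℕ → N → ℝ) : Prop where
  smooth : ∀ j ≤ n, ContMDiff (𝓡 n) 𝓘(ℝ, ℝ) ∞ (v j)
  expansion : ∃ D : N × ℝ → ℝ, Measurable D ∧
    (riemannianVolume (𝓡∂ (n + 1)) g).restrict (Φ '' (univ ×ˢ Ioo 0 δ)) =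
      Measure.map Φ
        ((((riemannianVolume (𝓡 n) (inducedMetric gbar ι)).prod volume).restrict
          (univ ×ˢ Ioo 0 δ)).withDensity
            fun p => ENNReal.ofReal ((p.2 ^ (n + 1))⁻¹ * D p)) ∧
    ∃ C s₀ : ℝ, 0 < s₀ ∧ ∀ (x : N) (s : ℝ), 0 < s → s < s₀ →
      |D (x, s) - ∑ j ∈ Finset.range (n + 1), v j x * s ^ j| ≤ C * (s ^ (n + 1) * |Real.log s|)

/-- The normal derivative `∂_r^j f` at the boundary point `x`, in the identification `Φ`. -/
def normalDeriv (Φ : PartialEquiv (N × ℝ) M) (δ : ℝ) (f : M → ℝ) (j : ℕ) (x : N) : ℝ :=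
  iteratedDerivWithin j (fun s : ℝ => f (Φ (x, s))) (Ico 0 δ) 0

end Collar

end RenormVol

end

/-! The volume density of `g` is fixed, so `t` enters only through the distance `r̂_t` to `∂M` for
`e^{2tω}ḡ`, and everything rests on expanding `r̂_t` in the collar coordinates `(x, s)` of `ḡ`.
Write `r̂_t = s e^a`. The equation `|d r̂_t| = 1` becomes `(1 + s ∂_s a)² + s² |d_y a|²_{h_s} =
e^{2(tω - a)}`. It determines the Taylor coefficients `a_k(t, x)` one at a time, because `a_m`
enters the `s^m` coefficient of the defect with the nonzero factor `2m + 2`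
(`exists_formal_eikonal`). At `t = 0` one has `a = 0`, and the tangential term is quadratic in `a`,
so the linearization is `(1 + s ∂_s) ȧ = ω`. Hence `ȧ_k = ∂_r^k ω / (k+1)!`, which is the origin of
the factorials in the formula.

That the true distance has this expansion is shown by comparison, without constructing normal
coordinates for `e^{2tω}ḡ`. Perturbing the truncated formal solution by `∓C s^{n+1}` yields a
subsolution and a supersolution of the eikonal equation (`exists_barrier`). A subsolution is
1-Lipschitz, so its value is at most the length of any curve to `∂M`; short curves cannot leave the
coordinate patch. A supersolution decreases along its steepest descent curves at least as fast as
length accumulates, so its value bounds the distance from above. The coefficients need only be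
bounded and measurable in `x`, so those of finitely many charts are glued by cutting `∂M` into
pieces.

For the volume, `s^{-k-1}` is integrated over `{s e^{a(s)} > ε}`. Rewritten in inverse powers of `ρ
= s e^{a(s)}`, the function `s^{-k}/k` has constant term exactly `a_k`, and `-log s` behaves in the
same way for `k = 0`. This residue-type identity is `exists_inverse_power_expansion`. A term `±C
s^{n+1}` in the exponent changes nothing up to `O(s)`, so the two barriers give the same expansion
and squeeze the volume. With `k = n - j` the result is `V(t) = const + ∫ ∑ v^{(j)} a_{n-j}(t)`, and
differentiation under the integral gives the theorem. -/

noncomputable section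

namespace RenormVol

/-! ### Taylor expansion in `s` with parameters, on `V × [0, δ)` -/

section SliceTaylor

variable {P : Type*} [NormedAddCommGroup P] [NormedSpace ℝ P]

/-- The partial derivative `∂_s F (z, s)` of a function on `V × [0, δ)`. -/
def sliceDeriv (V : Set P) (δ : ℝ) (F : P × ℝ → ℝ) (p : P × ℝ) : ℝ :=
  fderivWithin ℝ F (V ×ˢ Ico 0 δ) p (0, 1)

/-- The `k`-th Taylor coefficient at `s = 0` of a function on `V × [0, δ)`. -/
def sliceCoeff (V : Set P) (δ : ℝ) (F : P × ℝ → ℝ) (k : ℕ) (z : P) : ℝ :=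
  (sliceDeriv V δ)^[k] F (z, 0) / k.factorial

variable {V : Set P} {δ : ℝ} {F G : P × ℝ → ℝ}

theorem uniqueDiffOn_strip (hV : IsOpen V) : UniqueDiffOn ℝ (V ×ˢ Ico 0 δ) :=
  hV.uniqueDiffOn.prod (uniqueDiffOn_Ico 0 δ)

theorem contDiffOn_sliceDeriv (hV : IsOpen V) (hF : ContDiffOn ℝ ∞ F (V ×ˢ Ico 0 δ)) :
    ContDiffOn ℝ ∞ (sliceDeriv V δ F) (V ×ˢ Ico 0 δ) :=
  (hF.fderivWithin (uniqueDiffOn_strip hV) (by simp)).clm_apply contDiffOn_const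

theorem contDiffOn_iterate_sliceDeriv (hV : IsOpen V) (hF : ContDiffOn ℝ ∞ F (V ×ˢ Ico 0 δ))
    (k : ℕ) : ContDiffOn ℝ ∞ ((sliceDeriv V δ)^[k] F) (V ×ˢ Ico 0 δ) := by
  induction k with
  | zero => simpa using hF
  | succ k ih =>
    rw [Function.iterate_succ_apply']
    exact contDiffOn_sliceDeriv hV ih

theorem contDiffOn_sliceCoeff (hV : IsOpen V) (hδ : 0 < δ) (hF : ContDiffOn ℝ ∞ F (V ×ˢ Ico 0 δ))
    (k : ℕ) : ContDiffOn ℝ ∞ (sliceCoeff V δ F k) V := by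
  have h : ContDiffOn ℝ ∞ (fun z : P => (z, (0 : ℝ))) V := by fun_prop
  exact ((contDiffOn_iterate_sliceDeriv hV hF k).comp h
    fun z hz => ⟨hz, left_mem_Ico.2 hδ⟩).div_const _

theorem hasDerivWithinAt_slice (hF : DifferentiableOn ℝ F (V ×ˢ Ico 0 δ)) {z : P}
    (hz : z ∈ V) {s : ℝ} (hs : s ∈ Ico 0 δ) :
    HasDerivWithinAt (fun s => F (z, s)) (sliceDeriv V δ F (z, s)) (Ico 0 δ) s := by
  have h1 := (hF (z, s) ⟨hz, hs⟩).hasFDerivWithinAt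
  have h2 : HasDerivWithinAt (fun s : ℝ => (z, s)) ((0 : P), (1 : ℝ)) (Ico 0 δ) s :=
    (hasDerivWithinAt_const _ _ _).prodMk (hasDerivWithinAt_id _ _)
  exact h1.comp_hasDerivWithinAt s h2 fun σ hσ => ⟨hz, hσ⟩

/-- Links the one-variable normal derivatives in the statement to iterated `∂_s` of a jointly smooth
function, whose dependence on the parameters can be controlled. -/
theorem iteratedDerivWithin_slice (hV : IsOpen V) {z : P} (hz : z ∈ V) (k : ℕ) :
    ∀ {F : P × ℝ → ℝ}, ContDiffOn ℝ ∞ F (V ×ˢ Ico 0 δ) → ∀ s ∈ Ico 0 δ,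
    iteratedDerivWithin k (fun s => F (z, s)) (Ico 0 δ) s = (sliceDeriv V δ)^[k] F (z, s) := by
  induction k with
  | zero => intro F hF s hs; simp
  | succ k ih =>
    intro F hF s hs
    rw [iteratedDerivWithin_succ, Function.iterate_succ_apply']
    rw [derivWithin_congr (fun σ hσ => ih hF σ hσ) (ih hF s hs)]
    exact (hasDerivWithinAt_slice ((contDiffOn_iterate_sliceDeriv hV hF k).differentiableOn
      (by simp)) hz hs).derivWithin (uniqueDiffOn_Ico 0 δ s hs)

/-- Taylor's formula with remainder uniform on compact sets. -/
theorem exists_taylor_bound (hV : IsOpen V) {K : Set P} (hK : IsCompact K) (hKV : K ⊆ V) {s₁ : ℝ}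
    (hs₁ : s₁ < δ) (m : ℕ) : ∀ {F : P × ℝ → ℝ}, ContDiffOn ℝ ∞ F (V ×ˢ Ico 0 δ) →
    ∃ C, 0 ≤ C ∧ ∀ z ∈ K, ∀ s ∈ Icc 0 s₁,
      |F (z, s) - ∑ k ∈ Finset.range m, sliceCoeff V δ F k z * s ^ k| ≤ C * s ^ m := by
  have hsub : Icc 0 s₁ ⊆ Ico 0 δ := fun s hs => ⟨hs.1, hs.2.trans_lt hs₁⟩
  induction m with
  | zero =>
    intro F hF
    obtain ⟨C, hC⟩ := (hK.prod (isCompact_Icc (a := 0) (b := s₁))).exists_bound_of_continuousOn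
      (hF.continuousOn.mono (prod_mono hKV hsub))
    refine ⟨max C 0, le_max_right _ _, fun z hz s hs => ?_⟩
    simpa using Or.inl (hC (z, s) ⟨hz, hs⟩)
  | succ m ih =>
    intro F hF
    obtain ⟨C, hC0, hC⟩ := ih (contDiffOn_sliceDeriv hV hF)
    refine ⟨C, hC0, fun z hz s hs => ?_⟩
    -- The `s`-derivative of the order `m + 1` remainder of `F` is the order `m` remainder of `∂_s
    -- F`, so the inductive bound integrates by the mean value inequality.
    have hd : ∀ σ ∈ Icc 0 s, HasDerivWithinAt
        (fun σ => F (z, σ) - ∑ k ∈ Finset.range (m + 1), sliceCoeff V δ F k z * σ ^ k)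
        (sliceDeriv V δ F (z, σ)
          - ∑ k ∈ Finset.range m, sliceCoeff V δ (sliceDeriv V δ F) k z * σ ^ k) (Icc 0 s) σ := by
      intro σ hσ
      have hsub' : Icc 0 s ⊆ Ico 0 δ := (Icc_subset_Icc_right hs.2).trans hsub
      refine ((hasDerivWithinAt_slice (hF.differentiableOn (by simp)) (hKV hz) (hsub' hσ)).mono
        hsub').sub ?_
      have h : ∀ k ∈ Finset.range (m + 1), HasDerivWithinAt
          (fun σ : ℝ => sliceCoeff V δ F k z * σ ^ k)
          (sliceCoeff V δ F k z * (k * σ ^ (k - 1))) (Icc 0 s) σ := fun k _ =>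
        ((hasDerivAt_pow k σ).const_mul _).hasDerivWithinAt
      convert! HasDerivWithinAt.fun_sum h using 1
      rw [Finset.sum_range_succ']
      simp only [CharP.cast_eq_zero, zero_mul, mul_zero, add_zero]
      refine Finset.sum_congr rfl fun k _ => ?_
      simp only [sliceCoeff, ← Function.iterate_succ_apply, Nat.factorial_succ]
      push_cast
      have : (k.factorial : ℝ) ≠ 0 := by positivity
      have : (k + 1 : ℝ) ≠ 0 := by positivity
      field_simp
    have hb : ∀ σ ∈ Icc 0 s, ‖sliceDeriv V δ F (z, σ)
          - ∑ k ∈ Finset.range m, sliceCoeff V δ (sliceDeriv V δ F) k z * σ ^ k‖ ≤ C * s ^ m := by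
      intro σ hσ
      refine (hC z hz σ ⟨hσ.1, hσ.2.trans hs.2⟩).trans ?_
      have := hσ.1
      have := hσ.2
      gcongr
    have := (convex_Icc 0 s).norm_image_sub_le_of_norm_hasDerivWithin_le hd hb
      (left_mem_Icc.2 hs.1) (right_mem_Icc.2 hs.1)
    rw [Finset.sum_range_succ' (fun k => sliceCoeff V δ F k z * (0 : ℝ) ^ k)] at this
    simp only [ne_eq, Nat.add_eq_zero_iff, one_ne_zero, and_false, not_false_eq_true, zero_pow,
      mul_zero, Finset.sum_const_zero, zero_add, pow_zero, mul_one, sub_zero, Real.norm_eq_abs,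
      abs_of_nonneg hs.1] at this
    have h0 : sliceCoeff V δ F 0 z = F (z, 0) := by simp [sliceCoeff]
    rw [h0, sub_self, sub_zero] at this
    calc _ ≤ _ := this
      _ = _ := by ring

/-- Letting `s → 0` kills the constant coefficient; dividing by `s` then lowers the order by one. -/
theorem coeff_eq_zero_of_isBigO (m : ℕ) : ∀ (c : ℕ → ℝ),
    (fun s : ℝ => ∑ k ∈ Finset.range m, c k * s ^ k) =O[𝓝[>] 0] (fun s => s ^ m) →
    ∀ k < m, c k = 0 := by
  induction m with
  | zero => intro c _ k hk; omega
  | succ m ih =>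
    intro c h k hk
    have ht : Tendsto (fun s : ℝ => s) (𝓝[>] 0) (𝓝 0) :=
      tendsto_nhdsWithin_of_tendsto_nhds tendsto_id
    have h0 : c 0 = 0 := by
      have h1 : Tendsto (fun s : ℝ => ∑ k ∈ Finset.range (m + 1), c k * s ^ k) (𝓝[>] 0) (𝓝 0) :=
        h.trans_tendsto (by simpa using ht.pow (m + 1))
      have h2 : Tendsto (fun s : ℝ => ∑ k ∈ Finset.range (m + 1), c k * s ^ k) (𝓝[>] 0)
          (𝓝 (∑ k ∈ Finset.range (m + 1), c k * 0 ^ k)) :=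
        tendsto_finsetSum _ fun k _ => (ht.pow k).const_mul _
      have := tendsto_nhds_unique h2 h1
      simpa [Finset.sum_range_succ'] using this
    rcases k with _ | k
    · exact h0
    refine ih (fun k => c (k + 1)) ?_ k (by omega)
    refine (((Asymptotics.isBigO_refl (fun s : ℝ => s⁻¹) (𝓝[>] 0)).mul h).congr' ?_ ?_)
    · filter_upwards [self_mem_nhdsWithin] with s (hs : 0 < s)
      rw [Finset.sum_range_succ', h0]
      simp only [zero_mul, add_zero, Finset.mul_sum]
      refine Finset.sum_congr rfl fun k _ => ?_
      field_simp
      ring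
    · filter_upwards [self_mem_nhdsWithin] with s (hs : 0 < s)
      field_simp
      ring

theorem isBigO_taylor (hV : IsOpen V) (hδ : 0 < δ) (hF : ContDiffOn ℝ ∞ F (V ×ˢ Ico 0 δ)) (m : ℕ)
    {z : P} (hz : z ∈ V) :
    (fun s => F (z, s) - ∑ k ∈ Finset.range m, sliceCoeff V δ F k z * s ^ k)
      =O[𝓝[>] 0] (fun s => s ^ m) := by
  obtain ⟨C, -, hC⟩ := exists_taylor_bound hV isCompact_singleton (singleton_subset_iff.2 hz)
    (half_lt_self hδ) m hF
  refine Asymptotics.IsBigO.of_bound C ?_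
  filter_upwards [Ioc_mem_nhdsGT (half_pos hδ)] with s hs
  simpa [abs_of_pos hs.1] using hC z rfl s ⟨hs.1.le, hs.2⟩

/-- Uniqueness of Taylor coefficients. -/
theorem sliceCoeff_eq_of_isBigO (hV : IsOpen V) (hδ : 0 < δ)
    (hF : ContDiffOn ℝ ∞ F (V ×ˢ Ico 0 δ)) {m : ℕ} {z : P} (hz : z ∈ V) {c : ℕ → ℝ}
    (h : (fun s => F (z, s) - ∑ k ∈ Finset.range m, c k * s ^ k) =O[𝓝[>] 0] (fun s => s ^ m))
    {k : ℕ} (hk : k < m) : sliceCoeff V δ F k z = c k := by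
  have := coeff_eq_zero_of_isBigO m (fun k => sliceCoeff V δ F k z - c k)
    ((h.sub (isBigO_taylor hV hδ hF m hz)).congr_left fun s => ?_) k hk
  · linarith
  · simp only [sub_mul, Finset.sum_sub_distrib]; ring

theorem sliceCoeff_eq_zero_of_isBigO (hV : IsOpen V) (hδ : 0 < δ)
    (hF : ContDiffOn ℝ ∞ F (V ×ˢ Ico 0 δ)) {m : ℕ} {z : P} (hz : z ∈ V)
    (h : (fun s => F (z, s)) =O[𝓝[>] 0] (fun s => s ^ m))
    {k : ℕ} (hk : k < m) : sliceCoeff V δ F k z = 0 :=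
  sliceCoeff_eq_of_isBigO hV hδ hF hz (c := fun _ => 0) (by simpa using h) hk

/-- Symmetry of second derivatives. It persists at the edge `s = 0` because every point of the strip
lies in the closure of its interior. -/
theorem sliceDeriv_fderivWithin_comm (hV : IsOpen V) (hδ : 0 < δ)
    (hF : ContDiffOn ℝ ∞ F (V ×ˢ Ico 0 δ)) (u : P × ℝ) {p : P × ℝ} (hp : p ∈ V ×ˢ Ico 0 δ) :
    sliceDeriv V δ (fun q => fderivWithin ℝ F (V ×ˢ Ico 0 δ) q u) p
      = fderivWithin ℝ (sliceDeriv V δ F) (V ×ˢ Ico 0 δ) p u := by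
  have hS := uniqueDiffOn_strip (δ := δ) hV
  have hcl : p ∈ closure (interior (V ×ˢ Ico 0 δ)) := by
    rw [interior_prod_eq, interior_Ico, closure_prod_eq, closure_Ioo hδ.ne, hV.interior_eq]
    exact ⟨subset_closure hp.1, hp.2.1, hp.2.2.le⟩
  have hsym := (hF p hp).isSymmSndFDerivWithinAt (by simpa using ENat.LEInfty.out) hS hcl hp
  have hd : DifferentiableWithinAt ℝ (fderivWithin ℝ F (V ×ˢ Ico 0 δ)) (V ×ˢ Ico 0 δ) p :=
    ((hF.fderivWithin hS (m := ∞) (by simp)).differentiableOn (by simp)) p hp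
  unfold sliceDeriv
  rw [fderivWithin_clm_apply (hS p hp) hd (differentiableWithinAt_const _),
    fderivWithin_clm_apply (hS p hp) hd (differentiableWithinAt_const _)]
  simpa using hsym.eq _ _

theorem sliceDeriv_congr (h : EqOn F G (V ×ˢ Ico 0 δ)) :
    EqOn (sliceDeriv V δ F) (sliceDeriv V δ G) (V ×ˢ Ico 0 δ) := fun p hp => by
  simp only [sliceDeriv]
  rw [fderivWithin_congr h (h hp)]

theorem iterate_sliceDeriv_fderivWithin_comm (hV : IsOpen V) (hδ : 0 < δ)
    (hF : ContDiffOn ℝ ∞ F (V ×ˢ Ico 0 δ)) (u : P × ℝ) (k : ℕ) :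
    EqOn ((sliceDeriv V δ)^[k] (fun q => fderivWithin ℝ F (V ×ˢ Ico 0 δ) q u))
      (fun q => fderivWithin ℝ ((sliceDeriv V δ)^[k] F) (V ×ˢ Ico 0 δ) q u) (V ×ˢ Ico 0 δ) := by
  induction k with
  | zero => intro p _; simp
  | succ k ih =>
    intro p hp
    simp only [Function.iterate_succ_apply']
    rw [sliceDeriv_congr ih hp]
    exact sliceDeriv_fderivWithin_comm hV hδ (contDiffOn_iterate_sliceDeriv hV hF k) u hp

/-- Taking Taylor coefficients commutes with differentiation in the parameters. -/
theorem hasFDerivAt_sliceCoeff (hV : IsOpen V) (hδ : 0 < δ)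
    (hF : ContDiffOn ℝ ∞ F (V ×ˢ Ico 0 δ)) (k : ℕ) {z : P} (hz : z ∈ V) (u : P) :
    fderiv ℝ (sliceCoeff V δ F k) z u
      = sliceCoeff V δ (fun q => fderivWithin ℝ F (V ×ˢ Ico 0 δ) q (u, 0)) k z := by
  have h0 : (z, (0 : ℝ)) ∈ V ×ˢ Ico 0 δ := ⟨hz, left_mem_Ico.2 hδ⟩
  have h1 := (((contDiffOn_iterate_sliceDeriv hV hF k).differentiableOn (by simp)) _
    h0).hasFDerivWithinAt
  have h2 : HasFDerivWithinAt (fun z : P => (z, (0 : ℝ)))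
      ((ContinuousLinearMap.id ℝ P).prod 0) V z :=
    (hasFDerivWithinAt_id _ _).prodMk (hasFDerivWithinAt_const _ _ _)
  have h3 := (h1.comp z h2 fun z hz => mk_mem_prod hz (left_mem_Ico.2 hδ)).hasFDerivAt (hV.mem_nhds hz)
  have h4 := h3.mul_const ((k.factorial : ℝ)⁻¹)
  change HasFDerivAt (sliceCoeff V δ F k) _ z at h4
  rw [h4.fderiv]
  simp only [sliceCoeff, iterate_sliceDeriv_fderivWithin_comm hV hδ hF (u, 0) k h0]
  simp [div_eq_inv_mul]

end SliceTaylor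

/-! ### Formal solution of the eikonal equation -/

section FormalEikonal

variable {E : Type*} [NormedAddCommGroup E] [NormedSpace ℝ E]

/-- The polynomial `a = ∑_{k < m} α_k(t, y) s^k`. -/
def phase (m : ℕ) (α : ℕ → ℝ × E → ℝ) (p : (ℝ × E) × ℝ) : ℝ :=
  ∑ k ∈ Finset.range m, α k p.1 * p.2 ^ k

/-- The radial derivative `s ∂_s a` of the polynomial `a`. -/
def phaseRadial (m : ℕ) (α : ℕ → ℝ × E → ℝ) (p : (ℝ × E) × ℝ) : ℝ :=
  ∑ k ∈ Finset.range m, k * α k p.1 * p.2 ^ k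

/-- The tangential differential `d_y a` of the polynomial `a`. -/
def phaseDiff (m : ℕ) (α : ℕ → ℝ × E → ℝ) (p : (ℝ × E) × ℝ) : E →L[ℝ] ℝ :=
  ∑ k ∈ Finset.range m, p.2 ^ k • (fderiv ℝ (α k) p.1).comp (ContinuousLinearMap.inr ℝ ℝ E)

/-- The defect in the eikonal equation for `s e^a` with respect to the metric
`e^{2tw} (ds² + H)`, where `G` is the inverse of `H`. -/
def eikonal (w : E × ℝ → ℝ) (G : E × ℝ → (E →L[ℝ] ℝ) →L[ℝ] E) (m : ℕ) (α : ℕ → ℝ × E → ℝ)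
    (p : (ℝ × E) × ℝ) : ℝ :=
  (1 + phaseRadial m α p) ^ 2 + p.2 ^ 2 * phaseDiff m α p (G (p.1.2, p.2) (phaseDiff m α p))
    - Real.exp (2 * (p.1.1 * w (p.1.2, p.2) - phase m α p))

variable {U : Set E} {δ : ℝ} {w : E × ℝ → ℝ} {G : E × ℝ → (E →L[ℝ] ℝ) →L[ℝ] E}
  {α : ℕ → ℝ × E → ℝ} {m : ℕ}

theorem contDiffOn_comp_fst {f : ℝ × E → ℝ} (hf : ContDiffOn ℝ ∞ f (univ ×ˢ U)) :
    ContDiffOn ℝ ∞ (fun p : (ℝ × E) × ℝ => f p.1) ((univ ×ˢ U) ×ˢ Ico 0 δ) :=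
  hf.comp contDiffOn_fst fun _ hp => hp.1

theorem contDiffOn_comp_snd {F : Type*} [NormedAddCommGroup F] [NormedSpace ℝ F]
    {f : E × ℝ → F} (hf : ContDiffOn ℝ ∞ f (U ×ˢ Ico 0 δ)) :
    ContDiffOn ℝ ∞ (fun p : (ℝ × E) × ℝ => f (p.1.2, p.2)) ((univ ×ˢ U) ×ˢ Ico 0 δ) :=
  hf.comp (g := f) (f := fun p : (ℝ × E) × ℝ => (p.1.2, p.2)) (by fun_prop)
    fun _ hp => ⟨hp.1.2, hp.2⟩

theorem contDiffOn_tangential (hU : IsOpen U) {f : ℝ × E → ℝ}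
    (hf : ContDiffOn ℝ ∞ f (univ ×ˢ U)) :
    ContDiffOn ℝ ∞ (fun z => (fderiv ℝ f z).comp (ContinuousLinearMap.inr ℝ ℝ E)) (univ ×ˢ U) :=
  (hf.fderiv_of_isOpen (isOpen_univ.prod hU) (by simp)).clm_comp contDiffOn_const

theorem contDiffOn_phase (hα : ∀ k, ContDiffOn ℝ ∞ (α k) (univ ×ˢ U)) (m : ℕ) :
    ContDiffOn ℝ ∞ (phase m α) ((univ ×ˢ U) ×ˢ Ico 0 δ) :=
  ContDiffOn.sum fun k _ => (contDiffOn_comp_fst (hα k)).mul (contDiffOn_snd.pow k)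

theorem contDiffOn_phaseRadial (hα : ∀ k, ContDiffOn ℝ ∞ (α k) (univ ×ˢ U))
    (m : ℕ) : ContDiffOn ℝ ∞ (phaseRadial m α) ((univ ×ˢ U) ×ˢ Ico 0 δ) :=
  ContDiffOn.sum fun k _ =>
    (contDiffOn_const.mul (contDiffOn_comp_fst (hα k))).mul (contDiffOn_snd.pow k)

theorem contDiffOn_phaseDiff (hU : IsOpen U) (hα : ∀ k, ContDiffOn ℝ ∞ (α k) (univ ×ˢ U))
    (m : ℕ) : ContDiffOn ℝ ∞ (phaseDiff m α) ((univ ×ˢ U) ×ˢ Ico 0 δ) :=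
  ContDiffOn.sum fun k _ => (contDiffOn_snd.pow k).smul
    ((contDiffOn_tangential hU (hα k)).comp contDiffOn_fst fun _ hp => hp.1)

theorem contDiffOn_eikonal (hU : IsOpen U) (hw : ContDiffOn ℝ ∞ w (U ×ˢ Ico 0 δ))
    (hG : ContDiffOn ℝ ∞ G (U ×ˢ Ico 0 δ)) (hα : ∀ k, ContDiffOn ℝ ∞ (α k) (univ ×ˢ U)) (m : ℕ) :
    ContDiffOn ℝ ∞ (eikonal w G m α) ((univ ×ˢ U) ×ˢ Ico 0 δ) := by
  have hd := contDiffOn_phaseDiff (δ := δ) hU hα m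
  have ht : ContDiffOn ℝ ∞ (fun p : (ℝ × E) × ℝ => p.1.1) ((univ ×ˢ U) ×ˢ Ico 0 δ) := by fun_prop
  exact (((contDiffOn_const.add (contDiffOn_phaseRadial hα m)).pow 2).add
    ((contDiffOn_snd.pow 2).mul (hd.clm_apply ((contDiffOn_comp_snd hG).clm_apply hd)))).sub
    (contDiffOn_const.mul ((ht.mul (contDiffOn_comp_snd hw)).sub (contDiffOn_phase hα m))).exp

theorem isBigO_exp_sub_one (c : ℝ) {m : ℕ} (hm : 1 ≤ m) :
    (fun s : ℝ => Real.exp (c * s ^ m) - 1) =O[𝓝[>] 0] (fun s => s ^ m) ∧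
    (fun s : ℝ => Real.exp (c * s ^ m) - 1 - c * s ^ m) =O[𝓝[>] 0] (fun s => s ^ (m + 1)) := by
  have ht : Tendsto (fun s : ℝ => c * s ^ m) (𝓝[>] 0) (𝓝 0) := by
    have : Tendsto (fun s : ℝ => c * s ^ m) (𝓝 0) (𝓝 (c * 0 ^ m)) :=
      (tendsto_id.pow m).const_mul c
    rw [zero_pow (by omega), mul_zero] at this
    exact tendsto_nhdsWithin_of_tendsto_nhds this
  have hc : (fun s : ℝ => c * s ^ m) =O[𝓝[>] 0] (fun s => s ^ m) :=
    (Asymptotics.isBigO_refl _ _).const_mul_left c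
  constructor
  · have h := (Real.exp_sub_sum_range_isBigO_pow 1).comp_tendsto ht
    refine (h.congr_left fun s => ?_).trans (by simpa [Function.comp_def] using hc)
    simp
  · have h := (Real.exp_sub_sum_range_isBigO_pow 2).comp_tendsto ht
    refine (h.congr_left fun s => ?_).trans ?_
    · simp [Finset.sum_range_succ]; ring
    · refine (hc.pow 2).trans ?_
      refine Asymptotics.IsBigO.of_bound 1 ?_
      filter_upwards [Ioc_mem_nhdsGT one_pos] with s hs
      have := hs.1
      simp only [norm_pow, Real.norm_eq_abs, abs_of_pos hs.1, one_mul, ← pow_mul]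
      exact pow_le_pow_of_le_one hs.1.le hs.2 (by omega)

theorem phase_update (m : ℕ) (α : ℕ → ℝ × E → ℝ) (c : ℝ × E → ℝ) (p : (ℝ × E) × ℝ) :
    phase (m + 1) (Function.update α m c) p = phase m α p + c p.1 * p.2 ^ m := by
  simp only [phase, Finset.sum_range_succ, Function.update_self]
  congr 1
  refine Finset.sum_congr rfl fun k hk => ?_
  rw [Function.update_of_ne (Finset.mem_range.1 hk).ne]

theorem phaseRadial_update (m : ℕ) (α : ℕ → ℝ × E → ℝ) (c : ℝ × E → ℝ) (p : (ℝ × E) × ℝ) :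
    phaseRadial (m + 1) (Function.update α m c) p = phaseRadial m α p + m * c p.1 * p.2 ^ m := by
  simp only [phaseRadial, Finset.sum_range_succ, Function.update_self]
  congr 1
  refine Finset.sum_congr rfl fun k hk => ?_
  rw [Function.update_of_ne (Finset.mem_range.1 hk).ne]

theorem phaseDiff_update (m : ℕ) (α : ℕ → ℝ × E → ℝ) (c : ℝ × E → ℝ) (p : (ℝ × E) × ℝ) :
    phaseDiff (m + 1) (Function.update α m c) p = phaseDiff m α p
      + p.2 ^ m • (fderiv ℝ c p.1).comp (ContinuousLinearMap.inr ℝ ℝ E) := by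
  simp only [phaseDiff, Finset.sum_range_succ, Function.update_self]
  congr 1
  refine Finset.sum_congr rfl fun k hk => ?_
  rw [Function.update_of_ne (Finset.mem_range.1 hk).ne]

/-- Adding the term `c s^m` to a solution to order `m` with leading defect `-(2m+2) c s^m` gives
a solution to order `m + 1`. -/
theorem isBigO_eikonal_update (hU : IsOpen U) (hδ : 0 < δ) (hw : ContDiffOn ℝ ∞ w (U ×ˢ Ico 0 δ))
    (hG : ContDiffOn ℝ ∞ G (U ×ˢ Ico 0 δ)) (hα : ∀ k, ContDiffOn ℝ ∞ (α k) (univ ×ˢ U))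
    (hm : 1 ≤ m) {c : ℝ × E → ℝ} (hc : ContDiffOn ℝ ∞ c (univ ×ˢ U)) {z : ℝ × E}
    (hz : z ∈ univ ×ˢ U) (h0 : α 0 z = z.1 * w (z.2, 0))
    (h : (fun s => eikonal w G m α (z, s) - (-(2 * m + 2) * c z) * s ^ m)
      =O[𝓝[>] 0] (fun s => s ^ (m + 1))) :
    (fun s => eikonal w G (m + 1) (Function.update α m c) (z, s))
      =O[𝓝[>] 0] (fun s => s ^ (m + 1)) := by
  set V : Set (ℝ × E) := univ ×ˢ U with hV
  have hVo : IsOpen V := isOpen_univ.prod hU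
  have hd := contDiffOn_phaseDiff (δ := δ) hU hα m
  have hGs := contDiffOn_comp_snd hG
  have hdc : ContDiffOn ℝ ∞ (fun p : (ℝ × E) × ℝ =>
      (fderiv ℝ c p.1).comp (ContinuousLinearMap.inr ℝ ℝ E)) (V ×ˢ Ico 0 δ) :=
    (contDiffOn_tangential hU hc).comp contDiffOn_fst fun _ hp => hp.1
  set dc : E →L[ℝ] ℝ := (fderiv ℝ c z).comp (ContinuousLinearMap.inr ℝ ℝ E) with hdc'
  -- What `c s^m` adds to the tangential quadratic form, divided by `s^m`. Both cross terms are kept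
  -- because `G` is not assumed symmetric here.
  set B : (ℝ × E) × ℝ → ℝ := fun p =>
    ((fderiv ℝ c p.1).comp (ContinuousLinearMap.inr ℝ ℝ E)) (G (p.1.2, p.2) (phaseDiff m α p))
    + (phaseDiff m α p) (G (p.1.2, p.2)
      ((fderiv ℝ c p.1).comp (ContinuousLinearMap.inr ℝ ℝ E)))
    + p.2 ^ m * ((fderiv ℝ c p.1).comp (ContinuousLinearMap.inr ℝ ℝ E)) (G (p.1.2, p.2)
      ((fderiv ℝ c p.1).comp (ContinuousLinearMap.inr ℝ ℝ E))) with hB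
  have hBs : ContDiffOn ℝ ∞ B (V ×ˢ Ico 0 δ) :=
    ((hdc.clm_apply (hGs.clm_apply hd)).add (hd.clm_apply (hGs.clm_apply hdc))).add
      ((contDiffOn_snd.pow m).mul (hdc.clm_apply (hGs.clm_apply hdc)))
  have hBO : (fun s => B (z, s)) =O[𝓝[>] 0] (fun _ => (1 : ℝ)) := by
    simpa using isBigO_taylor hVo hδ hBs 0 hz
  have hrad : (fun s => phaseRadial m α (z, s)) =O[𝓝[>] 0] (fun s => s) := by
    have := isBigO_taylor hVo hδ (contDiffOn_phaseRadial hα m) 1 hz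
    have h00 : phaseRadial m α (z, 0) = 0 := by
      refine Finset.sum_eq_zero fun k _ => ?_
      rcases k with _ | k <;> simp
    simpa [sliceCoeff, h00] using this
  have ht : ContDiffOn ℝ ∞ (fun p : (ℝ × E) × ℝ => p.1.1) (V ×ˢ Ico 0 δ) := by fun_prop
  -- By `h0` the exponent vanishes at `s = 0`, so the exponential factor is `1 + O(s)`.
  have hX : (fun s => Real.exp (2 * (z.1 * w (z.2, s) - phase m α (z, s))) - 1)
      =O[𝓝[>] 0] (fun s => s) := by
    have := isBigO_taylor hVo hδ ((contDiffOn_const (c := (2 : ℝ))).mul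
      ((ht.mul (contDiffOn_comp_snd hw)).sub (contDiffOn_phase hα m))).exp 1 hz
    have h00 : phase m α (z, 0) = α 0 z := by
      obtain ⟨m, rfl⟩ := Nat.exists_eq_add_of_le' hm
      simp [phase, Finset.sum_range_succ']
    simpa [sliceCoeff, h00, h0] using this
  obtain ⟨hY, hY'⟩ := isBigO_exp_sub_one (-(2 * c z)) hm
  have hs : ∀ j : ℕ, (fun s : ℝ => s ^ j) =O[𝓝[>] 0] (fun s => s ^ j) :=
    fun j => Asymptotics.isBigO_refl _ _
  have hle : (fun s : ℝ => s ^ (2 * m)) =O[𝓝[>] 0] (fun s => s ^ (m + 1)) := by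
    refine Asymptotics.IsBigO.of_bound 1 ?_
    filter_upwards [Ioc_mem_nhdsGT one_pos] with s hs
    simp only [norm_pow, Real.norm_eq_abs, abs_of_pos hs.1, one_mul]
    exact pow_le_pow_of_le_one hs.1.le hs.2 (by omega)
  have hle' : (fun s : ℝ => s ^ (m + 2)) =O[𝓝[>] 0] (fun s => s ^ (m + 1)) := by
    refine Asymptotics.IsBigO.of_bound 1 ?_
    filter_upwards [Ioc_mem_nhdsGT one_pos] with s hs
    simp only [norm_pow, Real.norm_eq_abs, abs_of_pos hs.1, one_mul]
    exact pow_le_pow_of_le_one hs.1.le hs.2 (by omega)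
  have t1 : (fun s => 2 * m * c z * (s ^ m * phaseRadial m α (z, s)))
      =O[𝓝[>] 0] (fun s => s ^ (m + 1)) :=
    (((hs m).mul hrad).const_mul_left _).congr_right fun s => by ring
  have t2 : (fun s => (m * c z) ^ 2 * s ^ (2 * m)) =O[𝓝[>] 0] (fun s => s ^ (m + 1)) :=
    hle.const_mul_left _
  have t3 : (fun s => s ^ (m + 2) * B (z, s)) =O[𝓝[>] 0] (fun s => s ^ (m + 1)) := by
    simpa using hle'.mul hBO
  have t4 : (fun s => (Real.exp (2 * (z.1 * w (z.2, s) - phase m α (z, s))) - 1)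
      * (Real.exp (-(2 * c z) * s ^ m) - 1)) =O[𝓝[>] 0] (fun s => s ^ (m + 1)) :=
    (hX.mul hY).congr_right fun s => by ring
  -- The new term adds `2m c s^m` through the radial square and `2c s^m` through the exponential,
  -- which together cancel the leading defect; `t1` to `t4` and `hY'` collect the rest, all of order
  -- `m + 1`.
  refine (((((h.add t1).add t2).add t3).sub t4).sub hY').congr_left fun s => ?_
  simp only [eikonal, phase_update, phaseRadial_update, phaseDiff_update, hB]
  have e : Real.exp (2 * (z.1 * w (z.2, s) - (phase m α (z, s) + c z * s ^ m)))
      = Real.exp (2 * (z.1 * w (z.2, s) - phase m α (z, s))) * Real.exp (-(2 * c z) * s ^ m) := by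
    rw [← Real.exp_add]; ring_nf
  rw [e]
  simp only [map_add, map_smul, add_apply, smul_apply, smul_eq_mul]
  ring

theorem hasFDerivAt_inr (t : ℝ) (y : E) :
    HasFDerivAt (fun y : E => (t, y)) (ContinuousLinearMap.inr ℝ ℝ E) y :=
  hasFDerivAt_prodMk_right t y

theorem tangential_eq_zero (hU : IsOpen U) {f : ℝ × E → ℝ} (hf : ContDiffOn ℝ ∞ f (univ ×ˢ U))
    (h0 : ∀ y ∈ U, f (0, y) = 0) {y : E} (hy : y ∈ U) :
    (fderiv ℝ f (0, y)).comp (ContinuousLinearMap.inr ℝ ℝ E) = 0 := by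
  have hd : DifferentiableAt ℝ f (0, y) := (hf.differentiableOn (by simp)).differentiableAt
    ((isOpen_univ.prod hU).mem_nhds ⟨mem_univ _, hy⟩)
  have h1 := hd.hasFDerivAt.comp y (hasFDerivAt_inr 0 y)
  have h2 : (f ∘ fun y : E => ((0 : ℝ), y)) =ᶠ[𝓝 y] fun _ => 0 := by
    filter_upwards [hU.mem_nhds hy] with y' hy'
    exact h0 y' hy'
  exact (h1.congr_of_eventuallyEq h2.symm).unique (hasFDerivAt_const _ _)

/-- Differentiability is enough: the tangential term is quadratic and vanishes at `t = 0`, so the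
value of this derivative never enters the linearization. -/
theorem hasDerivAt_phaseDiff (hU : IsOpen U) (hα : ∀ k, ContDiffOn ℝ ∞ (α k) (univ ×ˢ U))
    {y : E} (hy : y ∈ U) (s : ℝ) :
    DifferentiableAt ℝ (fun t : ℝ => phaseDiff m α ((t, y), s)) 0 := by
  unfold phaseDiff
  refine DifferentiableAt.fun_sum fun k _ => DifferentiableAt.fun_const_smul ?_ (s ^ k)
  have h1 : DifferentiableAt ℝ (fun z => (fderiv ℝ (α k) z).comp
      (ContinuousLinearMap.inr ℝ ℝ E)) ((0 : ℝ), y) :=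
    ((contDiffOn_tangential hU (hα k)).differentiableOn (by simp)).differentiableAt
      ((isOpen_univ.prod hU).mem_nhds ⟨mem_univ _, hy⟩)
  exact h1.comp (f := fun t : ℝ => (t, y)) 0 (by fun_prop)

/-- Linearization at `t = 0`. All coefficients vanish there, so the exponential equals 1, the
quadratic tangential term drops out to first order, and what remains is `2(1 + s ∂_s)β - 2w`. -/
theorem hasDerivAt_eikonal (hU : IsOpen U) (hα : ∀ k, ContDiffOn ℝ ∞ (α k) (univ ×ˢ U))
    {y : E} (hy : y ∈ U) {β : ℕ → ℝ} (h0 : ∀ k < m, ∀ y ∈ U, α k (0, y) = 0)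
    (h1 : ∀ k < m, HasDerivAt (fun t => α k (t, y)) (β k) 0) (s : ℝ) :
    eikonal w G m α ((0, y), s) = 0 ∧
    HasDerivAt (fun t => eikonal w G m α ((t, y), s))
      (2 * (∑ k ∈ Finset.range m, (k + 1) * β k * s ^ k) - 2 * w (y, s)) 0 := by
  have hph : phase m α ((0, y), s) = 0 :=
    Finset.sum_eq_zero fun k hk => by simp [h0 k (Finset.mem_range.1 hk) y hy]
  have hrad : phaseRadial m α ((0, y), s) = 0 :=
    Finset.sum_eq_zero fun k hk => by simp [h0 k (Finset.mem_range.1 hk) y hy]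
  have hdiff : phaseDiff m α ((0, y), s) = 0 :=
    Finset.sum_eq_zero fun k hk => by
      simp only
      rw [tangential_eq_zero hU (hα k) (h0 k (Finset.mem_range.1 hk)) hy, smul_zero]
  refine ⟨by simp [eikonal, hph, hrad, hdiff], ?_⟩
  have hph' : HasDerivAt (fun t : ℝ => phase m α ((t, y), s))
      (∑ k ∈ Finset.range m, β k * s ^ k) 0 :=
    HasDerivAt.fun_sum fun k hk => (h1 k (Finset.mem_range.1 hk)).mul_const (s ^ k)
  have hrad' : HasDerivAt (fun t : ℝ => phaseRadial m α ((t, y), s))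
      (∑ k ∈ Finset.range m, k * β k * s ^ k) 0 :=
    HasDerivAt.fun_sum fun k hk => ((h1 k (Finset.mem_range.1 hk)).const_mul (k : ℝ)).mul_const (s ^ k)
  have hdiff' := (hasDerivAt_phaseDiff (m := m) hU hα hy s).hasDerivAt
  have hG' := (((hasDerivAt_const (0 : ℝ) (G (y, s))).clm_apply hdiff'))
  have hQ := (hdiff'.clm_apply hG').const_mul (s ^ 2)
  have hfin := (((hrad'.const_add 1).pow 2).add hQ).sub
    ((((hasDerivAt_id (0 : ℝ)).mul_const (w (y, s))).sub hph').const_mul 2).exp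
  convert! hfin using 1
  simp only [hdiff, hrad, hph, map_zero, id, zero_mul, sub_zero, mul_zero, Real.exp_zero,
    zero_apply, add_zero, one_mul, add_mul, Finset.sum_add_distrib, Pi.sub_apply, one_pow, mul_one,
    Nat.cast_ofNat]
  ring

/-- Formal solution of the eikonal equation to any finite order. -/
theorem exists_formal_eikonal (hU : IsOpen U) (hδ : 0 < δ) (hw : ContDiffOn ℝ ∞ w (U ×ˢ Ico 0 δ))
    (hG : ContDiffOn ℝ ∞ G (U ×ˢ Ico 0 δ)) (m : ℕ) :
    ∃ α : ℕ → ℝ × E → ℝ, (∀ k, ContDiffOn ℝ ∞ (α k) (univ ×ˢ U)) ∧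
      (∀ k < m + 1, ∀ y ∈ U, α k (0, y) = 0 ∧
        HasDerivAt (fun t => α k (t, y)) (sliceCoeff U δ w k y / (k + 1)) 0) ∧
      (∀ z ∈ univ ×ˢ U, α 0 z = z.1 * w (z.2, 0)) ∧
      ∀ z ∈ univ ×ˢ U, (fun s => eikonal w G (m + 1) α (z, s))
        =O[𝓝[>] 0] (fun s => s ^ (m + 1)) := by
  have hVo : IsOpen (univ ×ˢ U : Set (ℝ × E)) := isOpen_univ.prod hU
  induction m with
  | zero =>
    have hsm : ContDiffOn ℝ ∞ (fun z : ℝ × E => z.1 * w (z.2, 0)) (univ ×ˢ U) :=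
      contDiffOn_fst.mul (hw.comp (f := fun z : ℝ × E => (z.2, (0 : ℝ))) (by fun_prop)
        fun z hz => ⟨hz.2, left_mem_Ico.2 hδ⟩)
    -- Only the coefficient of index 0 is used at this order; those of higher index are placeholders
    -- to be overwritten.
    refine ⟨fun _ z => z.1 * w (z.2, 0), fun _ => hsm, fun k hk y hy => ⟨by simp, ?_⟩,
      fun _ _ => rfl, fun z hz => ?_⟩
    · obtain rfl : k = 0 := by omega
      simpa [sliceCoeff] using (hasDerivAt_id (0 : ℝ)).mul_const (w (y, 0))
    · have hE := contDiffOn_eikonal (m := 1) hU hw hG (fun _ => hsm)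
      have := isBigO_taylor hVo hδ hE 1 hz
      simpa [sliceCoeff, eikonal, phase, phaseRadial] using this
  | succ m ih =>
    obtain ⟨α, hα, hα0, hαz, hαE⟩ := ih
    have hE := contDiffOn_eikonal (m := m + 1) hU hw hG hα
    set e : ℝ × E → ℝ := sliceCoeff (univ ×ˢ U) δ (eikonal w G (m + 1) α) (m + 1) with he
    have hes : ContDiffOn ℝ ∞ e (univ ×ˢ U) := contDiffOn_sliceCoeff hVo hδ hE (m + 1)
    -- The defect coefficient `e` at order `m + 1` is cancelled by the rule `-(2k + 2) c` with `k =
    -- m + 1`.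
    set c : ℝ × E → ℝ := fun z => -e z / (2 * (m + 1) + 2) with hc
    have hcs : ContDiffOn ℝ ∞ c (univ ×ˢ U) := hes.neg.div_const _
    refine ⟨Function.update α (m + 1) c, fun k => ?_, fun k hk y hy => ?_, fun z hz => ?_,
      fun z hz => ?_⟩
    · rcases eq_or_ne k (m + 1) with rfl | hk
      · simpa using hcs
      · simpa [Function.update_of_ne hk] using hα k
    · rcases eq_or_ne k (m + 1) with rfl | hk'
      · have hval := hasDerivAt_eikonal (w := w) (G := G) (m := m + 1) hU hα hy
          (fun k hk y hy => (hα0 k hk y hy).1) (fun k hk => (hα0 k hk y hy).2)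
        have hz : ((0 : ℝ), y) ∈ (univ ×ˢ U : Set (ℝ × E)) := ⟨mem_univ _, hy⟩
        have he0 : e (0, y) = 0 := by
          refine sliceCoeff_eq_zero_of_isBigO (m := m + 2) hVo hδ hE hz ?_ (by omega)
          simp only [(hval _).1]
          exact Asymptotics.isBigO_zero _ _
        -- The `t`-derivative is moved inside the Taylor coefficient. By the linearization, the
        -- coefficients already found cancel `2w` through order `m`, and `-2 w_{m+1} s^{m+1}` is the
        -- first surviving term; division by `-(2(m+1) + 2)` gives `w_{m+1}/(m+2)`.
        have hed : fderiv ℝ e (0, y) (1, 0) = -2 * sliceCoeff U δ w (m + 1) y := by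
          rw [he, hasFDerivAt_sliceCoeff hVo hδ hE (m + 1) hz]
          have hsm : ContDiffOn ℝ ∞ (fun q => fderivWithin ℝ (eikonal w G (m + 1) α)
              ((univ ×ˢ U) ×ˢ Ico 0 δ) q ((1, 0), 0)) ((univ ×ˢ U) ×ˢ Ico 0 δ) :=
            (hE.fderivWithin (uniqueDiffOn_strip hVo) (by simp)).clm_apply contDiffOn_const
          refine sliceCoeff_eq_of_isBigO (m := m + 2) hVo hδ hsm hz
            (c := fun k => if k = m + 1 then -2 * sliceCoeff U δ w (m + 1) y else 0) ?_
            (by omega) |>.trans (by simp)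
          have hT := (isBigO_taylor hU hδ hw (m + 2) hy).const_mul_left (-2)
          refine hT.congr' ?_ EventuallyEq.rfl
          filter_upwards [Ioo_mem_nhdsGT hδ] with s hs
          have hs' : s ∈ Ico 0 δ := ⟨hs.1.le, hs.2⟩
          have hfd := ((hE.differentiableOn (by simp)) ((0, y), s)
            ⟨hz, hs'⟩).hasFDerivWithinAt
          have hcurve : HasDerivWithinAt (fun t : ℝ => ((t, y), s)) (((1 : ℝ), (0 : E)), (0 : ℝ))
              univ 0 := ((hasDerivWithinAt_id _ _).prodMk (hasDerivWithinAt_const _ _ _)).prodMk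
                (hasDerivWithinAt_const _ _ _)
          have hcomp := (hfd.comp_hasDerivWithinAt (0 : ℝ) hcurve
            fun t _ => mk_mem_prod (mk_mem_prod (mem_univ _) hy) hs').hasDerivAt univ_mem
          rw [hcomp.unique (hval s).2]
          rw [Finset.sum_range_succ _ (m + 1), Finset.sum_range_succ _ (m + 1)]
          have z0 : ∀ k ∈ Finset.range (m + 1),
              (if k = m + 1 then -2 * sliceCoeff U δ w (m + 1) y else 0) * s ^ k = 0 := by
            intro k hk
            rw [if_neg (Finset.mem_range.1 hk).ne, zero_mul]
          have z1 : ∀ k ∈ Finset.range (m + 1),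
              ((k : ℝ) + 1) * (sliceCoeff U δ w k y / (k + 1)) * s ^ k
                = sliceCoeff U δ w k y * s ^ k := by
            intro k _
            have : (k + 1 : ℝ) ≠ 0 := by positivity
            field_simp
          rw [Finset.sum_eq_zero z0, Finset.sum_congr rfl z1, if_pos rfl]
          ring
        refine ⟨by simp [hc, he0], ?_⟩
        have hd : DifferentiableAt ℝ e (0, y) := (hes.differentiableOn (by simp)).differentiableAt
          (hVo.mem_nhds hz)
        have hcurve : HasDerivAt (fun t : ℝ => (t, y)) ((1 : ℝ), (0 : E)) 0 :=
          (hasDerivAt_id _).prodMk (hasDerivAt_const _ _)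
        have := (hd.hasFDerivAt.comp_hasDerivAt (0 : ℝ) hcurve).neg.div_const (2 * (m + 1 : ℝ) + 2)
        rw [hed] at this
        simp only [Function.update_self]
        convert! this using 1
        push_cast
        have : (m + 1 + 1 : ℝ) ≠ 0 := by positivity
        have : (2 * (m + 1) + 2 : ℝ) ≠ 0 := by positivity
        field_simp
      · simpa [Function.update_of_ne hk'] using hα0 k (by omega) y hy
    · rw [Function.update_of_ne (by omega)]
      exact hαz z hz
    · refine isBigO_eikonal_update hU hδ hw hG hα (by omega) hcs hz (hαz z hz) ?_
      refine (isBigO_taylor hVo hδ hE (m + 2) hz).congr_left fun s => ?_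
      rw [Finset.sum_range_succ, Finset.sum_eq_zero, zero_add]
      · rw [← he]
        simp only [hc]
        push_cast
        have : (2 * (m + 1) + 2 : ℝ) ≠ 0 := by positivity
        field_simp
      · intro k hk
        rw [sliceCoeff_eq_zero_of_isBigO hVo hδ hE hz (hαE z hz) (Finset.mem_range.1 hk), zero_mul]

end FormalEikonal

/-! ### Comparison of sub- and supersolutions with lengths of curves -/

section Comparison

variable {E : Type*} [NormedAddCommGroup E] [NormedSpace ℝ E]

/-- `H` is a field of inner products on the slices of `U × [0, δ)` with inverse `G`. -/
structure IsSliceMetric (U : Set E) (δ : ℝ) (H : E × ℝ → E →L[ℝ] E →L[ℝ] ℝ)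
    (G : E × ℝ → (E →L[ℝ] ℝ) →L[ℝ] E) : Prop where
  symm : ∀ p ∈ U ×ˢ Ico 0 δ, ∀ v w, H p v w = H p w v
  nonneg : ∀ p ∈ U ×ˢ Ico 0 δ, ∀ v, 0 ≤ H p v v
  inverse : ∀ p ∈ U ×ˢ Ico 0 δ, ∀ l v, H p (G p l) v = l v
  contDiffOn : ContDiffOn ℝ ∞ G (U ×ˢ Ico 0 δ)

/-- The length of the tangent vector `(v, a)` at `p` for the metric `e^{2tw} (ds² + H)`. -/
def speed (t : ℝ) (w : E × ℝ → ℝ) (H : E × ℝ → E →L[ℝ] E →L[ℝ] ℝ) (p u : E × ℝ) : ℝ :=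
  Real.exp (t * w p) * √(u.2 ^ 2 + H p u.1 u.1)

/-- The function `s e^a`, where `a` is the polynomial with coefficients `α`. -/
def radius (t : ℝ) (m : ℕ) (α : ℕ → ℝ × E → ℝ) (p : E × ℝ) : ℝ :=
  p.2 * Real.exp (phase m α ((t, p.1), p.2))

variable {U : Set E} {δ : ℝ} {w : E × ℝ → ℝ} {H : E × ℝ → E →L[ℝ] E →L[ℝ] ℝ}
  {G : E × ℝ → (E →L[ℝ] ℝ) →L[ℝ] E} {α : ℕ → ℝ × E → ℝ} {m : ℕ} {t : ℝ}

theorem contDiffOn_radius (hα : ∀ k, ContDiffOn ℝ ∞ (α k) (univ ×ˢ U)) :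
    ContDiffOn ℝ ∞ (radius t m α) (U ×ˢ univ) := by
  have h : ∀ k, ContDiffOn ℝ ∞ (fun p : E × ℝ => α k (t, p.1)) (U ×ˢ univ) := fun k =>
    (hα k).comp (f := fun p : E × ℝ => (t, p.1)) (by fun_prop) fun p hp => ⟨mem_univ _, hp.1⟩
  exact contDiffOn_snd.mul (ContDiffOn.sum fun k _ => (h k).mul (contDiffOn_snd.pow k)).exp

/-- The value of the differential of `s e^a` on a tangent vector. -/
def radiusDeriv (t : ℝ) (m : ℕ) (α : ℕ → ℝ × E → ℝ) (p u : E × ℝ) : ℝ :=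
  Real.exp (phase m α ((t, p.1), p.2)) * ((1 + phaseRadial m α ((t, p.1), p.2)) * u.2
    + p.2 * phaseDiff m α ((t, p.1), p.2) u.1)

theorem hasDerivWithinAt_radius (hU : IsOpen U) (hα : ∀ k, ContDiffOn ℝ ∞ (α k) (univ ×ˢ U))
    {c : ℝ → E × ℝ} {c' : E × ℝ} {T : Set ℝ} {τ : ℝ} (hc : HasDerivWithinAt c c' T τ)
    (hτ : (c τ).1 ∈ U) :
    HasDerivWithinAt (fun τ => radius t m α (c τ)) (radiusDeriv t m α (c τ) c') T τ := by
  have h1 : HasDerivWithinAt (fun τ => (c τ).1) c'.1 T τ :=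
    (hasFDerivAt_fst (p := c τ)).comp_hasDerivWithinAt τ hc
  have h2 : HasDerivWithinAt (fun τ => (c τ).2) c'.2 T τ :=
    (hasFDerivAt_snd (p := c τ)).comp_hasDerivWithinAt τ hc
  have hk : ∀ k, HasDerivWithinAt (fun τ => α k (t, (c τ).1))
      ((fderiv ℝ (α k) (t, (c τ).1)).comp (ContinuousLinearMap.inr ℝ ℝ E) c'.1) T τ := by
    intro k
    have hd : DifferentiableAt ℝ (α k) (t, (c τ).1) :=
      ((hα k).differentiableOn (by simp)).differentiableAt
        ((isOpen_univ.prod hU).mem_nhds ⟨mem_univ _, hτ⟩)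
    have hcomp : HasFDerivAt (fun y => α k (t, y)) ((fderiv ℝ (α k) (t, (c τ).1)).comp
        (ContinuousLinearMap.inr ℝ ℝ E)) (c τ).1 :=
      hd.hasFDerivAt.comp _ (hasFDerivAt_inr t (c τ).1)
    exact HasFDerivAt.comp_hasDerivWithinAt (l := fun y => α k (t, y)) τ hcomp h1
  have hph : HasDerivWithinAt (fun τ => phase m α ((t, (c τ).1), (c τ).2))
      (∑ k ∈ Finset.range m, (((fderiv ℝ (α k) (t, (c τ).1)).comp
        (ContinuousLinearMap.inr ℝ ℝ E) c'.1) * (c τ).2 ^ k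
        + α k (t, (c τ).1) * (k * (c τ).2 ^ (k - 1) * c'.2))) T τ :=
    HasDerivWithinAt.fun_sum fun k _ => (hk k).mul (h2.pow k)
  refine (h2.mul hph.exp).congr_deriv ?_
  have e1 : (c τ).2 * (∑ k ∈ Finset.range m, (((fderiv ℝ (α k) (t, (c τ).1)).comp
        (ContinuousLinearMap.inr ℝ ℝ E) c'.1) * (c τ).2 ^ k
        + α k (t, (c τ).1) * (k * (c τ).2 ^ (k - 1) * c'.2)))
      = (c τ).2 * phaseDiff m α ((t, (c τ).1), (c τ).2) c'.1
        + phaseRadial m α ((t, (c τ).1), (c τ).2) * c'.2 := by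
    rw [Finset.sum_add_distrib, mul_add]
    congr 1
    · rw [phaseDiff, sum_apply]
      congr 1
      refine Finset.sum_congr rfl fun k _ => ?_
      simp [mul_comm]
    · rw [phaseRadial, Finset.mul_sum, Finset.sum_mul]
      refine Finset.sum_congr rfl fun k _ => ?_
      rcases k with _ | k
      · simp
      · simp only [add_tsub_cancel_right, pow_succ]; ring
  unfold radiusDeriv
  linear_combination Real.exp (phase m α ((t, (c τ).1), (c τ).2)) * e1

/-- The quadratic `x ↦ H(u + x v, u + x v)` is nonnegative, so its discriminant is nonpositive. -/
theorem IsSliceMetric.cauchy_schwarz (hH : IsSliceMetric U δ H G) {p : E × ℝ}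
    (hp : p ∈ U ×ˢ Ico 0 δ) (u v : E) : H p u v ^ 2 ≤ H p u u * H p v v := by
  have key : ∀ x : ℝ, 0 ≤ H p v v * (x * x) + 2 * H p u v * x + H p u u := by
    intro x
    have h := hH.nonneg p hp (u + x • v)
    simp only [map_add, map_smul, add_apply, smul_apply, smul_eq_mul, hH.symm p hp v u] at h
    linarith
  have := discrim_le_zero key
  unfold discrim at this
  nlinarith

/-- Where the eikonal defect is nonpositive, `s e^a` is 1-Lipschitz. -/
theorem abs_radiusDeriv_le (hH : IsSliceMetric U δ H G) {p : E × ℝ} (hp : p ∈ U ×ˢ Ico 0 δ)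
    (h : eikonal w G m α ((t, p.1), p.2) ≤ 0) (u : E × ℝ) :
    |radiusDeriv t m α p u| ≤ speed t w H p u := by
  set A := 1 + phaseRadial m α ((t, p.1), p.2) with hA
  set l := phaseDiff m α ((t, p.1), p.2) with hl
  set a := phase m α ((t, p.1), p.2) with ha
  have hE : A ^ 2 + p.2 ^ 2 * l (G p l) ≤ Real.exp (2 * (t * w p - a)) := by
    simpa [eikonal] using h
  have hlG : l (G p l) = H p (G p l) (G p l) := (hH.inverse p hp l _).symm
  have hlu : l u.1 = H p (G p l) u.1 := (hH.inverse p hp l _).symm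
  have hcs := hH.cauchy_schwarz hp (G p l) u.1
  have h1 := hH.nonneg p hp (G p l)
  have h2 := hH.nonneg p hp u.1
  -- Cauchy–Schwarz for `ds² + H` between the covector `A ds + s l` and the vector `u`, after
  -- representing `l` by `G l`.
  have hq : (A * u.2 + p.2 * l u.1) ^ 2
      ≤ Real.exp (2 * (t * w p - a)) * (u.2 ^ 2 + H p u.1 u.1) := by
    refine le_trans ?_ (mul_le_mul_of_nonneg_right hE (by positivity))
    rw [hlG, hlu]
    set X := H p (G p l) (G p l)
    set Y := H p u.1 u.1
    set Z := H p (G p l) u.1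
    have : 0 ≤ (A * √Y - u.2 * p.2 * √X) ^ 2 := sq_nonneg _
    have hX := Real.sq_sqrt h1
    have hY := Real.sq_sqrt h2
    have hZ : |Z| ≤ √X * √Y := by
      rw [← Real.sqrt_mul h1]
      exact Real.abs_le_sqrt hcs
    have hm : A * u.2 * p.2 * Z ≤ |A * u.2 * p.2| * (√X * √Y) :=
      (le_abs_self _).trans (by rw [abs_mul]; gcongr)
    have hm2 : 2 * (|A * u.2 * p.2| * (√X * √Y)) ≤ A ^ 2 * Y + u.2 ^ 2 * p.2 ^ 2 * X := by
      have e1 : |A * u.2 * p.2| * (√X * √Y) = |A * √Y| * |u.2 * p.2 * √X| := by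
        simp only [abs_mul, abs_of_nonneg (Real.sqrt_nonneg X), abs_of_nonneg (Real.sqrt_nonneg Y)]
        ring
      rw [e1]
      have := two_mul_le_add_sq (|A * √Y|) (|u.2 * p.2 * √X|)
      simp only [sq_abs, mul_pow, hX, hY] at this
      linarith
    have hz2 : (p.2 * Z) ^ 2 ≤ p.2 ^ 2 * (X * Y) := by
      rw [mul_pow]; gcongr
    nlinarith
  unfold radiusDeriv speed
  rw [abs_mul, abs_of_pos (Real.exp_pos _)]
  calc Real.exp a * |A * u.2 + p.2 * l u.1|
      ≤ Real.exp a * √(Real.exp (2 * (t * w p - a)) * (u.2 ^ 2 + H p u.1 u.1)) := by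
        gcongr
        exact Real.abs_le_sqrt hq
    _ = Real.exp (t * w p) * √(u.2 ^ 2 + H p u.1 u.1) := by
        rw [Real.sqrt_mul (Real.exp_pos _).le, two_mul, Real.exp_add,
          Real.sqrt_mul_self (Real.exp_pos _).le, ← mul_assoc, ← Real.exp_add]
        ring_nf

/-- Lower bound for the length of a curve to the boundary, by a subsolution. -/
theorem radius_le_length (hU : IsOpen U) (hH : IsSliceMetric U δ H G)
    (hα : ∀ k, ContDiffOn ℝ ∞ (α k) (univ ×ˢ U)) {K : Set (E × ℝ)} (hK : K ⊆ U ×ˢ Ico 0 δ)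
    (h : ∀ p ∈ K, eikonal w G m α ((t, p.1), p.2) ≤ 0) {c : ℝ → E × ℝ}
    (hc : ContDiffOn ℝ 1 c (Icc 0 1)) (hcK : MapsTo c (Icc 0 1) K) (h1 : (c 1).2 = 0) :
    ENNReal.ofReal (radius t m α (c 0))
      ≤ ∫⁻ τ in Icc (0 : ℝ) 1, ENNReal.ofReal (speed t w H (c τ) (derivWithin c (Icc 0 1) τ)) := by
  have hf : ContDiffOn ℝ 1 (fun τ => radius t m α (c τ)) (Icc 0 1) :=
    ((contDiffOn_radius hα).of_le (by exact_mod_cast le_top)).comp hc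
      fun τ hτ => ⟨(hK (hcK hτ)).1, mem_univ _⟩
  have key := enorm_sub_le_lintegral_derivWithin_Icc_of_contDiffOn_Icc hf zero_le_one
  have hr1 : radius t m α (c 1) = 0 := by simp [radius, h1]
  rw [hr1, zero_sub, enorm_neg] at key
  refine le_trans ?_ (key.trans (lintegral_mono_ae ?_))
  · rw [← ofReal_norm]
    exact ENNReal.ofReal_le_ofReal (le_abs_self _)
  · refine (ae_restrict_iff' measurableSet_Icc).2 (Eventually.of_forall fun τ hτ => ?_)
    have hd := ((hc.differentiableOn (by simp)) τ hτ).hasDerivWithinAt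
    rw [(hasDerivWithinAt_radius hU hα hd (hK (hcK hτ)).1).derivWithin
      (uniqueDiffOn_Icc zero_lt_one τ hτ), ← ofReal_norm]
    exact ENNReal.ofReal_le_ofReal (abs_radiusDeriv_le hH (hK (hcK hτ)) (h _ (hcK hτ)) _)

/-- The slope of the curves of steepest descent of `s e^a`, as graphs over the `s`-axis. -/
def descentField (G : E × ℝ → (E →L[ℝ] ℝ) →L[ℝ] E) (t : ℝ) (m : ℕ) (α : ℕ → ℝ × E → ℝ)
    (p : E × ℝ) : E :=
  (p.2 / (1 + phaseRadial m α ((t, p.1), p.2))) • G p (phaseDiff m α ((t, p.1), p.2))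

theorem contDiffOn_descentField (hU : IsOpen U) (hG : ContDiffOn ℝ ∞ G (U ×ˢ Ico 0 δ))
    (hα : ∀ k, ContDiffOn ℝ ∞ (α k) (univ ×ˢ U)) {K : Set (E × ℝ)} (hK : K ⊆ U ×ˢ Ico 0 δ)
    (h : ∀ p ∈ K, 1 + phaseRadial m α ((t, p.1), p.2) ≠ 0) :
    ContDiffOn ℝ ∞ (descentField G t m α) K := by
  have hι : ContDiffOn ℝ ∞ (fun p : E × ℝ => ((t, p.1), p.2)) K := by fun_prop
  have hm : MapsTo (fun p : E × ℝ => ((t, p.1), p.2)) K ((univ ×ˢ U) ×ˢ Ico 0 δ) :=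
    fun p hp => ⟨⟨mem_univ _, (hK hp).1⟩, (hK hp).2⟩
  exact (contDiffOn_snd.div (contDiffOn_const.add ((contDiffOn_phaseRadial hα m).comp hι hm)) h).smul
    ((hG.mono hK).clm_apply ((contDiffOn_phaseDiff hU hα m).comp hι hm))

/-- Where the eikonal defect is nonnegative, `s e^a` grows along the descent curves at least as
fast as their length. -/
theorem speed_descentField_le (hH : IsSliceMetric U δ H G) {p : E × ℝ} (hp : p ∈ U ×ˢ Ico 0 δ)
    (h : 0 ≤ eikonal w G m α ((t, p.1), p.2))
    (hA : 0 < 1 + phaseRadial m α ((t, p.1), p.2)) :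
    speed t w H p (descentField G t m α p, 1)
      ≤ radiusDeriv t m α p (descentField G t m α p, 1) := by
  unfold speed radiusDeriv descentField
  set A := 1 + phaseRadial m α ((t, p.1), p.2)
  set l := phaseDiff m α ((t, p.1), p.2)
  set a := phase m α ((t, p.1), p.2)
  have hE : Real.exp (2 * (t * w p - a)) ≤ A ^ 2 + p.2 ^ 2 * l (G p l) := by
    simpa [eikonal] using h
  simp only [map_smul, smul_apply, smul_eq_mul, hH.inverse p hp, one_pow, mul_one]
  set Θ := A ^ 2 + p.2 ^ 2 * l (G p l) with hΘ
  -- In `ds² + H` the descent vector has length `√Θ / A`, while `s e^a` grows along it at rate `e^a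
  -- Θ / A`. The required inequality is thus `e^{tw - a} ≤ √Θ`, which says that the defect is
  -- nonnegative.
  have e1 : 1 + p.2 / A * (p.2 / A * l (G p l)) = Θ / A ^ 2 := by
    rw [hΘ]; field_simp
  have e2 : A + p.2 * (p.2 / A * l (G p l)) = Θ / A := by
    rw [hΘ]; field_simp
  have hs : Real.exp (t * w p - a) ≤ √Θ := by
    refine Real.le_sqrt_of_sq_le ?_
    rwa [← Real.exp_nat_mul]
  have hΘ0 : 0 ≤ Θ := (Real.exp_pos _).le.trans hE
  rw [e1, e2, Real.sqrt_div' _ (sq_nonneg A), Real.sqrt_sq hA.le]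
  calc Real.exp (t * w p) * (√Θ / A) = Real.exp a * (Real.exp (t * w p - a) * √Θ / A) := by
        rw [show t * w p = a + (t * w p - a) by ring, Real.exp_add]
        ring_nf
    _ ≤ Real.exp a * (√Θ * √Θ / A) := by gcongr
    _ = _ := by rw [Real.mul_self_sqrt hΘ0]

/-- Picard–Lindelöf integrated backwards from the final time `s`. The fixed point of the Picard
operator is used directly, since membership in its function space also confines the solution to the
ball. -/
theorem exists_solution_mem_closedBall [CompleteSpace E] {f : ℝ → E → E} {s : ℝ} (hs : 0 ≤ s)
    {y : E} {a L K : NNReal}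
    (hlip : ∀ σ ∈ Icc 0 s, LipschitzOnWith K (f σ) (Metric.closedBall y a))
    (hcont : ∀ x ∈ Metric.closedBall y (a : ℝ), ContinuousOn (f · x) (Icc 0 s))
    (hbound : ∀ σ ∈ Icc 0 s, ∀ x ∈ Metric.closedBall y (a : ℝ), ‖f σ x‖ ≤ L) (hLa : L * s ≤ a) :
    ∃ x : ℝ → E, x s = y ∧ (∀ σ, x σ ∈ Metric.closedBall y a) ∧
      ∀ σ ∈ Icc 0 s, HasDerivWithinAt x (f σ (x σ)) (Icc 0 s) σ := by
  have hf : IsPicardLindelof f (tmin := 0) (tmax := s) ⟨s, hs, le_rfl⟩ y a 0 L K :=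
    { lipschitzOnWith := hlip
      continuousOn := hcont
      norm_le := hbound
      mul_max_le := by simpa [hs] using hLa }
  obtain ⟨x, hx⟩ := ODE.FunSpace.exists_isFixedPt_next hf (Metric.mem_closedBall_self le_rfl)
  refine ⟨x.compProj, ?_, fun σ => x.compProj_mem_closedBall hf.mul_max_le, fun σ hσ => ?_⟩
  · have h1 := x.compProj_val (t := ⟨s, hs, le_rfl⟩)
    rw [← hx, ODE.FunSpace.next_apply₀] at h1
    nth_rw 1 [← hx]
    exact h1
  · refine (ODE.hasDerivWithinAt_picard_Icc ⟨hs, le_rfl⟩ hf.continuousOn_uncurry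
      x.continuous_compProj.continuousOn (fun _ _ => x.compProj_mem_closedBall hf.mul_max_le)
      y hσ).congr_of_mem (fun σ' hσ' => ?_) hσ
    nth_rw 1 [← hx]
    rw [ODE.FunSpace.compProj_of_mem hσ', ODE.FunSpace.next_apply]

/-- Upper bound for the distance to the boundary, by a supersolution: there is a curve whose
length is at most `s e^a`. -/
theorem exists_curve_length_le_radius [FiniteDimensional ℝ E] (hU : IsOpen U)
    (hH : IsSliceMetric U δ H G) (hα : ∀ k, ContDiffOn ℝ ∞ (α k) (univ ×ˢ U)) {y₀ : E} {ρ s₁ : ℝ}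
    (hρ : 0 < ρ) (hs₁ : 0 < s₁) (hK : Metric.closedBall y₀ ρ ×ˢ Icc 0 s₁ ⊆ U ×ˢ Ico 0 δ)
    (h : ∀ p ∈ Metric.closedBall y₀ ρ ×ˢ Icc 0 s₁, 0 ≤ eikonal w G m α ((t, p.1), p.2))
    (hA : ∀ p ∈ Metric.closedBall y₀ ρ ×ˢ Icc 0 s₁,
      0 < 1 + phaseRadial m α ((t, p.1), p.2)) :
    ∃ s₂, 0 < s₂ ∧ s₂ ≤ s₁ ∧ ∀ y ∈ Metric.closedBall y₀ (ρ / 2), ∀ s ∈ Ioo 0 s₂,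
      ∃ c : ℝ → E × ℝ, ContDiffOn ℝ 1 c (Icc 0 s) ∧ MapsTo c (Icc 0 s) (U ×ˢ Ico 0 δ) ∧
        c s = (y, s) ∧ (c 0).2 = 0 ∧
        ∫⁻ τ in Icc (0 : ℝ) s, ENNReal.ofReal (speed t w H (c τ) (derivWithin c (Icc 0 s) τ))
          ≤ ENNReal.ofReal (radius t m α (y, s)) := by
  set K := Metric.closedBall y₀ ρ ×ˢ Icc 0 s₁ with hKdef
  have hKc : IsCompact K := (isCompact_closedBall y₀ ρ).prod isCompact_Icc
  have hKconv : Convex ℝ K := (convex_closedBall y₀ ρ).prod (convex_Icc 0 s₁)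
  have hX : ContDiffOn ℝ ∞ (descentField G t m α) K :=
    contDiffOn_descentField hU hH.contDiffOn hα hK fun p hp => (hA p hp).ne'
  obtain ⟨Λ, hΛ⟩ := hX.exists_lipschitzOnWith (by simp) hKconv hKc
  obtain ⟨B, hB⟩ := hKc.exists_bound_of_continuousOn hX.continuousOn
  set L : NNReal := ⟨max B 0, le_max_right _ _⟩ with hL
  -- With slope at most `L`, a curve starting in the half-size ball moves by less than `ρ / 2`
  -- before reaching `s = 0`, hence stays where the field is controlled.
  refine ⟨min s₁ (ρ / 2 / (L + 1)), by positivity, min_le_left _ _, fun y hy s hs => ?_⟩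
  have hss₁ : s < s₁ := hs.2.trans_le (min_le_left _ _)
  have hsL : s < ρ / 2 / (L + 1) := hs.2.trans_le (min_le_right _ _)
  have hball : Metric.closedBall y (ρ / 2) ⊆ Metric.closedBall y₀ ρ :=
    Metric.closedBall_subset_closedBall' (by have := Metric.mem_closedBall.1 hy; linarith)
  have hmem : ∀ x ∈ Metric.closedBall y (ρ / 2), ∀ σ ∈ Icc 0 s, (x, σ) ∈ K :=
    fun x hx σ hσ => ⟨hball hx, hσ.1, hσ.2.trans hss₁.le⟩
  have hsol : ∃ x : ℝ → E, x s = y ∧ (∀ σ, x σ ∈ Metric.closedBall y (ρ / 2)) ∧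
      ∀ σ ∈ Icc 0 s, HasDerivWithinAt x (descentField G t m α (x σ, σ)) (Icc 0 s) σ := by
    refine exists_solution_mem_closedBall (f := fun σ x => descentField G t m α (x, σ)) (y := y)
      (a := ⟨ρ / 2, by positivity⟩) (L := L) (K := Λ) hs.1.le ?_ ?_ ?_ ?_
    · intro σ hσ x hx x' hx'
      simpa [Prod.edist_eq] using hΛ (hmem x hx σ hσ) (hmem x' hx' σ hσ)
    · exact fun x hx => hX.continuousOn.comp (f := fun σ => (x, σ)) (by fun_prop)
        fun σ hσ => hmem x hx σ hσ
    · exact fun σ hσ x hx => (hB _ (hmem x hx σ hσ)).trans (le_max_left _ _)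
    · have h1 : (L + 1) * s < ρ / 2 := by
        rw [lt_div_iff₀ (by positivity)] at hsL
        linarith
      have := hs.1
      change (L : ℝ) * s ≤ ρ / 2
      linarith
  obtain ⟨x, hxs, hxb, hxd⟩ := hsol
  set c : ℝ → E × ℝ := fun σ => (x σ, σ) with hc
  have hcK : ∀ σ ∈ Icc 0 s, c σ ∈ K := fun σ hσ => hmem _ (hxb σ) σ hσ
  have hcd : ∀ σ ∈ Icc 0 s, HasDerivWithinAt c (descentField G t m α (c σ), 1) (Icc 0 s) σ :=
    fun σ hσ => (hxd σ hσ).prodMk (hasDerivWithinAt_id _ _)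
  have hun := uniqueDiffOn_Icc hs.1
  have hdw : ∀ σ ∈ Icc 0 s, derivWithin c (Icc 0 s) σ = (descentField G t m α (c σ), 1) :=
    fun σ hσ => (hcd σ hσ).derivWithin (hun σ hσ)
  have hccont : ContinuousOn c (Icc 0 s) := fun σ hσ => (hcd σ hσ).continuousWithinAt
  refine ⟨c, ?_, fun σ hσ => hK (hcK σ hσ), by simp [hc, hxs], rfl, ?_⟩
  · rw [show (1 : WithTop ℕ∞) = 0 + 1 by simp, contDiffOn_succ_iff_derivWithin hun]
    refine ⟨fun σ hσ => (hcd σ hσ).differentiableWithinAt, by simp, ?_⟩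
    rw [contDiffOn_zero]
    refine ContinuousOn.congr ?_ hdw
    exact (hX.continuousOn.comp hccont hcK).prodMk continuousOn_const
  · set f : ℝ → ℝ := fun σ => radius t m α (c σ)
    set f' : ℝ → ℝ := fun σ => radiusDeriv t m α (c σ) (descentField G t m α (c σ), 1)
    have hfd : ∀ σ ∈ Icc 0 s, HasDerivWithinAt f (f' σ) (Icc 0 s) σ :=
      fun σ hσ => hasDerivWithinAt_radius hU hα (hcd σ hσ) (hK (hcK σ hσ)).1
    have hle : ∀ σ ∈ Icc 0 s, speed t w H (c σ) (derivWithin c (Icc 0 s) σ) ≤ f' σ := by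
      intro σ hσ
      rw [hdw σ hσ]
      exact speed_descentField_le hH (hK (hcK σ hσ)) (h _ (hcK σ hσ)) (hA _ (hcK σ hσ))
    have hnn : ∀ σ ∈ Icc 0 s, 0 ≤ f' σ := fun σ hσ =>
      (mul_nonneg (Real.exp_pos _).le (Real.sqrt_nonneg _)).trans (hle σ hσ)
    have hfc : ContinuousOn f (Icc 0 s) := fun σ hσ => (hfd σ hσ).continuousWithinAt
    have hfd' : ∀ σ ∈ Ioo 0 s, HasDerivAt f (f' σ) σ := fun σ hσ =>
      (hfd σ (Ioo_subset_Icc_self hσ)).hasDerivAt (Icc_mem_nhds hσ.1 hσ.2)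
    -- Integrability comes for free: `f'` is a nonnegative derivative of a function continuous up to
    -- the endpoints.
    have hint : IntegrableOn f' (Ioc 0 s) := intervalIntegral.integrableOn_deriv_of_nonneg hfc hfd'
      fun σ hσ => hnn σ (Ioo_subset_Icc_self hσ)
    have hint' : IntervalIntegrable f' volume 0 s :=
      (intervalIntegrable_iff_integrableOn_Ioc_of_le hs.1.le).2 hint
    have hftc := intervalIntegral.integral_eq_sub_of_hasDerivAt_of_le hs.1.le hfc hfd' hint'
    calc _ ≤ ∫⁻ σ in Icc 0 s, ENNReal.ofReal (f' σ) :=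
          setLIntegral_mono_ae' measurableSet_Icc
            (Eventually.of_forall fun σ hσ => ENNReal.ofReal_le_ofReal (hle σ hσ))
      _ = ∫⁻ σ in Ioc 0 s, ENNReal.ofReal (f' σ) := by rw [restrict_Ioc_eq_restrict_Icc]
      _ = ENNReal.ofReal (∫ σ in Ioc 0 s, f' σ) :=
          (ofReal_integral_eq_lintegral_ofReal hint ((ae_restrict_iff' measurableSet_Ioc).2
            (Eventually.of_forall fun σ hσ => hnn σ (Ioc_subset_Icc_self hσ)))).symm
      _ = _ := by
          rw [← intervalIntegral.integral_of_le hs.1.le, hftc]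
          simp [f, hc, hxs, radius]

end Comparison

/-! ### Barriers -/

section Barrier

variable {E : Type*} [NormedAddCommGroup E] [NormedSpace ℝ E]
  {U : Set E} {δ : ℝ} {w : E × ℝ → ℝ} {G : E × ℝ → (E →L[ℝ] ℝ) →L[ℝ] E} {α : ℕ → ℝ × E → ℝ}
  {m : ℕ}

/-- A constant coefficient leaves the tangential differential unchanged, so the effect on the defect
is exact. Both added terms have the sign of `c` once `s` is small. -/
theorem eikonal_update_const (m : ℕ) (α : ℕ → ℝ × E → ℝ) (c : ℝ) (p : (ℝ × E) × ℝ) :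
    eikonal w G (m + 1) (Function.update α m fun _ => c) p = eikonal w G m α p
      + m * c * p.2 ^ m * (2 * (1 + phaseRadial m α p) + m * c * p.2 ^ m)
      + Real.exp (2 * (p.1.1 * w (p.1.2, p.2) - phase m α p))
        * (1 - Real.exp (-(2 * c * p.2 ^ m))) := by
  simp only [eikonal, phase_update, phaseRadial_update, phaseDiff_update]
  have e : Real.exp (2 * (p.1.1 * w (p.1.2, p.2) - (phase m α p + c * p.2 ^ m)))
      = Real.exp (2 * (p.1.1 * w (p.1.2, p.2) - phase m α p))
        * Real.exp (-(2 * c * p.2 ^ m)) := by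
    rw [← Real.exp_add]; ring_nf
  rw [e]
  simp
  ring

/-- Perturbing a formal solution of order `m` by `∓ C s^m` gives sub- and supersolutions of the
eikonal equation. -/
theorem exists_barrier (hU : IsOpen U) (hδ : 0 < δ) (hw : ContDiffOn ℝ ∞ w (U ×ˢ Ico 0 δ))
    (hG : ContDiffOn ℝ ∞ G (U ×ˢ Ico 0 δ)) (hα : ∀ k, ContDiffOn ℝ ∞ (α k) (univ ×ˢ U))
    (hm : 1 ≤ m) (hE : ∀ z ∈ univ ×ˢ U, (fun s => eikonal w G m α (z, s))
      =O[𝓝[>] 0] (fun s => s ^ m)) (t : ℝ) {K : Set E} (hK : IsCompact K) (hKU : K ⊆ U) :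
    ∃ C s₁, 0 ≤ C ∧ 0 < s₁ ∧ s₁ < δ ∧ ∀ y ∈ K, ∀ s ∈ Icc 0 s₁,
      eikonal w G (m + 1) (Function.update α m fun _ => -C) ((t, y), s) ≤ 0 ∧
      0 ≤ eikonal w G (m + 1) (Function.update α m fun _ => C) ((t, y), s) ∧
      0 < 1 + phaseRadial (m + 1) (Function.update α m fun _ => C) ((t, y), s) := by
  have hVo : IsOpen (univ ×ˢ U : Set (ℝ × E)) := isOpen_univ.prod hU
  have hKt : IsCompact ({t} ×ˢ K : Set (ℝ × E)) := isCompact_singleton.prod hK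
  have hKt' : ({t} ×ˢ K : Set (ℝ × E)) ⊆ univ ×ˢ U := prod_mono (subset_univ _) hKU
  have hEs := contDiffOn_eikonal (m := m) hU hw hG hα
  obtain ⟨C, hC0, hC⟩ := exists_taylor_bound hVo hKt hKt' (half_lt_self hδ) m hEs
  obtain ⟨C₁, hC₁0, hC₁⟩ := exists_taylor_bound hVo hKt hKt' (half_lt_self hδ) 1
    (contDiffOn_phaseRadial hα m)
  -- The last two bounds force `|s ∂_s a| ≤ 1/4` and `m C s^m ≤ 1/2`. The shift then has size at
  -- least `m C s^m (3/2 - 1/2) ≥ C s^m`, which dominates the defect, so the Taylor constant `C`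
  -- itself serves as barrier constant.
  set s₁ := min (min (δ / 2) 1) (min (1 / (4 * (C₁ + 1))) (1 / (2 * (m * C + 1)))) with hs₁
  have hs₁0 : 0 < s₁ := by positivity
  refine ⟨C, s₁, hC0, hs₁0, ?_, fun y hy s hs => ?_⟩
  · have : s₁ ≤ δ / 2 := (min_le_left _ _).trans (min_le_left _ _)
    linarith
  have hz : ((t, y) : ℝ × E) ∈ ({t} ×ˢ K : Set (ℝ × E)) := ⟨rfl, hy⟩
  have hsδ : s ∈ Icc 0 (δ / 2) := ⟨hs.1, hs.2.trans ((min_le_left _ _).trans (min_le_left _ _))⟩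
  have hs1 : s ≤ 1 := hs.2.trans ((min_le_left _ _).trans (min_le_right _ _))
  have hb1 : s * (4 * (C₁ + 1)) ≤ 1 := by
    have := hs.2.trans ((min_le_right _ _).trans (min_le_left _ _))
    rwa [le_div_iff₀ (by positivity)] at this
  have hb2 : s * (2 * (m * C + 1)) ≤ 1 := by
    have := hs.2.trans ((min_le_right _ _).trans (min_le_right _ _))
    rwa [le_div_iff₀ (by positivity)] at this
  have hEb : |eikonal w G m α ((t, y), s)| ≤ C * s ^ m := by
    have := hC _ hz s hsδ
    rwa [Finset.sum_eq_zero fun k hk => ?_, sub_zero] at this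
    rw [sliceCoeff_eq_zero_of_isBigO hVo hδ hEs (hKt' hz) (hE _ (hKt' hz)) (Finset.mem_range.1 hk),
      zero_mul]
  have hrb : |phaseRadial m α ((t, y), s)| ≤ 1 / 4 := by
    have h00 : phaseRadial m α ((t, y), 0) = 0 := by
      refine Finset.sum_eq_zero fun k _ => ?_
      rcases k with _ | k <;> simp
    have := hC₁ _ hz s hsδ
    simp only [Finset.range_one, Finset.sum_singleton, sliceCoeff, Function.iterate_zero, id, h00,
      zero_div, zero_mul, sub_zero, pow_one] at this
    have := hs.1
    nlinarith
  have hsm0 : 0 ≤ s ^ m := pow_nonneg hs.1 m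
  have hsm : s ^ m ≤ s := by simpa using pow_le_pow_of_le_one hs.1 hs1 hm
  have hm1 : (1 : ℝ) ≤ m := by exact_mod_cast hm
  have hmC : m * C * s ^ m ≤ 1 / 2 := by
    have : m * C * s ^ m ≤ m * C * s := by gcongr
    nlinarith [hs.1]
  have hmC0 : 0 ≤ m * C * s ^ m := by positivity
  have hCm : C * s ^ m ≤ m * C * s ^ m := by
    have : 0 ≤ C * s ^ m := by positivity
    nlinarith
  obtain ⟨hE1, hE2⟩ := abs_le.1 hEb
  obtain ⟨hr1, hr2⟩ := abs_le.1 hrb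
  have hexp := Real.exp_pos (2 * (t * w (y, s) - phase m α ((t, y), s)))
  refine ⟨?_, ?_, ?_⟩
  · rw [eikonal_update_const]
    have h1 : 1 - Real.exp (-(2 * -C * s ^ m)) ≤ 0 := by
      have := Real.one_le_exp (x := -(2 * -C * s ^ m)) (by nlinarith)
      linarith
    have h2 := mul_nonpos_of_nonneg_of_nonpos hexp.le h1
    simp only
    nlinarith
  · rw [eikonal_update_const]
    have h1 : 0 ≤ 1 - Real.exp (-(2 * C * s ^ m)) := by
      have := Real.exp_le_one_iff (x := -(2 * C * s ^ m)) |>.2 (by nlinarith)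
      linarith
    have h2 := mul_nonneg hexp.le h1
    simp only
    nlinarith
  · rw [phaseRadial_update]
    simp only
    linarith

end Barrier

/-! ### Inverting a smooth family of inner products -/

section SliceMetric

variable {E : Type*} [NormedAddCommGroup E] [NormedSpace ℝ E] [FiniteDimensional ℝ E]

theorem isInvertible_of_pos {B : E →L[ℝ] E →L[ℝ] ℝ} (hB : ∀ v, v ≠ 0 → 0 < B v v) :
    B.IsInvertible := by
  have hinj : Function.Injective B := by
    refine (injective_iff_map_eq_zero B).2 fun v hv => ?_
    by_contra h
    have := hB v h
    simp [hv] at this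
  have hrank : Module.finrank ℝ E = Module.finrank ℝ (E →L[ℝ] ℝ) := by
    rw [← (LinearMap.toContinuousLinearMap (𝕜 := ℝ) (E := E) (F' := ℝ)).finrank_eq]
    exact (Subspace.dual_finrank_eq).symm
  exact ⟨(LinearEquiv.ofInjectiveOfFinrankEq (B : E →ₗ[ℝ] (E →L[ℝ] ℝ)) hinj hrank
    ).toContinuousLinearEquiv, by ext; rfl⟩

/-- Definiteness makes each form an invertible map to the dual, and inversion is smooth at
invertible maps. -/
theorem IsSliceMetric.of_pos {U : Set E} {δ : ℝ} {H : E × ℝ → E →L[ℝ] E →L[ℝ] ℝ}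
    (hs : ∀ p ∈ U ×ˢ Ico 0 δ, ∀ v w, H p v w = H p w v)
    (hp : ∀ p ∈ U ×ˢ Ico 0 δ, ∀ v, v ≠ 0 → 0 < H p v v)
    (hc : ContDiffOn ℝ ∞ H (U ×ˢ Ico 0 δ)) :
    IsSliceMetric U δ H (fun p => (H p).inverse) where
  symm := hs
  nonneg p h v := by
    rcases eq_or_ne v 0 with rfl | hv
    · simp
    · exact (hp p h v hv).le
  inverse p h l v := by
    obtain ⟨e, he⟩ := isInvertible_of_pos (hp p h)
    simp [← he]
  contDiffOn p h := (isInvertible_of_pos (hp p h)).contDiffAt_map_inverse.comp_contDiffWithinAt p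
    (hc p h)

end SliceMetric

/-! ### Pullbacks of smooth metrics -/

section Pullback

variable {m : ℕ} {H : Type*} [TopologicalSpace H]
  {I : ModelWithCorners ℝ (EuclideanSpace ℝ (Fin m)) H}
  {M : Type*} [TopologicalSpace M] [ChartedSpace H M] [IsManifold I ∞ M]
  {F : Type*} [NormedAddCommGroup F] [NormedSpace ℝ F]

/-- The tangent map of `f` carries constant vector fields to smooth sections along `f`, and the
metric pairs smooth sections smoothly. This serves the collar metric and the Gram matrices on `M`
and on its boundary alike. -/
theorem contDiffOn_inner_mfderivWithin (g : SmoothMetric I M) {f : F → M} {S : Set F}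
    (hf : ContMDiffOn 𝓘(ℝ, F) I ∞ f S) (hS : UniqueDiffOn ℝ S) (v w : F) :
    ContDiffOn ℝ ∞ (fun y => g.inner (f y) (mfderivWithin 𝓘(ℝ, F) I f S y v)
      (mfderivWithin 𝓘(ℝ, F) I f S y w)) S := by
  let _ : RiemannianBundle (fun x : M => TangentSpace I x) := ⟨g.toRiemannianMetric⟩
  have key : ∀ v : F, ContMDiffOn 𝓘(ℝ, F) (I.prod 𝓘(ℝ, EuclideanSpace ℝ (Fin m))) ∞
      (fun y => (⟨f y, mfderivWithin 𝓘(ℝ, F) I f S y v⟩ :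
        TotalSpace (EuclideanSpace ℝ (Fin m)) (TangentSpace I : M → Type _))) S := by
    intro v
    have h1 := hf.contMDiffOn_tangentMapWithin (m := ∞) (by simp) hS.uniqueMDiffOn
    have h2 : ContMDiffOn 𝓘(ℝ, F) (𝓘(ℝ, F).prod 𝓘(ℝ, F)) ∞
        (fun y : F => (⟨y, v⟩ : TangentBundle 𝓘(ℝ, F) F)) S := by
      exact contMDiffOn_vectorSpace_iff_contDiffOn.2 (contDiffOn_const (c := v))
    exact h1.comp h2 fun y hy => hy
  exact contMDiffOn_iff_contDiffOn.1 ((key v).inner_bundle (key w))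

theorem enorm_eq_of_metric (g : SmoothMetric I M) (x : M) (v : TangentSpace I x) :
    letI : RiemannianBundle (fun x : M => TangentSpace I x) := ⟨g.toRiemannianMetric⟩
    ‖v‖ₑ = ENNReal.ofReal (√(g.inner x v v)) := by
  let _ : RiemannianBundle (fun x : M => TangentSpace I x) := ⟨g.toRiemannianMetric⟩
  rw [← ofReal_norm, norm_eq_sqrt_real_inner]
  rfl

end Pullback

/-! ### Coordinates on the collar -/

section CollarChart

variable {n : ℕ}
  {M : Type*} [TopologicalSpace M] [ChartedSpace (EuclideanHalfSpace (n + 1)) M]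
  [IsManifold (𝓡∂ (n + 1)) ∞ M]
  {N : Type*} [TopologicalSpace N] [ChartedSpace (EuclideanSpace ℝ (Fin n)) N]

/-- The collar coordinates `(y, s)` near the boundary, in the chart of `N` at `x₀`. -/
def collarChart (Φ : PartialEquiv (N × ℝ) M) (x₀ : N) (p : EuclideanSpace ℝ (Fin n) × ℝ) : M :=
  Φ ((extChartAt (𝓡 n) x₀).symm p.1, p.2)

/-- The inverse of the collar coordinates. -/
def collarChartInv (Φ : PartialEquiv (N × ℝ) M) (x₀ : N) (q : M) : EuclideanSpace ℝ (Fin n) × ℝ :=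
  (extChartAt (𝓡 n) x₀ (Φ.symm q).1, (Φ.symm q).2)

/-- The domain of the collar coordinates. -/
def collarDomain (n : ℕ) {N : Type*} [TopologicalSpace N]
    [ChartedSpace (EuclideanSpace ℝ (Fin n)) N] (δ : ℝ) (x₀ : N) : Set (EuclideanSpace ℝ (Fin n) × ℝ) :=
  (extChartAt (𝓡 n) x₀).target ×ˢ Ico 0 δ

/-- The differential of the collar coordinates. -/
def collarChartDeriv (Φ : PartialEquiv (N × ℝ) M) (δ : ℝ) (x₀ : N)
    (p : EuclideanSpace ℝ (Fin n) × ℝ) :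
    EuclideanSpace ℝ (Fin n) × ℝ →L[ℝ] TangentSpace (𝓡∂ (n + 1)) (collarChart Φ x₀ p) :=
  mfderivWithin 𝓘(ℝ, EuclideanSpace ℝ (Fin n) × ℝ) (𝓡∂ (n + 1)) (collarChart Φ x₀)
    (collarDomain n δ x₀) p

/-- The metric `h_s` in collar coordinates. -/
def collarMetric (gbar : SmoothMetric (𝓡∂ (n + 1)) M) (Φ : PartialEquiv (N × ℝ) M) (δ : ℝ) (x₀ : N)
    (p : EuclideanSpace ℝ (Fin n) × ℝ) :
    EuclideanSpace ℝ (Fin n) →L[ℝ] EuclideanSpace ℝ (Fin n) →L[ℝ] ℝ :=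
  (ContinuousLinearMap.precomp ℝ ((collarChartDeriv Φ δ x₀ p).comp
    (ContinuousLinearMap.inl ℝ (EuclideanSpace ℝ (Fin n)) ℝ))).comp
    ((gbar.inner (collarChart Φ x₀ p)).comp ((collarChartDeriv Φ δ x₀ p).comp
      (ContinuousLinearMap.inl ℝ (EuclideanSpace ℝ (Fin n)) ℝ)))

variable {gbar : SmoothMetric (𝓡∂ (n + 1)) M} {ι : N → M} {δ : ℝ} {Φ : PartialEquiv (N × ℝ) M}

theorem collarMetric_apply (p : EuclideanSpace ℝ (Fin n) × ℝ) (x₀ : N)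
    (v w : EuclideanSpace ℝ (Fin n)) :
    collarMetric gbar Φ δ x₀ p v w = gbar.inner (collarChart Φ x₀ p)
      (collarChartDeriv Φ δ x₀ p (v, 0)) (collarChartDeriv Φ δ x₀ p (w, 0)) := rfl

theorem isOpen_target_chart (x₀ : N) : IsOpen (extChartAt (𝓡 n) x₀).target :=
  isOpen_extChartAt_target x₀

theorem uniqueDiffOn_collarDomain (x₀ : N) : UniqueDiffOn ℝ (collarDomain n δ x₀) :=
  uniqueDiffOn_strip (isOpen_target_chart x₀)

theorem contMDiffOn_chartSymm_prod [IsManifold (𝓡 n) ∞ N] (x₀ : N) :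
    ContMDiffOn 𝓘(ℝ, EuclideanSpace ℝ (Fin n) × ℝ) ((𝓡 n).prod 𝓘(ℝ, ℝ)) ∞
      (fun p : EuclideanSpace ℝ (Fin n) × ℝ => ((extChartAt (𝓡 n) x₀).symm p.1, p.2))
      (collarDomain n δ x₀) := by
  refine ContMDiffOn.prodMk ?_ ?_
  · exact (contMDiffOn_extChartAt_symm (n := ∞) x₀).comp
      (contMDiffOn_iff_contDiffOn.2 contDiffOn_fst) fun p hp => hp.1
  · exact contMDiffOn_iff_contDiffOn.2 contDiffOn_snd

theorem mapsTo_chartSymm_prod (x₀ : N) :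
    MapsTo (fun p : EuclideanSpace ℝ (Fin n) × ℝ => ((extChartAt (𝓡 n) x₀).symm p.1, p.2))
      (collarDomain n δ x₀) (univ ×ˢ Ico 0 δ) := fun _ hp => ⟨mem_univ _, hp.2⟩

theorem contMDiffOn_collarChart [IsManifold (𝓡 n) ∞ N] (hΦ : IsGeodesicCollar gbar ι δ Φ) (x₀ : N) :
    ContMDiffOn 𝓘(ℝ, EuclideanSpace ℝ (Fin n) × ℝ) (𝓡∂ (n + 1)) ∞ (collarChart Φ x₀)
      (collarDomain n δ x₀) :=
  hΦ.smooth.comp (contMDiffOn_chartSymm_prod x₀) (mapsTo_chartSymm_prod x₀)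

theorem collarChart_mem_target (hΦ : IsGeodesicCollar gbar ι δ Φ) {x₀ : N}
    {p : EuclideanSpace ℝ (Fin n) × ℝ} (hp : p ∈ collarDomain n δ x₀) :
    collarChart Φ x₀ p ∈ Φ.target :=
  Φ.map_source (by rw [hΦ.source]; exact ⟨mem_univ _, hp.2⟩)

theorem symm_collarChart (hΦ : IsGeodesicCollar gbar ι δ Φ) {x₀ : N}
    {p : EuclideanSpace ℝ (Fin n) × ℝ} (hp : p ∈ collarDomain n δ x₀) :
    Φ.symm (collarChart Φ x₀ p) = ((extChartAt (𝓡 n) x₀).symm p.1, p.2) :=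
  Φ.left_inv (by rw [hΦ.source]; exact ⟨mem_univ _, hp.2⟩)

theorem collarChartInv_collarChart (hΦ : IsGeodesicCollar gbar ι δ Φ) {x₀ : N}
    {p : EuclideanSpace ℝ (Fin n) × ℝ} (hp : p ∈ collarDomain n δ x₀) :
    collarChartInv Φ x₀ (collarChart Φ x₀ p) = p := by
  unfold collarChartInv
  rw [symm_collarChart hΦ hp]
  exact Prod.ext ((extChartAt (𝓡 n) x₀).right_inv hp.1) rfl

/-- Images of relatively open sets under collar coordinates. -/
theorem image_collarChart (hΦ : IsGeodesicCollar gbar ι δ Φ) (x₀ : N)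
    (T : Set (EuclideanSpace ℝ (Fin n) × ℝ)) :
    collarChart Φ x₀ '' (T ∩ collarDomain n δ x₀) = Φ.target ∩ Φ.symm ⁻¹'
      {q | q.1 ∈ (extChartAt (𝓡 n) x₀).source ∧ (extChartAt (𝓡 n) x₀ q.1, q.2) ∈ T} := by
  ext q
  constructor
  · rintro ⟨p, ⟨hpT, hp⟩, rfl⟩
    refine ⟨collarChart_mem_target hΦ hp, ?_⟩
    rw [mem_preimage, symm_collarChart hΦ hp]
    refine ⟨(extChartAt (𝓡 n) x₀).map_target hp.1, ?_⟩
    simpa only [(extChartAt (𝓡 n) x₀).right_inv hp.1] using hpT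
  · rintro ⟨hq, hq1, hq2⟩
    have hs := Φ.map_target hq
    rw [hΦ.source] at hs
    refine ⟨_, ⟨hq2, (extChartAt (𝓡 n) x₀).map_source hq1, hs.2⟩, ?_⟩
    unfold collarChart
    simp only [(extChartAt (𝓡 n) x₀).left_inv hq1]
    exact Φ.right_inv hq

/-- The collar domain is not open, as it contains `s = 0`; its images are nevertheless open in `M`
because the collar has open target and continuous inverse. -/
theorem isOpen_image_collarChart (hΦ : IsGeodesicCollar gbar ι δ Φ) (x₀ : N)
    {T : Set (EuclideanSpace ℝ (Fin n) × ℝ)} (hT : IsOpen T) :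
    IsOpen (collarChart Φ x₀ '' (T ∩ collarDomain n δ x₀)) := by
  rw [image_collarChart hΦ]
  refine hΦ.smooth_symm.continuousOn.isOpen_inter_preimage hΦ.isOpen_target ?_
  have h1 : IsOpen ((extChartAt (𝓡 n) x₀).source ×ˢ (univ : Set ℝ)) :=
    (isOpen_extChartAt_source (I := 𝓡 n) x₀).prod isOpen_univ
  have h2 : ContinuousOn (fun q : N × ℝ => (extChartAt (𝓡 n) x₀ q.1, q.2))
      ((extChartAt (𝓡 n) x₀).source ×ˢ (univ : Set ℝ)) :=
    ((continuousOn_extChartAt (I := 𝓡 n) x₀).comp continuousOn_fst fun q hq => hq.1).prodMk continuousOn_snd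
  convert! h2.isOpen_inter_preimage h1 hT using 1
  ext q
  simp

theorem contMDiffOn_collarChartInv [IsManifold (𝓡 n) ∞ N] (hΦ : IsGeodesicCollar gbar ι δ Φ)
    (x₀ : N) :
    ContMDiffOn (𝓡∂ (n + 1)) 𝓘(ℝ, EuclideanSpace ℝ (Fin n) × ℝ) ∞ (collarChartInv (n := n) Φ x₀)
      (collarChart Φ x₀ '' collarDomain n δ x₀) := by
  have himg := image_collarChart hΦ x₀ univ
  rw [univ_inter] at himg
  have hsub : collarChart Φ x₀ '' collarDomain n δ x₀ ⊆ Φ.target := by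
    rw [himg]; exact inter_subset_left
  have h1 : ContMDiffOn (𝓡∂ (n + 1)) ((𝓡 n).prod 𝓘(ℝ, ℝ)) ∞ Φ.symm
      (collarChart Φ x₀ '' collarDomain n δ x₀) := hΦ.smooth_symm.mono hsub
  have h2 : ContMDiffOn (𝓡∂ (n + 1)) 𝓘(ℝ, EuclideanSpace ℝ (Fin n)) ∞
      (fun q => extChartAt (𝓡 n) x₀ (Φ.symm q).1) (collarChart Φ x₀ '' collarDomain n δ x₀) := by
    refine (contMDiffOn_extChartAt (n := ∞) (x := x₀)).comp
      (contMDiff_fst.comp_contMDiffOn h1) fun q hq => ?_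
    rw [himg] at hq
    simpa [extChartAt_source] using hq.2.1
  exact h2.prodMk_space (contMDiff_snd.comp_contMDiffOn h1)

/-- By the chain rule the chart acts only on the tangential component and leaves the `∂_s` component
`a` alone, so the normal form `dr² + h_r` carries over to coordinates. -/
theorem exists_collarChartDeriv_eq [IsManifold (𝓡 n) ∞ N] (hΦ : IsGeodesicCollar gbar ι δ Φ) {x₀ : N}
    {p : EuclideanSpace ℝ (Fin n) × ℝ} (hp : p ∈ collarDomain n δ x₀) :
    ∃ B : EuclideanSpace ℝ (Fin n) → EuclideanSpace ℝ (Fin n), ∀ v a,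
      collarChartDeriv Φ δ x₀ p (v, a)
        = collarDeriv Φ δ ((extChartAt (𝓡 n) x₀).symm p.1) p.2 (B v) a := by
  have hu : UniqueMDiffWithinAt 𝓘(ℝ, EuclideanSpace ℝ (Fin n) × ℝ) (collarDomain n δ x₀) p :=
    (uniqueDiffOn_collarDomain x₀).uniqueMDiffOn p hp
  have h1 := ((hΦ.smooth.mdifferentiableOn (by simp)) ((extChartAt (𝓡 n) x₀).symm p.1, p.2)
    ⟨mem_univ _, hp.2⟩)
  have h2 := ((contMDiffOn_extChartAt_symm (I := 𝓡 n) (n := ∞) x₀).mdifferentiableOn (by simp)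
    p.1 hp.1).hasMFDerivWithinAt.comp p
    ((hasFDerivWithinAt_fst (𝕜 := ℝ) (p := p) (s := collarDomain n δ x₀)).hasMFDerivWithinAt)
    fun q hq => hq.1
  have h3 := (hasFDerivWithinAt_snd (𝕜 := ℝ) (p := p)
    (s := collarDomain n δ x₀)).hasMFDerivWithinAt
  have h4 := (h1.hasMFDerivWithinAt.comp p (h2.prodMk h3)
    (mapsTo_chartSymm_prod x₀)).mfderivWithin hu
  refine ⟨fun v => mfderivWithin 𝓘(ℝ, EuclideanSpace ℝ (Fin n)) (𝓡 n) (extChartAt (𝓡 n) x₀).symm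
    (extChartAt (𝓡 n) x₀).target p.1 v, fun v a => ?_⟩
  have h5 := congrArg (fun L : EuclideanSpace ℝ (Fin n) × ℝ →L[ℝ] EuclideanSpace ℝ (Fin (n + 1)) =>
    L (v, a)) h4
  exact h5

end CollarChart

/-! ### Metric and lengths in collar coordinates -/

section CollarLength

variable {n : ℕ}
  {M : Type*} [TopologicalSpace M] [ChartedSpace (EuclideanHalfSpace (n + 1)) M]
  [IsManifold (𝓡∂ (n + 1)) ∞ M]
  {N : Type*} [TopologicalSpace N] [ChartedSpace (EuclideanSpace ℝ (Fin n)) N]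
  [IsManifold (𝓡 n) ∞ N]
  {gbar : SmoothMetric (𝓡∂ (n + 1)) M} {ι : N → M} {δ : ℝ} {Φ : PartialEquiv (N × ℝ) M} {x₀ : N}

theorem inner_collarChartDeriv (hΦ : IsGeodesicCollar gbar ι δ Φ)
    {p : EuclideanSpace ℝ (Fin n) × ℝ} (hp : p ∈ collarDomain n δ x₀)
    (u : EuclideanSpace ℝ (Fin n) × ℝ) :
    gbar.inner (collarChart Φ x₀ p) (collarChartDeriv Φ δ x₀ p u) (collarChartDeriv Φ δ x₀ p u)
      = u.2 ^ 2 + collarMetric gbar Φ δ x₀ p u.1 u.1 := by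
  obtain ⟨B, hB⟩ := exists_collarChartDeriv_eq hΦ hp
  rw [collarMetric_apply]
  have h := hΦ.normal_form ((extChartAt (𝓡 n) x₀).symm p.1) p.2 hp.2 (B u.1) (B u.1) u.2 u.2
  rw [← hB, ← hB] at h
  rw [pow_two]
  exact h

/-- The collar coordinates have a differentiable left inverse. Injectivity is what makes the
coordinate expression of `h_s` positive definite. -/
theorem collarChartDeriv_injective (hΦ : IsGeodesicCollar gbar ι δ Φ)
    {p : EuclideanSpace ℝ (Fin n) × ℝ} (hp : p ∈ collarDomain n δ x₀) :
    Function.Injective (collarChartDeriv Φ δ x₀ p) := by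
  have hu : UniqueMDiffWithinAt 𝓘(ℝ, EuclideanSpace ℝ (Fin n) × ℝ) (collarDomain n δ x₀) p :=
    (uniqueDiffOn_collarDomain x₀).uniqueMDiffOn p hp
  have h1 := ((contMDiffOn_collarChart hΦ x₀).mdifferentiableOn (by simp) p hp).hasMFDerivWithinAt
  have h2 := ((contMDiffOn_collarChartInv hΦ x₀).mdifferentiableOn (by simp) _
    (mem_image_of_mem _ hp)).hasMFDerivWithinAt
  have h3 := h2.comp p h1 (subset_preimage_image _ _)
  have h4 : HasMFDerivWithinAt 𝓘(ℝ, EuclideanSpace ℝ (Fin n) × ℝ)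
      𝓘(ℝ, EuclideanSpace ℝ (Fin n) × ℝ) (collarChartInv (n := n) Φ x₀ ∘ collarChart Φ x₀)
      (collarDomain n δ x₀) p (ContinuousLinearMap.id ℝ (EuclideanSpace ℝ (Fin n) × ℝ)) := by
    refine (hasMFDerivWithinAt_id (I := 𝓘(ℝ, EuclideanSpace ℝ (Fin n) × ℝ))
      (collarDomain n δ x₀) p).congr_of_eventuallyEq ?_ ?_
    · filter_upwards [self_mem_nhdsWithin] with q hq
      exact collarChartInv_collarChart hΦ hq
    · exact collarChartInv_collarChart hΦ hp
  have h5 := hu.eq h3 h4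
  intro u v huv
  have h6 : ∀ u, u = (mfderivWithin (𝓡∂ (n + 1)) 𝓘(ℝ, EuclideanSpace ℝ (Fin n) × ℝ)
      (collarChartInv (n := n) Φ x₀) (collarChart Φ x₀ '' collarDomain n δ x₀)
      (collarChart Φ x₀ p)) (collarChartDeriv Φ δ x₀ p u) := fun u =>
    (congrArg (fun L : EuclideanSpace ℝ (Fin n) × ℝ →L[ℝ] EuclideanSpace ℝ (Fin n) × ℝ => L u)
      h5).symm
  rw [h6 u, h6 v, huv]

theorem isSliceMetric_collarMetric (hΦ : IsGeodesicCollar gbar ι δ Φ) (x₀ : N) :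
    IsSliceMetric (extChartAt (𝓡 n) x₀).target δ (collarMetric gbar Φ δ x₀)
      (fun p => (collarMetric gbar Φ δ x₀ p).inverse) := by
  refine IsSliceMetric.of_pos (fun p _ v w => gbar.symm _ _ _) (fun p hp v hv => ?_) ?_
  · refine gbar.pos _ _ fun h => hv ?_
    have h0 : collarChartDeriv Φ δ x₀ p (v, 0) = collarChartDeriv Φ δ x₀ p 0 := by
      rw [map_zero]; exact h
    exact congrArg Prod.fst (collarChartDeriv_injective hΦ hp h0)
  · refine contDiffOn_clm_apply.2 fun v => contDiffOn_clm_apply.2 fun w => ?_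
    exact contDiffOn_inner_mfderivWithin gbar (contMDiffOn_collarChart hΦ x₀)
      (uniqueDiffOn_collarDomain x₀) (v, 0) (w, 0)

/-- The length of a curve in collar coordinates, for a conformal metric `e^{2tw} ḡ`. -/
theorem pathELength_collarChart (hΦ : IsGeodesicCollar gbar ι δ Φ) (t : ℝ) {w : M → ℝ}
    (hw : ContMDiff (𝓡∂ (n + 1)) 𝓘(ℝ, ℝ) ∞ (fun p => t * w p))
    {c : ℝ → EuclideanSpace ℝ (Fin n) × ℝ} {a b : ℝ} (hab : a < b)
    (hc : ContDiffOn ℝ 1 c (Icc a b)) (hcm : MapsTo c (Icc a b) (collarDomain n δ x₀)) :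
    letI : RiemannianBundle (fun x : M => TangentSpace (𝓡∂ (n + 1)) x) :=
      ⟨(gbar.conformal (fun p => t * w p) hw).toRiemannianMetric⟩
    Manifold.pathELength (𝓡∂ (n + 1)) (fun τ => collarChart Φ x₀ (c τ)) a b
      = ∫⁻ τ in Icc a b, ENNReal.ofReal (speed t (fun p => w (collarChart Φ x₀ p))
          (collarMetric gbar Φ δ x₀) (c τ) (derivWithin c (Icc a b) τ)) := by
  let _ : RiemannianBundle (fun x : M => TangentSpace (𝓡∂ (n + 1)) x) :=
      ⟨(gbar.conformal (fun p => t * w p) hw).toRiemannianMetric⟩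
  rw [Manifold.pathELength_eq_lintegral_mfderivWithin_Icc]
  refine setLIntegral_congr_fun measurableSet_Icc fun τ hτ => ?_
  have hu : UniqueMDiffWithinAt 𝓘(ℝ, ℝ) (Icc a b) τ :=
    (uniqueDiffOn_Icc hab).uniqueMDiffOn τ hτ
  have h1 := ((contMDiffOn_collarChart hΦ x₀).mdifferentiableOn (by simp) (c τ)
    (hcm hτ)).hasMFDerivWithinAt
  have h2 := (hc.differentiableOn (by simp) τ hτ).hasDerivWithinAt.hasFDerivWithinAt
  have h3 : mfderivWithin 𝓘(ℝ, ℝ) (𝓡∂ (n + 1)) (fun τ => collarChart Φ x₀ (c τ)) (Icc a b) τ 1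
      = collarChartDeriv Φ δ x₀ (c τ) (derivWithin c (Icc a b) τ) := by
    have h4 := (h1.comp τ h2.hasMFDerivWithinAt hcm).mfderivWithin hu
    have h5 := congrArg (fun L : ℝ →L[ℝ] EuclideanSpace ℝ (Fin (n + 1)) => L 1) h4
    refine h5.trans ?_
    change collarChartDeriv Φ δ x₀ (c τ) ((1 : ℝ) • derivWithin c (Icc a b) τ) = _
    rw [one_smul]
  rw [h3, enorm_eq_of_metric]
  congr 1
  have h6 := inner_collarChartDeriv hΦ (hcm hτ) (derivWithin c (Icc a b) τ)
  refine (congrArg (fun z : ℝ => √(Real.exp (2 * (t * w (collarChart Φ x₀ (c τ)))) * z)) h6).trans ?_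
  rw [Real.sqrt_mul (Real.exp_pos _).le, two_mul, Real.exp_add,
    Real.sqrt_mul_self (Real.exp_pos _).le, speed]

end CollarLength

/-! ### Riemannian balls and the topology of `M` -/

section Thickening

variable {m : ℕ} {H : Type*} [TopologicalSpace H]
  {I : ModelWithCorners ℝ (EuclideanSpace ℝ (Fin m)) H}
  {M : Type*} [TopologicalSpace M] [ChartedSpace H M] [IsManifold I ∞ M]

/-- The Riemannian distance induces the topology of `M`, so a compact set in an open one has a
uniform thickening there. Thus short curves from a compact part of a patch cannot leave it. -/
theorem exists_riemannianEDist_lt_subset [RegularSpace M] (g : SmoothMetric I M) {K O : Set M}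
    (hK : IsCompact K) (hO : IsOpen O) (hKO : K ⊆ O) :
    letI : RiemannianBundle (fun x : M => TangentSpace I x) := ⟨g.toRiemannianMetric⟩
    ∃ c : ℝ, 0 < c ∧ ∀ p ∈ K, ∀ q, Manifold.riemannianEDist I p q < ENNReal.ofReal c → q ∈ O := by
  let _ : RiemannianBundle (fun x : M => TangentSpace I x) := ⟨g.toRiemannianMetric⟩
  have : IsContinuousRiemannianBundle (EuclideanSpace ℝ (Fin m))
      (fun x : M => TangentSpace I x) :=
    ⟨⟨g.inner, g.contMDiff.continuous, fun _ _ _ => rfl⟩⟩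
  have : IsManifold I 1 M := IsManifold.of_le (n := ∞) (by exact_mod_cast le_top)
  let _ : PseudoEMetricSpace M := PseudoEMetricSpace.ofRiemannianMetric I M
  obtain ⟨c, hc, hcO⟩ := hK.exists_thickening_subset_open hO hKO
  refine ⟨c, hc, fun p hp q hq => hcO ?_⟩
  rw [Metric.mem_thickening_iff_exists_edist_lt]
  refine ⟨p, hp, ?_⟩
  rw [edist_comm]
  exact hq

end Thickening

/-! ### Comparison of the barriers with the distance to `∂M` -/

section CollarDistance

variable {n : ℕ}
  {M : Type*} [TopologicalSpace M] [ChartedSpace (EuclideanHalfSpace (n + 1)) M]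
  [IsManifold (𝓡∂ (n + 1)) ∞ M]
  {N : Type*} [TopologicalSpace N] [ChartedSpace (EuclideanSpace ℝ (Fin n)) N]
  {gbar : SmoothMetric (𝓡∂ (n + 1)) M} {ι : N → M} {δ : ℝ} {Φ : PartialEquiv (N × ℝ) M} {x₀ : N}
  {w : M → ℝ} {m : ℕ} {α : ℕ → ℝ × EuclideanSpace ℝ (Fin n) → ℝ}

theorem snd_eq_zero_of_mem_boundary (hΦ : IsGeodesicCollar gbar ι δ Φ)
    (hι : range ι = (𝓡∂ (n + 1)).boundary M) {x : N} {s : ℝ} (hs : s ∈ Ico 0 δ)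
    (h : Φ (x, s) ∈ (𝓡∂ (n + 1)).boundary M) : s = 0 := by
  rw [← hι] at h
  obtain ⟨x', hx'⟩ := h
  rw [← hΦ.zero] at hx'
  have h0 : (x', (0 : ℝ)) ∈ Φ.source := by
    rw [hΦ.source]; exact mk_mem_prod (mem_univ _) (left_mem_Ico.2 hΦ.pos)
  have h2 : (x, s) ∈ Φ.source := by rw [hΦ.source]; exact mk_mem_prod (mem_univ _) hs
  have h1 := Φ.injOn h0 h2 hx'
  exact (congrArg Prod.snd h1).symm

variable [IsManifold (𝓡 n) ∞ N]

/-- The descent curve of the supersolution, pushed into `M`, is a competitor for the distance ending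
on `∂M`. -/
theorem distBoundary_le_radius (hΦ : IsGeodesicCollar gbar ι δ Φ)
    (hι : range ι = (𝓡∂ (n + 1)).boundary M) {t : ℝ}
    (hw : ContMDiff (𝓡∂ (n + 1)) 𝓘(ℝ, ℝ) ∞ (fun p => t * w p))
    (hα : ∀ k, ContDiffOn ℝ ∞ (α k) (univ ×ˢ (extChartAt (𝓡 n) x₀).target))
    {y₀ : EuclideanSpace ℝ (Fin n)} {ρ s₁ : ℝ} (hρ : 0 < ρ) (hs₁ : 0 < s₁)
    (hK : Metric.closedBall y₀ ρ ×ˢ Icc 0 s₁ ⊆ collarDomain n δ x₀)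
    (h : ∀ p ∈ Metric.closedBall y₀ ρ ×ˢ Icc 0 s₁,
      0 ≤ eikonal (fun p => w (collarChart Φ x₀ p))
        (fun p => (collarMetric gbar Φ δ x₀ p).inverse) m α ((t, p.1), p.2))
    (hA : ∀ p ∈ Metric.closedBall y₀ ρ ×ˢ Icc 0 s₁,
      0 < 1 + phaseRadial m α ((t, p.1), p.2)) :
    ∃ s₂, 0 < s₂ ∧ ∀ y ∈ Metric.closedBall y₀ (ρ / 2), ∀ s ∈ Ioo 0 s₂,
      distBoundary (gbar.conformal (fun p => t * w p) hw) (collarChart Φ x₀ (y, s))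
        ≤ ENNReal.ofReal (radius t m α (y, s)) := by
  obtain ⟨s₂, hs₂, -, hcurve⟩ := exists_curve_length_le_radius (isOpen_target_chart x₀)
    (isSliceMetric_collarMetric hΦ x₀) hα hρ hs₁ hK h hA
  refine ⟨s₂, hs₂, fun y hy s hs => ?_⟩
  obtain ⟨c, hc, hcm, hcs, hc0, hlen⟩ := hcurve y hy s hs
  let _ : RiemannianBundle (fun x : M => TangentSpace (𝓡∂ (n + 1)) x) :=
      ⟨(gbar.conformal (fun p => t * w p) hw).toRiemannianMetric⟩
  have hq : collarChart Φ x₀ (c 0) ∈ (𝓡∂ (n + 1)).boundary M := by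
    rw [← hι]
    refine ⟨(extChartAt (𝓡 n) x₀).symm (c 0).1, ?_⟩
    rw [collarChart, hc0, hΦ.zero]
  unfold distBoundary
  refine iInf₂_le_of_le _ hq ?_
  rw [Manifold.riemannianEDist_comm]
  have hcM : ContMDiffOn 𝓘(ℝ, ℝ) (𝓡∂ (n + 1)) 1 (fun τ => collarChart Φ x₀ (c τ)) (Icc 0 s) :=
    ((contMDiffOn_collarChart hΦ x₀).of_le (by exact_mod_cast le_top)).comp
      (contMDiffOn_iff_contDiffOn.2 hc) hcm
  refine (Manifold.riemannianEDist_le_pathELength hcM rfl (by rw [hcs]) hs.1.le).trans ?_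
  rw [pathELength_collarChart hΦ t hw hs.1 hc hcm]
  exact hlen

/-- A curve to `∂M` shorter than the subsolution would be too short to leave the patch; read in
coordinates, it contradicts the Lipschitz bound there. -/
theorem radius_le_distBoundary [RegularSpace M] (hΦ : IsGeodesicCollar gbar ι δ Φ)
    (hι : range ι = (𝓡∂ (n + 1)).boundary M) {t : ℝ}
    (hw : ContMDiff (𝓡∂ (n + 1)) 𝓘(ℝ, ℝ) ∞ (fun p => t * w p))
    (hα : ∀ k, ContDiffOn ℝ ∞ (α k) (univ ×ˢ (extChartAt (𝓡 n) x₀).target))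
    {y₀ : EuclideanSpace ℝ (Fin n)} {ρ s₁ : ℝ} (hρ : 0 < ρ) (hs₁ : 0 < s₁)
    (hK : Metric.closedBall y₀ ρ ×ˢ Icc 0 s₁ ⊆ collarDomain n δ x₀)
    (h : ∀ p ∈ Metric.closedBall y₀ ρ ×ˢ Icc 0 s₁,
      eikonal (fun p => w (collarChart Φ x₀ p))
        (fun p => (collarMetric gbar Φ δ x₀ p).inverse) m α ((t, p.1), p.2) ≤ 0) :
    ∃ s₂, 0 < s₂ ∧ ∀ y ∈ Metric.closedBall y₀ (ρ / 2), ∀ s ∈ Ioo 0 s₂,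
      ENNReal.ofReal (radius t m α (y, s))
        ≤ distBoundary (gbar.conformal (fun p => t * w p) hw) (collarChart Φ x₀ (y, s)) := by
  set g := gbar.conformal (fun p => t * w p) hw with hg
  set K₁ := Metric.closedBall y₀ (ρ / 2) ×ˢ Icc 0 (s₁ / 2) with hK₁
  have hK₁c : IsCompact K₁ := (isCompact_closedBall y₀ _).prod isCompact_Icc
  set T : Set (EuclideanSpace ℝ (Fin n) × ℝ) := Metric.ball y₀ ρ ×ˢ Iio s₁ with hT
  have hTo : IsOpen T := Metric.isOpen_ball.prod isOpen_Iio
  have hTK : T ∩ collarDomain n δ x₀ ⊆ Metric.closedBall y₀ ρ ×ˢ Icc 0 s₁ :=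
    fun p hp => ⟨Metric.ball_subset_closedBall hp.1.1, hp.2.2.1, le_of_lt hp.1.2⟩
  have hK₁T : K₁ ⊆ T ∩ collarDomain n δ x₀ := by
    intro p hp
    have h1 : p.1 ∈ Metric.ball y₀ ρ := Metric.closedBall_subset_ball (by linarith) hp.1
    refine ⟨⟨h1, ?_⟩, hK ⟨Metric.ball_subset_closedBall h1, hp.2.1, ?_⟩⟩
    · exact hp.2.2.trans_lt (by linarith)
    · exact hp.2.2.trans (by linarith)
  have hΨ := contMDiffOn_collarChart hΦ x₀
  have himg : IsCompact (collarChart Φ x₀ '' K₁) :=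
    hK₁c.image_of_continuousOn (hΨ.continuousOn.mono (hK₁T.trans inter_subset_right))
  obtain ⟨c₀, hc₀, hnear⟩ := exists_riemannianEDist_lt_subset g himg
    (isOpen_image_collarChart hΦ x₀ hTo) (image_mono hK₁T)
  obtain ⟨B, hB⟩ := hK₁c.exists_bound_of_continuousOn
    (f := fun p => Real.exp (phase m α ((t, p.1), p.2))) (by
      refine ((contDiffOn_phase (δ := δ) hα m).continuousOn.comp (by fun_prop) ?_).rexp
      exact fun p hp => ⟨⟨mem_univ _, (hK₁T hp).2.1⟩, (hK₁T hp).2.2⟩)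
  have hB0 : 0 ≤ B := (norm_nonneg _).trans (hB (y₀, 0)
    ⟨Metric.mem_closedBall_self (by positivity), le_rfl, by positivity⟩)
  -- The first bound places the point in `K₁`, the second makes `s e^a ≤ c₀`, the length below which
  -- curves stay in the patch.
  refine ⟨min (s₁ / 2) (c₀ / (B + 1)), by positivity, fun y hy s hs => ?_⟩
  have hyK : (y, s) ∈ K₁ := ⟨hy, hs.1.le, hs.2.le.trans (min_le_left _ _)⟩
  have hrc : radius t m α (y, s) ≤ c₀ := by
    have h1 := (le_abs_self _).trans (hB _ hyK)
    have h2 : s * (B + 1) ≤ c₀ := by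
      have := hs.2.le.trans (min_le_right _ _)
      rwa [le_div_iff₀ (by positivity)] at this
    have := hs.1
    unfold radius
    simp only at h1 ⊢
    nlinarith
  let _ : RiemannianBundle (fun x : M => TangentSpace (𝓡∂ (n + 1)) x) := ⟨g.toRiemannianMetric⟩
  unfold distBoundary
  refine le_iInf₂ fun q hq => ?_
  by_contra hcon
  rw [not_le] at hcon
  obtain ⟨γ, hγ0, hγ1, hγ, hlen⟩ := Manifold.exists_lt_of_riemannianEDist_lt hcon
  -- Each initial segment of `γ` is shorter than `c₀`, so every point of `γ`, not just its endpoint,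
  -- lies in the patch.
  have hmem : ∀ τ ∈ Icc (0 : ℝ) 1, γ τ ∈ collarChart Φ x₀ '' (T ∩ collarDomain n δ x₀) := by
    intro τ hτ
    refine hnear _ (mem_image_of_mem _ hyK) _ ?_
    refine lt_of_le_of_lt ?_ (hlen.trans_le (ENNReal.ofReal_le_ofReal hrc))
    refine (Manifold.riemannianEDist_le_pathELength
      (hγ.mono (Icc_subset_Icc_right hτ.2)) hγ0 rfl hτ.1).trans ?_
    exact Manifold.pathELength_mono le_rfl hτ.2
  set c : ℝ → EuclideanSpace ℝ (Fin n) × ℝ := fun τ => collarChartInv Φ x₀ (γ τ) with hc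
  have hcT : ∀ τ ∈ Icc (0 : ℝ) 1, c τ ∈ T ∩ collarDomain n δ x₀ ∧
      collarChart Φ x₀ (c τ) = γ τ := by
    intro τ hτ
    obtain ⟨p, hp, hpγ⟩ := hmem τ hτ
    have : c τ = p := by
      simp only [hc, ← hpγ]
      exact collarChartInv_collarChart hΦ hp.2
    rw [this]
    exact ⟨hp, hpγ⟩
  have hcd : ContDiffOn ℝ 1 c (Icc 0 1) := by
    refine contMDiffOn_iff_contDiffOn.1 (((contMDiffOn_collarChartInv hΦ x₀).of_le
      (by exact_mod_cast le_top)).comp hγ fun τ hτ => ?_)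
    exact image_mono inter_subset_right (hmem τ hτ)
  have hc1 : (c 1).2 = 0 := by
    have h1 := hcT 1 (right_mem_Icc.2 zero_le_one)
    refine snd_eq_zero_of_mem_boundary (x := (extChartAt (𝓡 n) x₀).symm (c 1).1) hΦ hι h1.1.2.2 ?_
    change collarChart Φ x₀ (c 1) ∈ _
    rw [h1.2, hγ1]
    exact hq
  have hc0 : c 0 = (y, s) := by
    simp only [hc, hγ0]
    exact collarChartInv_collarChart hΦ (hK₁T hyK).2
  have key := radius_le_length (isOpen_target_chart x₀) (isSliceMetric_collarMetric hΦ x₀) hα hK h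
    hcd (fun τ hτ => hTK (hcT τ hτ).1) hc1
  rw [hc0, ← pathELength_collarChart hΦ t hw zero_lt_one hcd fun τ hτ => (hcT τ hτ).1.2,
    Manifold.pathELength_congr fun τ hτ => (hcT τ hτ).2] at key
  exact absurd hlen (not_lt.2 key)

end CollarDistance

/-! ### Expansion of the distance to the boundary -/

section DistanceExpansion

variable {n : ℕ}
  {M : Type*} [TopologicalSpace M] [ChartedSpace (EuclideanHalfSpace (n + 1)) M]
  [IsManifold (𝓡∂ (n + 1)) ∞ M]
  {N : Type*} [TopologicalSpace N] [ChartedSpace (EuclideanSpace ℝ (Fin n)) N]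

/-- The distance to the boundary of `e^{2tw} ḡ`, at `Φ (x, s)` for `x ∈ A`, has the expansion
`s exp (∑ a_k(t, x) s^k + O(s^{n+1}))`. -/
structure HasDistanceExpansion [MeasurableSpace N] (gbar : SmoothMetric (𝓡∂ (n + 1)) M) (δ : ℝ)
    (Φ : PartialEquiv (N × ℝ) M) {w : M → ℝ} (hw : ContMDiff (𝓡∂ (n + 1)) 𝓘(ℝ, ℝ) ∞ w)
    (A : Set N) (a : ℕ → ℝ → N → ℝ) : Prop where
  measurable : ∀ k t, Measurable (a k t)
  bounded : ∀ k t, ∃ B, ∀ x ∈ A, |a k t x| ≤ B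
  lipschitz : ∀ k, ∃ B, ∀ t, |t| ≤ 1 → ∀ x ∈ A, |a k t x - a k 0 x| ≤ B * |t|
  hasDerivAt : ∀ k < n + 1, ∀ x ∈ A,
    HasDerivAt (fun t => a k t x) (normalDeriv Φ δ w k x / (k + 1).factorial) 0
  bound : ∀ t, ∃ C s₀, 0 ≤ C ∧ 0 < s₀ ∧ s₀ < δ ∧ ∀ x ∈ A, ∀ s ∈ Ioo 0 s₀,
    ENNReal.ofReal (s * Real.exp ((∑ k ∈ Finset.range (n + 1), a k t x * s ^ k)
        - C * s ^ (n + 1)))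
      ≤ distBoundary (gbar.conformal (fun p => t * w p) (contMDiff_const.mul hw)) (Φ (x, s)) ∧
    distBoundary (gbar.conformal (fun p => t * w p) (contMDiff_const.mul hw)) (Φ (x, s))
      ≤ ENNReal.ofReal (s * Real.exp ((∑ k ∈ Finset.range (n + 1), a k t x * s ^ k)
        + C * s ^ (n + 1)))

variable {gbar : SmoothMetric (𝓡∂ (n + 1)) M} {ι : N → M} {δ : ℝ} {Φ : PartialEquiv (N × ℝ) M}
  {w : M → ℝ} {hw : ContMDiff (𝓡∂ (n + 1)) 𝓘(ℝ, ℝ) ∞ w}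

theorem HasDistanceExpansion.mono [MeasurableSpace N] {A B : Set N} {a : ℕ → ℝ → N → ℝ}
    (h : HasDistanceExpansion gbar δ Φ hw B a) (hAB : A ⊆ B) :
    HasDistanceExpansion gbar δ Φ hw A a where
  measurable := h.measurable
  bounded k t := (h.bounded k t).imp fun _ hB x hx => hB x (hAB hx)
  lipschitz k := (h.lipschitz k).imp fun _ hB t ht x hx => hB t ht x (hAB hx)
  hasDerivAt k hk x hx := h.hasDerivAt k hk x (hAB hx)
  bound t := by
    obtain ⟨C, s₀, h1, h2, h3, h4⟩ := h.bound t
    exact ⟨C, s₀, h1, h2, h3, fun x hx => h4 x (hAB hx)⟩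

-- Since only measurability and bounds in `x` are required, coefficients can be cut and pasted. No
-- agreement between charts has to be proved.
open scoped Classical in
theorem HasDistanceExpansion.union [MeasurableSpace N] {A B : Set N} {a b : ℕ → ℝ → N → ℝ}
    (hA : MeasurableSet A)
    (ha : HasDistanceExpansion gbar δ Φ hw A a) (hb : HasDistanceExpansion gbar δ Φ hw B b) :
    HasDistanceExpansion gbar δ Φ hw (A ∪ B)
      (fun k t x => if x ∈ A then a k t x else b k t x) where
  measurable k t := Measurable.ite hA (ha.measurable k t) (hb.measurable k t)
  bounded k t := by
    obtain ⟨B₁, h1⟩ := ha.bounded k t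
    obtain ⟨B₂, h2⟩ := hb.bounded k t
    refine ⟨max B₁ B₂, fun x hx => ?_⟩
    by_cases hxA : x ∈ A
    · simpa [hxA] using Or.inl (h1 x hxA)
    · simpa [hxA] using Or.inr (h2 x (hx.resolve_left hxA))
  lipschitz k := by
    obtain ⟨B₁, h1⟩ := ha.lipschitz k
    obtain ⟨B₂, h2⟩ := hb.lipschitz k
    refine ⟨max B₁ B₂, fun t ht x hx => ?_⟩
    by_cases hxA : x ∈ A
    · simp only [hxA, if_true]
      exact (h1 t ht x hxA).trans (by gcongr; exact le_max_left _ _)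
    · simp only [hxA, if_false]
      exact (h2 t ht x (hx.resolve_left hxA)).trans (by gcongr; exact le_max_right _ _)
  hasDerivAt k hk x hx := by
    by_cases hxA : x ∈ A
    · simpa only [hxA, if_true] using ha.hasDerivAt k hk x hxA
    · simpa only [hxA, if_false] using hb.hasDerivAt k hk x (hx.resolve_left hxA)
  bound t := by
    obtain ⟨C₁, s₁, hC₁, hs₁, hsδ, h1⟩ := ha.bound t
    obtain ⟨C₂, s₂, hC₂, hs₂, -, h2⟩ := hb.bound t
    refine ⟨max C₁ C₂, min s₁ s₂, hC₁.trans (le_max_left _ _), lt_min hs₁ hs₂,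
      (min_le_left _ _).trans_lt hsδ, fun x hx s hs => ?_⟩
    have hs0 : 0 < s := hs.1
    by_cases hxA : x ∈ A
    · obtain ⟨h3, h4⟩ := h1 x hxA s ⟨hs.1, hs.2.trans_le (min_le_left _ _)⟩
      simp only [hxA, if_true]
      refine ⟨le_trans ?_ h3, h4.trans ?_⟩ <;>
      · gcongr
        exact le_max_left _ _
    · obtain ⟨h3, h4⟩ := h2 x (hx.resolve_left hxA) s ⟨hs.1, hs.2.trans_le (min_le_right _ _)⟩
      simp only [hxA, if_false]
      refine ⟨le_trans ?_ h3, h4.trans ?_⟩ <;>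
      · gcongr
        exact le_max_right _ _

theorem collarChart_extChartAt {x₀ x : N} (hx : x ∈ (extChartAt (𝓡 n) x₀).source) (s : ℝ) :
    collarChart Φ x₀ (extChartAt (𝓡 n) x₀ x, s) = Φ (x, s) := by
  unfold collarChart
  simp only [(extChartAt (𝓡 n) x₀).left_inv hx]

theorem normalDeriv_eq_sliceCoeff [IsManifold (𝓡 n) ∞ N] (hΦ : IsGeodesicCollar gbar ι δ Φ)
    (hw : ContMDiff (𝓡∂ (n + 1)) 𝓘(ℝ, ℝ) ∞ w) {x₀ x : N}
    (hx : x ∈ (extChartAt (𝓡 n) x₀).source) (k : ℕ) :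
    normalDeriv Φ δ w k x = k.factorial * sliceCoeff (extChartAt (𝓡 n) x₀).target δ
      (fun p => w (collarChart Φ x₀ p)) k (extChartAt (𝓡 n) x₀ x) := by
  have h1 : ContDiffOn ℝ ∞ (fun p => w (collarChart Φ x₀ p)) (collarDomain n δ x₀) :=
    contMDiffOn_iff_contDiffOn.1 (hw.comp_contMDiffOn (contMDiffOn_collarChart hΦ x₀))
  have h2 := iteratedDerivWithin_slice (isOpen_target_chart x₀)
    ((extChartAt (𝓡 n) x₀).map_source hx) k h1 0 (left_mem_Ico.2 hΦ.pos)
  simp only [collarChart_extChartAt hx] at h2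
  have hk : (k.factorial : ℝ) ≠ 0 := by positivity
  unfold normalDeriv sliceCoeff
  rw [h2]
  field_simp

/-- Mean value inequality on `[-1, 1] × K`. The uniform constant later dominates the difference
quotients under the integral over the boundary. -/
theorem exists_lipschitz_fst {E : Type*} [NormedAddCommGroup E] [NormedSpace ℝ E] {U K : Set E}
    {f : ℝ × E → ℝ} (hU : IsOpen U) (hf : ContDiffOn ℝ ∞ f (univ ×ˢ U)) (hK : IsCompact K)
    (hKU : K ⊆ U) :
    ∃ B, ∀ t : ℝ, |t| ≤ 1 → ∀ y ∈ K, |f (t, y) - f (0, y)| ≤ B * |t| := by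
  have hVo : IsOpen (univ ×ˢ U : Set (ℝ × E)) := isOpen_univ.prod hU
  have hK1 : IsCompact (Icc (-1 : ℝ) 1 ×ˢ K) := isCompact_Icc.prod hK
  have hK1U : Icc (-1 : ℝ) 1 ×ˢ K ⊆ univ ×ˢ U := prod_mono (subset_univ _) hKU
  obtain ⟨B, hB⟩ := hK1.exists_bound_of_continuousOn
    (((hf.continuousOn_fderiv_of_isOpen hVo (by simp)).clm_apply
      (continuousOn_const (c := ((1 : ℝ), (0 : E))))).mono hK1U)
  refine ⟨B, fun t ht y hy => ?_⟩
  have hd : ∀ τ ∈ Icc (-1 : ℝ) 1, HasDerivWithinAt (fun τ => f (τ, y))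
      (fderiv ℝ f (τ, y) (1, 0)) (Icc (-1) 1) τ := by
    intro τ _
    have h1 := ((hf.differentiableOn (by simp)).differentiableAt
      (hVo.mem_nhds (mk_mem_prod (mem_univ τ) (hKU hy)))).hasFDerivAt
    exact (h1.comp_hasDerivAt τ ((hasDerivAt_id τ).prodMk (hasDerivAt_const τ y))).hasDerivWithinAt
  have h2 := (convex_Icc (-1 : ℝ) 1).norm_image_sub_le_of_norm_hasDerivWithin_le hd
    (fun τ hτ => hB (τ, y) ⟨hτ, hy⟩) (x := 0) (y := t) (by simp) (abs_le.1 ht)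
  simpa using h2

theorem isOpen_image_collar (hΦ : IsGeodesicCollar gbar ι δ Φ) (s₁ : ℝ) :
    IsOpen (Φ '' (univ ×ˢ (Ico 0 δ ∩ Iio s₁))) := by
  have h : Φ '' (univ ×ˢ (Ico 0 δ ∩ Iio s₁)) = Φ.target ∩ Φ.symm ⁻¹' (univ ×ˢ Iio s₁) := by
    rw [← Φ.image_source_inter_eq', hΦ.source]
    congr 1
    ext p
    simp [and_assoc]
  rw [h]
  exact hΦ.smooth_symm.continuousOn.isOpen_inter_preimage hΦ.isOpen_target
    (isOpen_univ.prod isOpen_Iio)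

/-- The compact boundary has a thickening inside the collar. For small `ε`, therefore, the part of
`M` outside the collar lies entirely in `{r̂ > ε}` and contributes a volume that does not depend on
the conformal factor. -/
theorem exists_le_distBoundary_of_notMem [RegularSpace M] [CompactSpace N] (hιc : Continuous ι)
    (hΦ : IsGeodesicCollar gbar ι δ Φ) (hι : range ι = (𝓡∂ (n + 1)).boundary M)
    (g : SmoothMetric (𝓡∂ (n + 1)) M) {s₁ : ℝ} (hs₁ : 0 < s₁) :
    ∃ c : ℝ, 0 < c ∧ ∀ p, p ∉ Φ '' (univ ×ˢ (Ico 0 δ ∩ Iio s₁)) →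
      ENNReal.ofReal c ≤ distBoundary g p := by
  obtain ⟨c, hc, h⟩ := exists_riemannianEDist_lt_subset g (isCompact_range hιc)
    (isOpen_image_collar hΦ s₁) (by
      rintro _ ⟨x, rfl⟩
      exact ⟨(x, 0), ⟨mem_univ _, left_mem_Ico.2 hΦ.pos, hs₁⟩, hΦ.zero x⟩)
  refine ⟨c, hc, fun p hp => ?_⟩
  let _ : RiemannianBundle (fun x : M => TangentSpace (𝓡∂ (n + 1)) x) := ⟨g.toRiemannianMetric⟩
  unfold distBoundary
  refine le_iInf₂ fun q hq => ?_
  by_contra hcon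
  rw [not_le, Manifold.riemannianEDist_comm] at hcon
  exact hp (h q (hι ▸ hq) p hcon)

variable [MeasurableSpace N] [BorelSpace N] [IsManifold (𝓡 n) ∞ N]

/-- In one chart: a formal solution with `n + 1` coefficients has defect `O(s^{n+1})`, and the
barriers built on it trap the distance up to `±C s^{n+1}` in the exponent. -/
theorem exists_hasDistanceExpansion_nhds [RegularSpace M] (hΦ : IsGeodesicCollar gbar ι δ Φ)
    (hι : range ι = (𝓡∂ (n + 1)).boundary M) (hw : ContMDiff (𝓡∂ (n + 1)) 𝓘(ℝ, ℝ) ∞ w) (x₀ : N) :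
    ∃ A ∈ 𝓝 x₀, MeasurableSet A ∧ ∃ a, HasDistanceExpansion gbar δ Φ hw A a := by
  classical
  set φ := extChartAt (𝓡 n) x₀ with hφ
  have hU : IsOpen φ.target := isOpen_target_chart x₀
  set w' : EuclideanSpace ℝ (Fin n) × ℝ → ℝ := fun p => w (collarChart Φ x₀ p) with hw'
  have hw's : ContDiffOn ℝ ∞ w' (φ.target ×ˢ Ico 0 δ) :=
    contMDiffOn_iff_contDiffOn.1 (hw.comp_contMDiffOn (contMDiffOn_collarChart hΦ x₀))
  have hH := isSliceMetric_collarMetric hΦ x₀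
  obtain ⟨α, hα, hα0, -, hE⟩ := exists_formal_eikonal hU hΦ.pos hw's hH.contDiffOn n
  obtain ⟨ρ, hρ, hρU⟩ := Metric.nhds_basis_closedBall.mem_iff.1
    (hU.mem_nhds (mem_extChartAt_target (I := 𝓡 n) x₀))
  set K := Metric.closedBall (φ x₀) ρ with hK
  have hKc : IsCompact K := isCompact_closedBall _ _
  set A := φ.source ∩ φ ⁻¹' (Metric.ball (φ x₀) (ρ / 2)) with hA
  have hAo : IsOpen A := (continuousOn_extChartAt x₀).isOpen_inter_preimage
    (isOpen_extChartAt_source x₀) Metric.isOpen_ball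
  have hAK : ∀ x ∈ A, φ x ∈ Metric.closedBall (φ x₀) (ρ / 2) := fun x hx =>
    Metric.ball_subset_closedBall hx.2
  have hAK' : ∀ x ∈ A, φ x ∈ K := fun x hx =>
    Metric.closedBall_subset_closedBall (by linarith) (hAK x hx)
  -- The coefficients are extended by 0 outside `A` to be measurable on all of `N`.
  refine ⟨A, hAo.mem_nhds ⟨mem_extChartAt_source x₀, Metric.mem_ball_self (by positivity)⟩,
    hAo.measurableSet, fun k t x => if x ∈ A then α k (t, φ x) else 0, ?_⟩
  have hcont : ∀ k t, ContinuousOn (fun y => α k (t, y)) φ.target := fun k t =>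
    (hα k).continuousOn.comp (by fun_prop) fun y hy => ⟨mem_univ _, hy⟩
  constructor
  · intro k t
    have h1 : ContinuousOn (fun x => α k (t, φ x)) A :=
      (hcont k t).comp ((continuousOn_extChartAt x₀).mono inter_subset_left)
        fun x hx => φ.map_source hx.1
    exact h1.measurable_piecewise continuousOn_const hAo.measurableSet
  · intro k t
    obtain ⟨B, hB⟩ := hKc.exists_bound_of_continuousOn ((hcont k t).mono hρU)
    refine ⟨B, fun x hx => ?_⟩
    simpa only [hx, if_true, Real.norm_eq_abs] using hB _ (hAK' x hx)
  · intro k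
    obtain ⟨B, hB⟩ := exists_lipschitz_fst hU (hα k) hKc hρU
    refine ⟨B, fun t ht x hx => ?_⟩
    simpa only [hx, if_true] using hB t ht _ (hAK' x hx)
  · intro k hk x hx
    simp only [hx, if_true]
    convert (hα0 k hk (φ x) (φ.map_source hx.1)).2 using 1
    rw [normalDeriv_eq_sliceCoeff hΦ hw hx.1, Nat.factorial_succ]
    have hk : (k.factorial : ℝ) ≠ 0 := by positivity
    push_cast
    field_simp
    rfl
  · intro t
    obtain ⟨C, s₁, hC, hs₁, hs₁δ, hbar⟩ := exists_barrier hU hΦ.pos hw's hH.contDiffOn hα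
      (Nat.le_add_left 1 n) hE t hKc hρU
    have hKs : K ×ˢ Icc 0 s₁ ⊆ collarDomain n δ x₀ := fun p hp =>
      ⟨hρU hp.1, hp.2.1, hp.2.2.trans_lt hs₁δ⟩
    have hα' : ∀ c : ℝ, ∀ k, ContDiffOn ℝ ∞ (Function.update α (n + 1) (fun _ => c) k)
        (univ ×ˢ φ.target) := by
      intro c k
      rcases eq_or_ne k (n + 1) with rfl | hk
      · simpa using contDiffOn_const
      · simpa [hk] using hα k
    obtain ⟨s₂, hs₂, hlow⟩ := radius_le_distBoundary hΦ hι (t := t) (contMDiff_const.mul hw)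
      (hα' (-C)) hρ hs₁ hKs fun p hp => (hbar p.1 hp.1 p.2 hp.2).1
    obtain ⟨s₃, hs₃, hupp⟩ := distBoundary_le_radius hΦ hι (t := t) (contMDiff_const.mul hw)
      (hα' C) hρ hs₁ hKs (fun p hp => (hbar p.1 hp.1 p.2 hp.2).2.1)
      fun p hp => (hbar p.1 hp.1 p.2 hp.2).2.2
    refine ⟨C, min (min s₂ s₃) s₁, hC, by positivity, (min_le_right _ _).trans_lt hs₁δ,
      fun x hx s hs => ?_⟩
    have h1 := hlow _ (hAK x hx) s
      ⟨hs.1, hs.2.trans_le ((min_le_left _ _).trans (min_le_left _ _))⟩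
    have h2 := hupp _ (hAK x hx) s
      ⟨hs.1, hs.2.trans_le ((min_le_left _ _).trans (min_le_right _ _))⟩
    rw [collarChart_extChartAt hx.1, radius, phase_update] at h1 h2
    simp only [hx, if_true]
    refine ⟨?_, h2⟩
    rw [sub_eq_add_neg, ← neg_mul]
    exact h1

theorem exists_hasDistanceExpansion [RegularSpace M] [CompactSpace N]
    (hΦ : IsGeodesicCollar gbar ι δ Φ)
    (hι : range ι = (𝓡∂ (n + 1)).boundary M) (hw : ContMDiff (𝓡∂ (n + 1)) 𝓘(ℝ, ℝ) ∞ w) :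
    ∃ a, HasDistanceExpansion gbar δ Φ hw univ a := by
  -- Compactness induction needs a property inherited by subsets, hence the measurable superset `A`.
  have : ∃ A, univ ⊆ A ∧ MeasurableSet A ∧ ∃ a, HasDistanceExpansion gbar δ Φ hw A a := by
    refine isCompact_univ.induction_on (p := fun s => ∃ A, s ⊆ A ∧ MeasurableSet A ∧
      ∃ a, HasDistanceExpansion gbar δ Φ hw A a) ?_ ?_ ?_ ?_
    · refine ⟨∅, le_rfl, MeasurableSet.empty, fun _ _ _ => 0, fun _ _ => measurable_const,
        by simp, by simp, by simp, fun t => ⟨0, δ / 2, le_rfl, half_pos hΦ.pos,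
          half_lt_self hΦ.pos, by simp⟩⟩
    · rintro s t hst ⟨A, hA, h⟩
      exact ⟨A, hst.trans hA, h⟩
    · rintro s t ⟨A, hA, hAm, a, ha⟩ ⟨B, hB, hBm, b, hb⟩
      exact ⟨A ∪ B, union_subset_union hA hB, hAm.union hBm, _, ha.union hAm hb⟩
    · intro x _
      obtain ⟨A, hA, hAm, ha⟩ := exists_hasDistanceExpansion_nhds hΦ hι hw x
      exact ⟨A, mem_nhdsWithin_of_mem_nhds hA, A, le_rfl, hAm, ha⟩
  obtain ⟨A, hA, -, a, ha⟩ := this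
  exact ⟨a, ha.mono hA⟩

end DistanceExpansion

/-! ### Riemannian volume in charts -/

theorem measurableSet_inter_preimage_of_continuousOn {X Y : Type*} [TopologicalSpace X]
    [MeasurableSpace X] [OpensMeasurableSpace X] [TopologicalSpace Y] [MeasurableSpace Y]
    [BorelSpace Y] {f : X → Y} {T : Set X} (hf : ContinuousOn f T) (hT : MeasurableSet T)
    {A : Set Y} (hA : MeasurableSet A) : MeasurableSet (T ∩ f ⁻¹' A) := by
  have h1 : Measurable (T.domRestrict f) :=
    (continuousOn_iff_continuous_domRestrict.1 hf).measurable
  have h2 := (MeasurableEmbedding.subtype_coe hT).measurableSet_image.2 (h1 hA)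
  convert! h2 using 1
  ext y
  simp only [mem_inter_iff, mem_preimage, mem_image, Set.domRestrict, Subtype.exists,
    exists_and_right, exists_eq_right]
  tauto

section ChartVolume

variable {m : ℕ} {H : Type*} [TopologicalSpace H]
  {I : ModelWithCorners ℝ (EuclideanSpace ℝ (Fin m)) H}
  {M : Type*} [TopologicalSpace M] [ChartedSpace H M]

/-- The field `g` consists of bilinear forms. -/
def IsBilinearField (g : FormField I M) : Prop :=
  ∀ x : M, ∃ B : LinearMap.BilinForm ℝ (EuclideanSpace ℝ (Fin m)),
    ∀ v w : EuclideanSpace ℝ (Fin m), g x v w = B v w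

/-- The density `√(det g_ij)` in the chart at `x₀`. -/
def chartDensity (g : FormField I M) (x₀ : M) (y : EuclideanSpace ℝ (Fin m)) : ℝ≥0∞ :=
  ENNReal.ofReal (√(gramMatrix I g x₀ y).det)

theorem measurableSet_chart_target (x₀ : M) : MeasurableSet (extChartAt I x₀).target := by
  rw [extChartAt_target]
  exact ((chartAt H x₀).open_target.preimage I.continuous_symm).measurableSet.inter
    I.isClosed_range.measurableSet

theorem chartVolume_apply [MeasurableSpace M] [BorelSpace M] (g : FormField I M) (x₀ : M)
    {A : Set M} (hA : MeasurableSet A) :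
    chartVolume I g x₀ A = ∫⁻ y in (extChartAt I x₀).target ∩ (extChartAt I x₀).symm ⁻¹' A,
      chartDensity g x₀ y := by
  have hm := measurableSet_chart_target (I := I) x₀
  have hae : AEMeasurable (extChartAt I x₀).symm
      ((volume.restrict (extChartAt I x₀).target).withDensity (chartDensity g x₀)) :=
    ((continuousOn_extChartAt_symm x₀).aemeasurable hm).mono_ac (withDensity_absolutelyContinuous _ _)
  rw [chartVolume]
  change Measure.map _ ((volume.restrict _).withDensity (chartDensity g x₀)) A = _
  rw [Measure.map_apply_of_aemeasurable hae hA, withDensity_apply',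
    Measure.restrict_restrict' hm, inter_comm]

theorem FormField.congr_point (g : FormField I M) {p q : M} (h : p = q)
    (v w : EuclideanSpace ℝ (Fin m)) :
    (g p : EuclideanSpace ℝ (Fin m) → EuclideanSpace ℝ (Fin m) → ℝ) v w = g q v w := by
  subst h; rfl

/-- The change of coordinates between the charts at `x₀` and `x₁`. -/
def transition (I : ModelWithCorners ℝ (EuclideanSpace ℝ (Fin m)) H) (x₀ x₁ : M) :
    EuclideanSpace ℝ (Fin m) → EuclideanSpace ℝ (Fin m) :=
  extChartAt I x₁ ∘ (extChartAt I x₀).symm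

/-- The domain of the change of coordinates. -/
def transitionDomain (I : ModelWithCorners ℝ (EuclideanSpace ℝ (Fin m)) H) (x₀ x₁ : M) :
    Set (EuclideanSpace ℝ (Fin m)) :=
  (extChartAt I x₀).target ∩ (extChartAt I x₀).symm ⁻¹' (extChartAt I x₁).source

/-- Allows derivatives within the overlap to be exchanged for derivatives within `range I`, the set
used for coordinate vectors. It matters at boundary points. -/
theorem transitionDomain_mem_nhdsWithin {x₀ x₁ : M} {y : EuclideanSpace ℝ (Fin m)}
    (hy : y ∈ transitionDomain I x₀ x₁) : transitionDomain I x₀ x₁ ∈ 𝓝[range I] y := by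
  refine inter_mem (extChartAt_target_mem_nhdsWithin_of_mem hy.1) ?_
  exact (continuousAt_extChartAt_symm'' hy.1).continuousWithinAt.preimage_mem_nhdsWithin
    ((isOpen_extChartAt_source x₁).mem_nhds hy.2)

theorem symm_transition {x₀ x₁ : M} {y : EuclideanSpace ℝ (Fin m)}
    (hy : y ∈ transitionDomain I x₀ x₁) :
    (extChartAt I x₁).symm (transition I x₀ x₁ y) = (extChartAt I x₀).symm y :=
  (extChartAt I x₁).left_inv hy.2

theorem mapsTo_transition (x₀ x₁ : M) :
    MapsTo (transition I x₀ x₁) (transitionDomain I x₀ x₁) (transitionDomain I x₁ x₀) := by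
  intro y hy
  refine ⟨(extChartAt I x₁).map_source hy.2, ?_⟩
  rw [mem_preimage, symm_transition hy]
  exact (extChartAt I x₀).map_target hy.1

theorem transition_transition {x₀ x₁ : M} {y : EuclideanSpace ℝ (Fin m)}
    (hy : y ∈ transitionDomain I x₀ x₁) :
    transition I x₁ x₀ (transition I x₀ x₁ y) = y := by
  change extChartAt I x₀ ((extChartAt I x₁).symm (transition I x₀ x₁ y)) = y
  rw [symm_transition hy]
  exact (extChartAt I x₀).right_inv hy.1

theorem injOn_transition (x₀ x₁ : M) : InjOn (transition I x₀ x₁) (transitionDomain I x₀ x₁) :=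
  fun y hy z hz h => by
    rw [← transition_transition hy, h, transition_transition hz]

variable [IsManifold I ∞ M]

theorem hasFDerivWithinAt_transition {x₀ x₁ : M} {y : EuclideanSpace ℝ (Fin m)}
    (hy : y ∈ transitionDomain I x₀ x₁) :
    HasFDerivWithinAt (transition I x₀ x₁)
      (fderivWithin ℝ (transition I x₀ x₁) (transitionDomain I x₀ x₁) y)
      (transitionDomain I x₀ x₁) y := by
  have h := contDiffOn_ext_coord_change (I := I) (n := ∞) x₁ x₀
  rw [PartialEquiv.trans_source, PartialEquiv.symm_source] at h
  exact ((h.differentiableOn (by simp)) y hy).hasFDerivWithinAt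

/-- Chain rule for the factorization of one inverse chart as the other composed with the change of
coordinates. -/
theorem coordVec_eq {x₀ x₁ : M} {y : EuclideanSpace ℝ (Fin m)}
    (hy : y ∈ transitionDomain I x₀ x₁) (i : Fin m) :
    (coordVec I x₀ y i : EuclideanSpace ℝ (Fin m)) =
      mfderivWithin 𝓘(ℝ, EuclideanSpace ℝ (Fin m)) I (extChartAt I x₁).symm (range I)
        (transition I x₀ x₁ y)
        (fderivWithin ℝ (transition I x₀ x₁) (transitionDomain I x₀ x₁) y
          (EuclideanSpace.single i (1 : ℝ))) := by
  have : IsManifold I 1 M := IsManifold.of_le (n := ∞) (by exact_mod_cast le_top)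
  set S := transitionDomain I x₀ x₁ with hS
  have hz := (mapsTo_transition x₀ x₁ hy).1
  have h1 := (mdifferentiableWithinAt_extChartAt_symm hz).hasMFDerivWithinAt
  have h2 := (hasFDerivWithinAt_transition hy).hasMFDerivWithinAt
  have h3 := h1.comp y h2 fun z hz => extChartAt_target_subset_range x₁ (mapsTo_transition x₀ x₁ hz).1
  have h4 : HasMFDerivWithinAt 𝓘(ℝ, EuclideanSpace ℝ (Fin m)) I (extChartAt I x₀).symm S y _ :=
    h3.congr_of_eventuallyEq
      (eventually_nhdsWithin_of_forall fun z hz => (symm_transition hz).symm) (symm_transition hy).symm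
  have h5 := (h4.mono_of_mem_nhdsWithin (t := range I) ?_).mfderivWithin
    ((I.uniqueDiffOn y (extChartAt_target_subset_range x₀ hy.1)).uniqueMDiffWithinAt)
  · have h6 := congrArg (fun L : EuclideanSpace ℝ (Fin m) →L[ℝ] EuclideanSpace ℝ (Fin m) =>
      L (EuclideanSpace.single i (1 : ℝ))) h5
    exact h6
  · exact transitionDomain_mem_nhdsWithin hy

/-- Under a change of coordinates the Gram matrix becomes `Jᵀ G J`. This is where bilinearity of the
field is needed. -/
theorem det_gramMatrix_transition {g : FormField I M} (hg : IsBilinearField g) {x₀ x₁ : M}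
    {y : EuclideanSpace ℝ (Fin m)} (hy : y ∈ transitionDomain I x₀ x₁) :
    (gramMatrix I g x₀ y).det =
      (fderivWithin ℝ (transition I x₀ x₁) (transitionDomain I x₀ x₁) y).det ^ 2
        * (gramMatrix I g x₁ (transition I x₀ x₁ y)).det := by
  set J := fderivWithin ℝ (transition I x₀ x₁) (transitionDomain I x₀ x₁) y with hJ
  set L : EuclideanSpace ℝ (Fin m) →L[ℝ] EuclideanSpace ℝ (Fin m) :=
    mfderivWithin 𝓘(ℝ, EuclideanSpace ℝ (Fin m)) I (extChartAt I x₁).symm (range I)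
        (transition I x₀ x₁ y) with hL
  obtain ⟨B, hB⟩ := hg ((extChartAt I x₁).symm (transition I x₀ x₁ y))
  set b := (EuclideanSpace.basisFun (Fin m) ℝ).toBasis with hb
  set B' : LinearMap.BilinForm ℝ (EuclideanSpace ℝ (Fin m)) :=
    B.comp (L : EuclideanSpace ℝ (Fin m) →ₗ[ℝ] EuclideanSpace ℝ (Fin m)) L with hB'
  have h1 : gramMatrix I g x₁ (transition I x₀ x₁ y) = LinearMap.BilinForm.toMatrix b B' := by
    ext i j
    simp only [gramMatrix, Matrix.of_apply, LinearMap.BilinForm.toMatrix_apply, hb,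
      OrthonormalBasis.coe_toBasis, EuclideanSpace.basisFun_apply]
    exact hB _ _
  have h0 : gramMatrix I g x₀ y = LinearMap.BilinForm.toMatrix b
      (B'.comp (J : EuclideanSpace ℝ (Fin m) →ₗ[ℝ] EuclideanSpace ℝ (Fin m)) J) := by
    ext i j
    simp only [gramMatrix, Matrix.of_apply, LinearMap.BilinForm.toMatrix_apply, hb,
      OrthonormalBasis.coe_toBasis, EuclideanSpace.basisFun_apply]
    refine (FormField.congr_point g (symm_transition hy).symm _ _).trans ?_
    refine (hB _ _).trans ?_
    rw [coordVec_eq hy i, coordVec_eq hy j]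
    rfl
  rw [h0, h1, LinearMap.BilinForm.toMatrix_comp b b, Matrix.det_mul, Matrix.det_mul,
    Matrix.det_transpose, LinearMap.det_toMatrix]
  change LinearMap.det _ * _ * LinearMap.det _ = LinearMap.det _ ^ 2 * _
  ring

theorem chartDensity_transition {g : FormField I M} (hg : IsBilinearField g) {x₀ x₁ : M}
    {y : EuclideanSpace ℝ (Fin m)} (hy : y ∈ transitionDomain I x₀ x₁) :
    chartDensity g x₀ y =
      ENNReal.ofReal |(fderivWithin ℝ (transition I x₀ x₁) (transitionDomain I x₀ x₁) y).det|
        * chartDensity g x₁ (transition I x₀ x₁ y) := by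
  rw [chartDensity, chartDensity, det_gramMatrix_transition hg hy, Real.sqrt_mul (sq_nonneg _),
    Real.sqrt_sq_eq_abs, ENNReal.ofReal_mul (abs_nonneg _)]

variable [MeasurableSpace M] [BorelSpace M]

theorem measurableSet_inter_preimage (x₀ : M) {A : Set M} (hA : MeasurableSet A) :
    MeasurableSet ((extChartAt I x₀).target ∩ (extChartAt I x₀).symm ⁻¹' A) :=
  measurableSet_inter_preimage_of_continuousOn (continuousOn_extChartAt_symm x₀)
    (measurableSet_chart_target x₀) hA

/-- The chart measures agree on overlaps. -/
theorem chartVolume_eq {g : FormField I M} (hg : IsBilinearField g) {x₀ x₁ : M} {A : Set M}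
    (hA : MeasurableSet A) (h0 : A ⊆ (extChartAt I x₀).source)
    (h1 : A ⊆ (extChartAt I x₁).source) :
    chartVolume I g x₀ A = chartVolume I g x₁ A := by
  set S := (extChartAt I x₀).target ∩ (extChartAt I x₀).symm ⁻¹' A with hS
  have hSD : S ⊆ transitionDomain I x₀ x₁ := fun y hy => ⟨hy.1, h1 hy.2⟩
  have himg : transition I x₀ x₁ '' S = (extChartAt I x₁).target ∩ (extChartAt I x₁).symm ⁻¹' A := by
    ext z
    constructor
    · rintro ⟨y, hy, rfl⟩
      refine ⟨(mapsTo_transition x₀ x₁ (hSD hy)).1, ?_⟩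
      rw [mem_preimage, symm_transition (hSD hy)]
      exact hy.2
    · intro hz
      have hz' : z ∈ transitionDomain I x₁ x₀ := ⟨hz.1, h0 hz.2⟩
      refine ⟨transition I x₁ x₀ z, ⟨(mapsTo_transition x₁ x₀ hz').1, ?_⟩,
        transition_transition hz'⟩
      rw [mem_preimage, symm_transition hz']
      exact hz.2
  rw [chartVolume_apply g x₀ hA, chartVolume_apply g x₁ hA, ← himg,
    lintegral_image_eq_lintegral_abs_det_fderiv_mul volume (measurableSet_inter_preimage x₀ hA)
      (fun y hy => (hasFDerivWithinAt_transition (hSD hy)).mono hSD)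
      ((injOn_transition x₀ x₁).mono hSD)]
  exact setLIntegral_congr_fun (measurableSet_inter_preimage x₀ hA) fun y hy =>
    chartDensity_transition hg (hSD hy)

theorem chartVolume_inter_source (g : FormField I M) (x₀ : M) {A : Set M} (hA : MeasurableSet A) :
    chartVolume I g x₀ A = chartVolume I g x₀ (A ∩ (extChartAt I x₀).source) := by
  rw [chartVolume_apply g x₀ hA, chartVolume_apply g x₀
    (hA.inter (isOpen_extChartAt_source x₀).measurableSet)]
  congr 2
  ext y
  simp only [mem_inter_iff, mem_preimage]
  exact ⟨fun h => ⟨h.1, h.2, (extChartAt I x₀).map_target h.1⟩, fun h => ⟨h.1, h.2.1⟩⟩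

/-- In a chart, the Riemannian volume is the chart measure. -/
theorem riemannianVolume_eq_chartVolume {g : FormField I M} (hg : IsBilinearField g) {x₁ : M}
    {A : Set M} (hA : MeasurableSet A) (h1 : A ⊆ (extChartAt I x₁).source) :
    riemannianVolume I g A = chartVolume I g x₁ A := by
  have hs : MeasurableSet (extChartAt I x₁).source :=
    (isOpen_extChartAt_source (I := I) x₁).measurableSet
  refine le_antisymm ?_ (le_iSup (fun x => chartVolume I g x) x₁ A)
  -- The measure equal to the chart measure on the chart domain and to the full volume off it
  -- dominates every chart measure, since these agree on overlaps. Hence it dominates their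
  -- supremum.
  have hle : riemannianVolume I g ≤ (chartVolume I g x₁).restrict (extChartAt I x₁).source
      + (riemannianVolume I g).restrict (extChartAt I x₁).sourceᶜ := by
    refine iSup_le fun x₀ => ?_
    rw [← Measure.restrict_add_restrict_compl (μ := chartVolume I g x₀) hs]
    refine add_le_add ?_ (Measure.restrict_mono le_rfl (le_iSup (fun x => chartVolume I g x) x₀))
    refine Measure.le_iff.2 fun B hB => ?_
    rw [Measure.restrict_apply hB, Measure.restrict_apply hB,
      chartVolume_inter_source g x₀ (hB.inter hs),
      chartVolume_eq hg (x₁ := x₁) ((hB.inter hs).inter (isOpen_extChartAt_source x₀).measurableSet)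
        inter_subset_right (inter_subset_left.trans inter_subset_right)]
    exact measure_mono inter_subset_left
  refine (hle A).trans ?_
  rw [Measure.add_apply, Measure.restrict_apply hA, Measure.restrict_apply hA]
  have : A ∩ (extChartAt I x₁).sourceᶜ = ∅ := by
    rw [← sdiff_eq, sdiff_eq_empty]; exact h1
  rw [this, measure_empty, add_zero]
  exact measure_mono inter_subset_left

/-- Near the centre of the chart the density is bounded by continuity, and a coordinate ball has
finite Lebesgue measure. -/
theorem finiteAtFilter_riemannianVolume {g : FormField I M} (hg : IsBilinearField g) {x₀ : M}
    (hc : ContinuousWithinAt (fun y => (gramMatrix I g x₀ y).det) (extChartAt I x₀).target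
      (extChartAt I x₀ x₀)) :
    (riemannianVolume I g).FiniteAtFilter (𝓝 x₀) := by
  set y₀ := extChartAt I x₀ x₀ with hy₀
  have h1 : ∀ᶠ y in 𝓝[(extChartAt I x₀).target] y₀,
      √(gramMatrix I g x₀ y).det < √(gramMatrix I g x₀ y₀).det + 1 :=
    (hc.sqrt).eventually (gt_mem_nhds (lt_add_one _))
  obtain ⟨O, hO, hO'⟩ := mem_nhdsWithin_iff_exists_mem_nhds_inter.1 h1
  obtain ⟨ρ, hρ, hρO⟩ := Metric.mem_nhds_iff.1 hO
  set A := (extChartAt I x₀).source ∩ extChartAt I x₀ ⁻¹' (Metric.ball y₀ ρ) with hA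
  have hAo : IsOpen A := (continuousOn_extChartAt x₀).isOpen_inter_preimage
    (isOpen_extChartAt_source x₀) Metric.isOpen_ball
  refine ⟨A, hAo.mem_nhds ⟨mem_extChartAt_source x₀, Metric.mem_ball_self hρ⟩, ?_⟩
  rw [riemannianVolume_eq_chartVolume hg hAo.measurableSet inter_subset_left,
    chartVolume_apply g x₀ hAo.measurableSet]
  set S := (extChartAt I x₀).target ∩ (extChartAt I x₀).symm ⁻¹' A with hS
  have hSb : S ⊆ Metric.ball y₀ ρ := fun y hy => by
    have := hy.2.2
    rwa [mem_preimage, (extChartAt I x₀).right_inv hy.1] at this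
  calc ∫⁻ y in S, chartDensity g x₀ y
      ≤ ∫⁻ _ in S, ENNReal.ofReal (√(gramMatrix I g x₀ y₀).det + 1) := by
        refine setLIntegral_mono' (measurableSet_inter_preimage x₀ hAo.measurableSet) fun y hy => ?_
        exact ENNReal.ofReal_le_ofReal (hO' ⟨hρO (hSb hy), hy.1⟩).le
    _ = ENNReal.ofReal (√(gramMatrix I g x₀ y₀).det + 1) * volume S := setLIntegral_const _ _
    _ < ⊤ := ENNReal.mul_lt_top ENNReal.ofReal_lt_top
        ((measure_mono hSb).trans_lt measure_ball_lt_top)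

end ChartVolume

/-! ### Volume of the singular metric away from its zeros of `u` -/

section SingularVolume

variable {m : ℕ} {H : Type*} [TopologicalSpace H]
  {I : ModelWithCorners ℝ (EuclideanSpace ℝ (Fin m)) H}
  {M : Type*} [TopologicalSpace M] [ChartedSpace H M] [IsManifold I ∞ M]
  (gbar : SmoothMetric I M) (u : M → ℝ)

theorem exists_bilinForm_eq {E : Type*} [NormedAddCommGroup E] [NormedSpace ℝ E]
    (C : E →L[ℝ] E →L[ℝ] ℝ) : ∃ B : LinearMap.BilinForm ℝ E, ∀ v w, C v w = B v w :=
  ⟨LinearMap.mk₂ ℝ (fun v w => C v w) (by simp) (by simp) (by simp) (by simp), fun _ _ => rfl⟩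

theorem isBilinearField_singularMetric : IsBilinearField (singularMetric gbar u) := fun x =>
  (exists_bilinForm_eq ((u x ^ 2)⁻¹ • (gbar.inner x :
    EuclideanSpace ℝ (Fin m) →L[ℝ] EuclideanSpace ℝ (Fin m) →L[ℝ] ℝ))).imp
      fun _ hB v w => Eq.trans rfl (hB v w)

/-- Coordinate vectors are differentials within `range I`, while smoothness of pullbacks is
available within the chart target; unique differentiability of the target identifies the two. -/
theorem mfderivWithin_chartSymm_target {x₀ : M} {y : EuclideanSpace ℝ (Fin m)}
    (hy : y ∈ (extChartAt I x₀).target) :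
    mfderivWithin 𝓘(ℝ, EuclideanSpace ℝ (Fin m)) I (extChartAt I x₀).symm
      (extChartAt I x₀).target y =
    mfderivWithin 𝓘(ℝ, EuclideanSpace ℝ (Fin m)) I (extChartAt I x₀).symm (range I) y := by
  have : IsManifold I 1 M := IsManifold.of_le (n := ∞) (by exact_mod_cast le_top)
  exact ((mdifferentiableWithinAt_extChartAt_symm hy).hasMFDerivWithinAt.mono
    (extChartAt_target_subset_range x₀)).mfderivWithin
    ((uniqueDiffOn_extChartAt_target x₀).uniqueMDiffOn y hy)

theorem continuousOn_inner_coordVec (x₀ : M) (i j : Fin m) :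
    ContinuousOn (fun y => gbar.inner ((extChartAt I x₀).symm y) (coordVec I x₀ y i)
      (coordVec I x₀ y j)) (extChartAt I x₀).target := by
  refine (contDiffOn_inner_mfderivWithin gbar (contMDiffOn_extChartAt_symm x₀)
    (uniqueDiffOn_extChartAt_target x₀) (EuclideanSpace.single i (1 : ℝ))
    (EuclideanSpace.single j (1 : ℝ))).continuousOn.congr fun y hy => ?_
  exact congrArg (fun L : EuclideanSpace ℝ (Fin m) →L[ℝ] EuclideanSpace ℝ (Fin m) =>
    (gbar.inner ((extChartAt I x₀).symm y) :
      EuclideanSpace ℝ (Fin m) →L[ℝ] EuclideanSpace ℝ (Fin m) →L[ℝ] ℝ)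
      (L (EuclideanSpace.single i (1 : ℝ))) (L (EuclideanSpace.single j (1 : ℝ))))
    (mfderivWithin_chartSymm_target hy).symm

theorem continuousOn_det_gramMatrix_singularMetric {x₀ : M} {O : Set M}
    (hu : ContinuousOn u O) (hu0 : ∀ p ∈ O, u p ≠ 0) :
    ContinuousOn (fun y => (gramMatrix I (singularMetric gbar u) x₀ y).det)
      ((extChartAt I x₀).target ∩ (extChartAt I x₀).symm ⁻¹' O) := by
  have h : ContinuousOn (gramMatrix I (singularMetric gbar u) x₀)
      ((extChartAt I x₀).target ∩ (extChartAt I x₀).symm ⁻¹' O) := by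
    refine continuousOn_pi.2 fun i => continuousOn_pi.2 fun j => ?_
    refine ContinuousOn.mul ?_ ((continuousOn_inner_coordVec gbar x₀ i j).mono inter_subset_left)
    refine ((hu.comp ((continuousOn_extChartAt_symm x₀).mono inter_subset_left)
      fun y hy => hy.2).pow 2).inv₀ fun y hy => pow_ne_zero 2 (hu0 _ hy.2)
  exact (continuous_id.matrix_det).comp_continuousOn h

/-- The Gram matrix represents a positive definite form pulled back by the invertible differential
of the inverse chart. -/
theorem det_gramMatrix_singularMetric_pos {x₀ : M} {y : EuclideanSpace ℝ (Fin m)}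
    (hy : y ∈ (extChartAt I x₀).target) (hu : u ((extChartAt I x₀).symm y) ≠ 0) :
    0 < (gramMatrix I (singularMetric gbar u) x₀ y).det := by
  have : IsManifold I 1 M := IsManifold.of_le (n := ∞) (by exact_mod_cast le_top)
  obtain ⟨B, hB⟩ := isBilinearField_singularMetric gbar u ((extChartAt I x₀).symm y)
  set L : EuclideanSpace ℝ (Fin m) →L[ℝ] EuclideanSpace ℝ (Fin m) :=
    mfderivWithin 𝓘(ℝ, EuclideanSpace ℝ (Fin m)) I (extChartAt I x₀).symm (range I) y with hL
  have hLi : Function.Injective L := by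
    obtain ⟨e, he⟩ := isInvertible_mfderivWithin_extChartAt_symm (I := I) hy
    intro v w hvw
    rw [hL, ← he] at hvw
    exact e.injective hvw
  set b := (EuclideanSpace.basisFun (Fin m) ℝ).toBasis with hb
  have hsum : ∀ x : Fin m → ℝ, x ⬝ᵥ (gramMatrix I (singularMetric gbar u) x₀ y).mulVec x
      = B (L (WithLp.toLp 2 x)) (L (WithLp.toLp 2 x)) := by
    intro x
    have h1 : gramMatrix I (singularMetric gbar u) x₀ y = LinearMap.BilinForm.toMatrix b
        (B.comp (L : EuclideanSpace ℝ (Fin m) →ₗ[ℝ] EuclideanSpace ℝ (Fin m)) L) := by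
      ext i j
      simp only [gramMatrix, Matrix.of_apply, LinearMap.BilinForm.toMatrix_apply, hb,
        OrthonormalBasis.coe_toBasis, EuclideanSpace.basisFun_apply]
      exact hB _ _
    have h2 := LinearMap.BilinForm.dotProduct_toMatrix_mulVec b
      (B.comp (L : EuclideanSpace ℝ (Fin m) →ₗ[ℝ] EuclideanSpace ℝ (Fin m)) L) x x
    rw [h1, h2]
    have h3 : b.equivFun.symm x = WithLp.toLp 2 x := by
      rw [LinearEquiv.symm_apply_eq]
      ext i
      simp [hb]
    rw [h3]
    rfl
  refine Matrix.PosDef.det_pos (Matrix.PosDef.of_dotProduct_mulVec_pos ?_ fun x hx => ?_)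
  · ext i j
    simp only [Matrix.conjTranspose_apply, gramMatrix, Matrix.of_apply, star_trivial,
      singularMetric]
    rw [gbar.symm]
  · simp only [star_trivial]
    rw [hsum, ← hB]
    refine mul_pos (by positivity) (gbar.pos _ _ fun h0 => hx ?_)
    have h1 : WithLp.toLp 2 x = (0 : EuclideanSpace ℝ (Fin m)) := hLi (h0.trans (map_zero L).symm)
    simpa using h1

variable [MeasurableSpace M] [BorelSpace M]

/-- The density is continuous where `u ≠ 0`, so the volume is locally finite there and finite on
compact sets. Applied to the complement of the collar. -/
theorem riemannianVolume_singularMetric_lt_top {O K : Set M} (hO : IsOpen O)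
    (hu : ContinuousOn u O) (hu0 : ∀ p ∈ O, u p ≠ 0) (hK : IsCompact K) (hKO : K ⊆ O) :
    riemannianVolume I (singularMetric gbar u) K < ⊤ := by
  refine hK.measure_lt_top_of_nhdsWithin fun x hx => Measure.FiniteAtFilter.filter_mono
    nhdsWithin_le_nhds (finiteAtFilter_riemannianVolume
      (isBilinearField_singularMetric gbar u) ?_)
  have hmem : extChartAt I x x ∈ (extChartAt I x).target ∩ (extChartAt I x).symm ⁻¹' O :=
    ⟨mem_extChartAt_target x, by simpa using hKO hx⟩
  refine ((continuousOn_det_gramMatrix_singularMetric gbar u hu hu0) _ hmem).mono_of_mem_nhdsWithin ?_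
  refine inter_mem self_mem_nhdsWithin ?_
  exact ((continuousAt_extChartAt_symm x).preimage_mem_nhds
    (by simpa using hO.mem_nhds (hKO hx))) |> mem_nhdsWithin_of_mem_nhds

/-- A null set for the volume of `u⁻² ḡ` has null image in every chart. -/
theorem volume_chart_eq_zero {O Z : Set M} (hu : ContinuousOn u O)
    (hu0 : ∀ p ∈ O, u p ≠ 0) (hZm : MeasurableSet Z) (hZO : Z ⊆ O)
    (hZ : riemannianVolume I (singularMetric gbar u) Z = 0) (x₀ : M) :
    volume ((extChartAt I x₀).target ∩ (extChartAt I x₀).symm ⁻¹' Z) = 0 := by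
  set S := (extChartAt I x₀).target ∩ (extChartAt I x₀).symm ⁻¹' Z with hS
  have hSm : MeasurableSet S := measurableSet_inter_preimage x₀ hZm
  have h0 : chartVolume I (singularMetric gbar u) x₀ Z = 0 :=
    le_antisymm ((le_iSup (fun x => chartVolume I (singularMetric gbar u) x) x₀ Z).trans hZ.le)
      (zero_le)
  rw [chartVolume_apply _ _ hZm] at h0
  have hc : ContinuousOn (fun y => (gramMatrix I (singularMetric gbar u) x₀ y).det) S :=
    (continuousOn_det_gramMatrix_singularMetric gbar u hu hu0).mono
      (inter_subset_inter_right _ (preimage_mono hZO))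
  have hae : AEMeasurable (chartDensity (singularMetric gbar u) x₀) (volume.restrict S) :=
    (hc.sqrt.aemeasurable hSm).ennreal_ofReal
  rw [lintegral_eq_zero_iff' hae, Filter.EventuallyEq, ae_restrict_iff' hSm] at h0
  refine measure_mono_null (fun y hy => ?_) h0
  simp only [mem_compl_iff, mem_ofPred_eq, Pi.zero_apply, chartDensity, ENNReal.ofReal_eq_zero]
  intro h
  have := Real.sqrt_pos.2 (det_gramMatrix_singularMetric_pos gbar u hy.1 (hu0 _ (hZO hy.2)))
  exact absurd (h hy) (not_le.2 this)

end SingularVolume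

/-! ### Volume of the induced boundary metric -/

section BoundaryVolume

variable {n : ℕ}
  {M : Type*} [TopologicalSpace M] [ChartedSpace (EuclideanHalfSpace (n + 1)) M]
  [IsManifold (𝓡∂ (n + 1)) ∞ M]
  {N : Type*} [TopologicalSpace N] [ChartedSpace (EuclideanSpace ℝ (Fin n)) N]
  (gbar : SmoothMetric (𝓡∂ (n + 1)) M) {ι : N → M}

theorem isBilinearField_inducedMetric : IsBilinearField (inducedMetric gbar ι) := fun x =>
  let L : EuclideanSpace ℝ (Fin n) →L[ℝ] EuclideanSpace ℝ (Fin (n + 1)) :=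
    mfderiv (𝓡 n) (𝓡∂ (n + 1)) ι x
  let C : EuclideanSpace ℝ (Fin (n + 1)) →L[ℝ] EuclideanSpace ℝ (Fin (n + 1)) →L[ℝ] ℝ :=
    gbar.inner (ι x)
  (exists_bilinForm_eq ((ContinuousLinearMap.precomp ℝ L).comp (C.comp L))).imp
    fun _ hB v w => Eq.trans rfl (hB v w)

variable [IsManifold (𝓡 n) ∞ N]

theorem continuousOn_det_gramMatrix_inducedMetric
    (hι : ContMDiff (𝓡 n) (𝓡∂ (n + 1)) ∞ ι) (x₀ : N) :
    ContinuousOn (fun y => (gramMatrix (𝓡 n) (inducedMetric gbar ι) x₀ y).det)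
      (extChartAt (𝓡 n) x₀).target := by
  have : IsManifold (𝓡 n) 1 N := IsManifold.of_le (n := ∞) (by exact_mod_cast le_top)
  have h : ContinuousOn (gramMatrix (𝓡 n) (inducedMetric gbar ι) x₀) (extChartAt (𝓡 n) x₀).target := by
    refine continuousOn_pi.2 fun i => continuousOn_pi.2 fun j => ?_
    refine (contDiffOn_inner_mfderivWithin gbar (hι.comp_contMDiffOn
      (contMDiffOn_extChartAt_symm x₀)) (uniqueDiffOn_extChartAt_target x₀)
      (EuclideanSpace.single i (1 : ℝ)) (EuclideanSpace.single j (1 : ℝ))).continuousOn.congr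
      fun y hy => ?_
    have h1 := (hι.mdifferentiableAt (by simp) (x := (extChartAt (𝓡 n) x₀).symm y)).hasMFDerivAt
    have h2 := (mdifferentiableWithinAt_extChartAt_symm hy).hasMFDerivWithinAt.mono
      (extChartAt_target_subset_range x₀)
    have h3 := (h1.comp_hasMFDerivWithinAt y h2).mfderivWithin
      ((uniqueDiffOn_extChartAt_target x₀).uniqueMDiffOn y hy)
    exact congrArg (fun L : EuclideanSpace ℝ (Fin n) →L[ℝ] EuclideanSpace ℝ (Fin (n + 1)) =>
      (gbar.inner (ι ((extChartAt (𝓡 n) x₀).symm y)) :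
        EuclideanSpace ℝ (Fin (n + 1)) →L[ℝ] EuclideanSpace ℝ (Fin (n + 1)) →L[ℝ] ℝ)
        (L (EuclideanSpace.single i (1 : ℝ))) (L (EuclideanSpace.single j (1 : ℝ)))) h3.symm
  exact (continuous_id.matrix_det).comp_continuousOn h

theorem isFiniteMeasure_riemannianVolume_inducedMetric [MeasurableSpace N] [BorelSpace N]
    [CompactSpace N] (hι : ContMDiff (𝓡 n) (𝓡∂ (n + 1)) ∞ ι) :
    IsFiniteMeasure (riemannianVolume (𝓡 n) (inducedMetric gbar ι)) := by
  refine ⟨isCompact_univ.measure_lt_top_of_nhdsWithin fun x _ => Measure.FiniteAtFilter.filter_mono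
    nhdsWithin_le_nhds (finiteAtFilter_riemannianVolume (isBilinearField_inducedMetric gbar) ?_)⟩
  exact continuousOn_det_gramMatrix_inducedMetric gbar hι x _ (mem_extChartAt_target x)

end BoundaryVolume

/-! ### Null sets in the collar -/

section NullSets

variable {n : ℕ}
  {M : Type*} [TopologicalSpace M] [ChartedSpace (EuclideanHalfSpace (n + 1)) M]
  [IsManifold (𝓡∂ (n + 1)) ∞ M]
  {N : Type*} [TopologicalSpace N] [ChartedSpace (EuclideanSpace ℝ (Fin n)) N]
  {gbar : SmoothMetric (𝓡∂ (n + 1)) M} {ι : N → M} {δ : ℝ} {Φ : PartialEquiv (N × ℝ) M}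
  {u : M → ℝ}

theorem measurableSet_image_collar [MeasurableSpace M] [BorelSpace M] [MeasurableSpace N]
    [BorelSpace N] (hΦ : IsGeodesicCollar gbar ι δ Φ) {A : Set (N × ℝ)} (hA : MeasurableSet A)
    (hAs : A ⊆ univ ×ˢ Ico 0 δ) : MeasurableSet (Φ '' A) := by
  have h : Φ '' A = Φ.target ∩ Φ.symm ⁻¹' A := by
    rw [← hΦ.source] at hAs
    rw [← Φ.image_source_inter_eq', inter_eq_right.2 hAs]
  rw [h]
  exact measurableSet_inter_preimage_of_continuousOn hΦ.smooth_symm.continuousOn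
    hΦ.isOpen_target.measurableSet hA

theorem image_subset_interior (hΦ : IsGeodesicCollar gbar ι δ Φ)
    (hι : range ι = (𝓡∂ (n + 1)).boundary M) {A : Set (N × ℝ)} (hA : A ⊆ univ ×ˢ Ioo 0 δ) :
    Φ '' A ⊆ (𝓡∂ (n + 1)).interior M := by
  rintro _ ⟨⟨x, s⟩, hp, rfl⟩
  rw [← ModelWithCorners.compl_boundary]
  intro h
  exact (hA hp).2.1.ne' (snd_eq_zero_of_mem_boundary hΦ hι (Ioo_subset_Ico_self (hA hp).2) h)

/-- Differentiable maps between spaces of the same dimension map null sets to null sets. -/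
theorem volume_image_eq_zero {E F : Type*} [NormedAddCommGroup E] [NormedSpace ℝ E]
    [FiniteDimensional ℝ E] [MeasurableSpace E] [BorelSpace E] [NormedAddCommGroup F]
    [NormedSpace ℝ F] [FiniteDimensional ℝ F] [MeasurableSpace F] [BorelSpace F] (μ : Measure E)
    [μ.IsAddHaarMeasure] (ν : Measure F) [ν.IsAddHaarMeasure]
    (hEF : Module.finrank ℝ F = Module.finrank ℝ E) {f : E → F} {S : Set E}
    (hf : DifferentiableOn ℝ f S) (hS : μ S = 0) : ν (f '' S) = 0 := by
  -- A linear isomorphism reduces the statement to a self-map of `F`; Haar measures on one space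
  -- have the same null sets.
  set L : F ≃L[ℝ] E := ContinuousLinearEquiv.ofFinrankEq hEF
  have h0 : ν.map L S = 0 := Measure.absolutelyContinuous_isAddHaarMeasure (ν.map L) μ hS
  have h1 := addHaar_image_eq_zero_of_differentiableOn_of_addHaar_eq_zero (ν.map L)
    (L.differentiable.comp_differentiableOn hf) h0
  have h2 : ν.map L (L ∘ f '' S) = ν (L ⁻¹' (L ∘ f '' S)) :=
    L.toHomeomorph.toMeasurableEquiv.map_apply _
  rw [h2, image_comp, preimage_image_eq _ L.injective] at h1
  exact h1

variable [IsManifold (𝓡 n) ∞ N] [MeasurableSpace M] [BorelSpace M] [MeasurableSpace N] [BorelSpace N]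

/-- Fubini in both directions: almost every slice at fixed `s` is Lebesgue null in the chart, hence
null for the boundary volume, which has a density there. -/
theorem prod_eq_zero_of_chart [SFinite (riemannianVolume (𝓡 n) (inducedMetric gbar ι))] {x₀ : N}
    {A : Set (N × ℝ)} (hA : MeasurableSet A) (hAs : A ⊆ (extChartAt (𝓡 n) x₀).source ×ˢ univ)
    (h0 : (volume : Measure (EuclideanSpace ℝ (Fin n) × ℝ))
      ((extChartAt (𝓡 n) x₀).target ×ˢ univ ∩
        (fun p : EuclideanSpace ℝ (Fin n) × ℝ => ((extChartAt (𝓡 n) x₀).symm p.1, p.2)) ⁻¹' A) = 0) :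
    (riemannianVolume (𝓡 n) (inducedMetric gbar ι)).prod volume A = 0 := by
  have hBm := measurableSet_inter_preimage_of_continuousOn
    (f := fun p : EuclideanSpace ℝ (Fin n) × ℝ => ((extChartAt (𝓡 n) x₀).symm p.1, p.2))
    (T := (extChartAt (𝓡 n) x₀).target ×ˢ univ)
    (((continuousOn_extChartAt_symm x₀).comp continuousOn_fst fun p hp => hp.1).prodMk
      continuousOn_snd) ((measurableSet_chart_target x₀).prod MeasurableSet.univ) hA
  rw [Measure.volume_eq_prod, Measure.prod_apply_symm hBm, lintegral_eq_zero_iff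
    (measurable_measure_prodMk_right hBm)] at h0
  rw [Measure.prod_apply_symm hA, lintegral_eq_zero_iff (measurable_measure_prodMk_right hA)]
  filter_upwards [h0] with s hs
  have hAm : MeasurableSet ((fun x => (x, s)) ⁻¹' A) := measurable_prodMk_right hA
  simp only [Pi.zero_apply] at hs ⊢
  rw [riemannianVolume_eq_chartVolume (isBilinearField_inducedMetric gbar) (x₁ := x₀) hAm
    fun x hx => (hAs hx).1, chartVolume_apply _ _ hAm]
  refine setLIntegral_measure_zero _ _ ?_
  convert hs using 2
  ext y
  simp

/-- A `g`-null set is Lebesgue null in the charts of `M`, because the density is positive; the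
smooth inverse collar coordinates then carry it to a null set. The argument is local, and second
countability makes it global. -/
theorem prod_eq_zero_of_image [CompactSpace N]
    [SFinite (riemannianVolume (𝓡 n) (inducedMetric gbar ι))] (hΦ : IsGeodesicCollar gbar ι δ Φ)
    (hι : range ι = (𝓡∂ (n + 1)).boundary M)
    (hu : Continuous u) (hu0 : ∀ p ∈ (𝓡∂ (n + 1)).interior M, u p ≠ 0)
    {A : Set (N × ℝ)} (hA : MeasurableSet A) (hAs : A ⊆ univ ×ˢ Ioo 0 δ)
    (h0 : riemannianVolume (𝓡∂ (n + 1)) (singularMetric gbar u) (Φ '' A) = 0) :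
    (riemannianVolume (𝓡 n) (inducedMetric gbar ι)).prod volume A = 0 := by
  have : SecondCountableTopology N :=
    ChartedSpace.secondCountable_of_sigmaCompact (EuclideanSpace ℝ (Fin n)) N
  refine measure_null_of_locally_null _ fun q hq => ?_
  set x₀ := q.1
  set p₀ := Φ q with hp₀
  have hδo : IsOpen (univ ×ˢ Ioo 0 δ : Set (N × ℝ)) := isOpen_univ.prod isOpen_Ioo
  have hΦc : ContinuousOn Φ (univ ×ˢ Ioo 0 δ) :=
    hΦ.smooth.continuousOn.mono (prod_mono le_rfl Ioo_subset_Ico_self)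
  set W : Set (N × ℝ) := ((univ ×ˢ Ioo 0 δ) ∩ Φ ⁻¹' (extChartAt (𝓡∂ (n + 1)) p₀).source)
    ∩ ((extChartAt (𝓡 n) x₀).source ×ˢ univ) with hW
  have hWo : IsOpen W := (hΦc.isOpen_inter_preimage hδo (isOpen_extChartAt_source p₀)).inter
    ((isOpen_extChartAt_source x₀).prod isOpen_univ)
  have hqW : q ∈ W := ⟨⟨hAs hq, mem_extChartAt_source p₀⟩, mem_extChartAt_source x₀, mem_univ _⟩
  refine ⟨A ∩ W, inter_mem_nhdsWithin A (hWo.mem_nhds hqW), ?_⟩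
  have hAW : MeasurableSet (A ∩ W) := hA.inter hWo.measurableSet
  have hAWs : A ∩ W ⊆ univ ×ˢ Ioo 0 δ := inter_subset_left.trans hAs
  have hAWs' : A ∩ W ⊆ univ ×ˢ Ico 0 δ := hAWs.trans (prod_mono le_rfl Ioo_subset_Ico_self)
  refine prod_eq_zero_of_chart hAW (fun p hp => hp.2.2) ?_
  have h1 := volume_chart_eq_zero gbar u hu.continuousOn hu0
    (measurableSet_image_collar hΦ hAW hAWs') (image_subset_interior hΦ hι hAWs)
    (measure_mono_null (image_mono inter_subset_left) h0) p₀
  set S := (extChartAt (𝓡∂ (n + 1)) p₀).target ∩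
    (extChartAt (𝓡∂ (n + 1)) p₀).symm ⁻¹' (Φ '' (A ∩ W)) with hS
  have himg : ∀ p ∈ A ∩ W, ∃ y ∈ collarDomain n δ x₀, collarChart Φ x₀ y = Φ p ∧
      y = (extChartAt (𝓡 n) x₀ p.1, p.2) := fun p hp =>
    ⟨_, ⟨(extChartAt (𝓡 n) x₀).map_source hp.2.2.1, (hAWs' hp).2⟩,
      collarChart_extChartAt hp.2.2.1 _, rfl⟩
  have hF : DifferentiableOn ℝ (fun z => collarChartInv (n := n) Φ x₀
      ((extChartAt (𝓡∂ (n + 1)) p₀).symm z)) S := by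
    refine ContDiffOn.differentiableOn (n := ∞) ?_ (by simp)
    refine contMDiffOn_iff_contDiffOn.1 ((contMDiffOn_collarChartInv hΦ x₀).comp
      ((contMDiffOn_extChartAt_symm p₀).mono inter_subset_left) fun z hz => ?_)
    obtain ⟨p, hp, hpz⟩ := hz.2
    obtain ⟨y, hy, hyp, -⟩ := himg p hp
    rw [mem_preimage, ← hpz, ← hyp]
    exact mem_image_of_mem _ hy
  rw [Measure.volume_eq_prod]
  refine measure_mono_null ?_ (volume_image_eq_zero volume (volume.prod volume) (by simp) hF h1)
  rintro ⟨y, s⟩ ⟨hy, hp⟩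
  obtain ⟨y', hy', hyp, hyy⟩ := himg _ hp
  simp only [(extChartAt (𝓡 n) x₀).right_inv hy.1] at hyy
  refine ⟨extChartAt (𝓡∂ (n + 1)) p₀ (Φ ((extChartAt (𝓡 n) x₀).symm y, s)),
    ⟨(extChartAt _ p₀).map_source hp.2.1.2, ?_⟩, ?_⟩
  · rw [mem_preimage, (extChartAt _ p₀).left_inv hp.2.1.2]
    exact mem_image_of_mem _ hp
  · simp only [(extChartAt _ p₀).left_inv hp.2.1.2]
    rw [← hyp, collarChartInv_collarChart hΦ hy', hyy]

end NullSets

/-! ### Inverse powers of `s` in terms of `ρ = s e^{a(s)}` -/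

section PowerExpansion

/-- The Taylor coefficients of the exponential of a polynomial. -/
theorem iteratedDeriv_exp_polynomial (n : ℕ) (a : ℕ → ℝ) (c : ℝ) {i : ℕ} (hi : i < n) :
    iteratedDeriv (i + 1) (fun s : ℝ => Real.exp (c * ∑ l ∈ Finset.range (n + 1), a l * s ^ l)) 0
        / (i + 1).factorial
      = c / (i + 1) * ∑ r ∈ Finset.range (i + 1), (r + 1) * a (r + 1) *
        (iteratedDeriv (i - r) (fun s : ℝ =>
          Real.exp (c * ∑ l ∈ Finset.range (n + 1), a l * s ^ l)) 0 / (i - r).factorial) := by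
  set f : ℝ → ℝ := fun s => Real.exp (c * ∑ l ∈ Finset.range (n + 1), a l * s ^ l) with hf
  set q : ℝ → ℝ := fun s => ∑ l ∈ Finset.range n, ((l + 1) * a (l + 1)) * s ^ l with hq
  have hfs : ContDiff ℝ ∞ f := by fun_prop
  have hqs : ContDiff ℝ ∞ q := by fun_prop
  -- The recursion is the differential equation `f' = c q f`, with `q` the derivative of the
  -- polynomial, expanded at 0 by the Leibniz rule.
  have hd : deriv f = fun s => c * (q s * f s) := by
    funext s
    have h1 : HasDerivAt (fun s : ℝ => ∑ l ∈ Finset.range (n + 1), a l * s ^ l) (q s) s := by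
      have h2 : ∀ l ∈ Finset.range (n + 1),
          HasDerivAt (fun s : ℝ => a l * s ^ l) (a l * (l * s ^ (l - 1))) s :=
        fun l _ => (hasDerivAt_pow l s).const_mul (a l)
      have h3 : ∑ l ∈ Finset.range (n + 1), a l * (l * s ^ (l - 1)) = q s := by
        rw [Finset.sum_range_succ']
        simp only [hq, Nat.cast_zero, zero_mul, mul_zero, add_zero, Nat.add_sub_cancel]
        exact Finset.sum_congr rfl fun l _ => by push_cast; ring
      rw [← h3]
      exact HasDerivAt.fun_sum h2
    rw [((h1.const_mul c).exp).deriv]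
    simp only [hf]
    ring
  have hqr : ∀ r < n, iteratedDeriv r q 0 = r.factorial * ((r + 1) * a (r + 1)) := by
    intro r hr
    simp only [hq]
    rw [iteratedDeriv_fun_sum fun l _ => by fun_prop]
    simp only [iteratedDeriv_const_mul_field, iteratedDeriv_fun_pow_zero]
    rw [Finset.sum_eq_single r]
    · simp; ring
    · intro l _ hl
      simp [hl.symm]
    · intro h
      exact absurd (Finset.mem_range.2 hr) h
  rw [iteratedDeriv_succ', hd, iteratedDeriv_const_mul_field,
    iteratedDeriv_fun_mul (hqs.contDiffAt.of_le (by exact_mod_cast le_top))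
      (hfs.contDiffAt.of_le (by exact_mod_cast le_top)), mul_div_assoc, Finset.sum_div,
    Finset.mul_sum, Finset.mul_sum]
  refine Finset.sum_congr rfl fun r hr => ?_
  have hri : r ≤ i := Nat.lt_succ_iff.1 (Finset.mem_range.1 hr)
  rw [hqr r (hri.trans_lt hi), Nat.cast_choose ℝ hri, Nat.factorial_succ]
  have h1 : (i.factorial : ℝ) ≠ 0 := by positivity
  have h2 : (r.factorial : ℝ) ≠ 0 := by positivity
  have h3 : ((i - r).factorial : ℝ) ≠ 0 := by positivity
  push_cast
  field_simp

/-- The first coefficients, as a point of a finite dimensional space. -/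
def headCoeff (n : ℕ) (a : ℕ → ℝ) : Fin (n + 1) → ℝ := fun l => a l

theorem headCoeff_mem_closedBall {n : ℕ} {a : ℕ → ℝ} {B : ℝ} (hB : 0 ≤ B)
    (ha : ∀ l < n + 1, |a l| ≤ B) : headCoeff n a ∈ Metric.closedBall 0 B := by
  rw [mem_closedBall_zero_iff, pi_norm_le_iff_of_nonneg hB]
  exact fun l => ha l l.2

theorem exists_bound_comp_headCoeff {n : ℕ} {β : (Fin (n + 1) → ℝ) → ℝ} (hβ : Continuous β) (B : ℝ) :
    ∃ K, 0 ≤ K ∧ ∀ a : ℕ → ℝ, (∀ l < n + 1, |a l| ≤ B) → |β (headCoeff n a)| ≤ K := by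
  obtain ⟨K, hK⟩ := (isCompact_closedBall (0 : Fin (n + 1) → ℝ) B).exists_bound_of_continuousOn
    hβ.continuousOn
  refine ⟨|K|, abs_nonneg _, fun a ha => ?_⟩
  have hB : 0 ≤ B := (abs_nonneg _).trans (ha 0 (Nat.succ_pos n))
  exact (hK _ (headCoeff_mem_closedBall hB ha)).trans (le_abs_self K)

/-- The coefficients `a_0, …, a_n` are treated as parameters. The uniform Taylor theorem then gives
coefficients continuous in `a` and a remainder uniform over bounded `a`, as needed when `a` depends
on the boundary point. -/
theorem exists_exp_taylor (n : ℕ) (c : ℝ) : ∃ p : ℕ → (Fin (n + 1) → ℝ) → ℝ,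
    (∀ i, Continuous (p i)) ∧ (∀ a, p 0 (headCoeff n a) = Real.exp (c * a 0)) ∧
    (∀ a, ∀ i < n, p (i + 1) (headCoeff n a) = c / (i + 1) *
      ∑ r ∈ Finset.range (i + 1), (r + 1) * a (r + 1) * p (i - r) (headCoeff n a)) ∧
    ∀ B, ∀ m, ∃ K, 0 ≤ K ∧ ∀ a : ℕ → ℝ, (∀ l < n + 1, |a l| ≤ B) → ∀ s ∈ Icc (0 : ℝ) (1 / 2),
      |Real.exp (c * ∑ l ∈ Finset.range (n + 1), a l * s ^ l)
        - ∑ i ∈ Finset.range m, p i (headCoeff n a) * s ^ i| ≤ K * s ^ m := by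
  set F : (Fin (n + 1) → ℝ) × ℝ → ℝ := fun q => Real.exp (c * ∑ l : Fin (n + 1), q.1 l * q.2 ^ (l : ℕ))
    with hF
  have hFs : ContDiffOn ℝ ∞ F (univ ×ˢ Ico 0 1) := by
    refine ContDiff.contDiffOn ?_
    have : ∀ l : Fin (n + 1), ContDiff ℝ ∞ (fun q : (Fin (n + 1) → ℝ) × ℝ => q.1 l) := fun l =>
      (contDiff_apply ℝ ℝ l).comp contDiff_fst
    fun_prop
  have hFa : ∀ a : ℕ → ℝ, ∀ s, F (headCoeff n a, s)
      = Real.exp (c * ∑ l ∈ Finset.range (n + 1), a l * s ^ l) := fun a s => by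
    simp only [hF, headCoeff]
    rw [Fin.sum_univ_eq_sum_range (fun l => a l * s ^ l) (n + 1)]
  have hp : ∀ a i, sliceCoeff univ 1 F i (headCoeff n a) = iteratedDeriv i (fun s : ℝ =>
      Real.exp (c * ∑ l ∈ Finset.range (n + 1), a l * s ^ l)) 0 / i.factorial := by
    intro a i
    rw [sliceCoeff, ← iteratedDerivWithin_slice isOpen_univ (mem_univ _) i hFs 0 (by simp)]
    simp only [hFa]
    rw [iteratedDerivWithin_eq_iteratedDeriv (uniqueDiffOn_Ico 0 1) _ (by simp)]
    exact ContDiff.contDiffAt (by fun_prop)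
  refine ⟨sliceCoeff univ 1 F, fun i => ?_, fun a => ?_, fun a i hi => ?_, fun B m => ?_⟩
  · exact continuousOn_univ.1 (contDiffOn_sliceCoeff isOpen_univ one_pos hFs i).continuousOn
  · rw [hp]
    simp [Finset.sum_range_succ']
  · simp only [hp]
    exact iteratedDeriv_exp_polynomial n a c hi
  · obtain ⟨K, hK, h⟩ := exists_taylor_bound isOpen_univ
      (isCompact_closedBall (0 : Fin (n + 1) → ℝ) B) (subset_univ _) (by norm_num : (1 / 2 : ℝ) < 1)
      m hFs
    refine ⟨K, hK, fun a ha s hs => ?_⟩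
    have hB : 0 ≤ B := (abs_nonneg _).trans (ha 0 (Nat.succ_pos n))
    have := h _ (headCoeff_mem_closedBall hB ha) s hs
    rwa [hFa] at this

/-- Inverse powers of `s` in terms of the inverse powers of `s e^{a(s)}`. -/
theorem exists_inverse_power_expansion (n k : ℕ) (hk : k < n) :
    ∃ β : ℕ → (Fin (n + 1) → ℝ) → ℝ, (∀ j, Continuous (β j)) ∧
    ∀ B, ∃ K, 0 ≤ K ∧ ∀ a : ℕ → ℝ, (∀ l < n + 1, |a l| ≤ B) → ∀ s ∈ Ioc (0 : ℝ) (1 / 2),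
      |(s ^ (k + 1))⁻¹ - ((∑ j ∈ Finset.range n, β j (headCoeff n a)
          * ((s * Real.exp (∑ l ∈ Finset.range (n + 1), a l * s ^ l)) ^ (j + 1))⁻¹)
        + (k + 1) * a (k + 1))| ≤ K * s := by
  induction k using Nat.strong_induction_on with
  | _ k ih =>
  have ih' : ∀ i, ∃ β : ℕ → (Fin (n + 1) → ℝ) → ℝ, i < k → (∀ j, Continuous (β j)) ∧
      ∀ B, ∃ K, 0 ≤ K ∧ ∀ a : ℕ → ℝ, (∀ l < n + 1, |a l| ≤ B) → ∀ s ∈ Ioc (0 : ℝ) (1 / 2),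
      |(s ^ (i + 1))⁻¹ - ((∑ j ∈ Finset.range n, β j (headCoeff n a)
          * ((s * Real.exp (∑ l ∈ Finset.range (n + 1), a l * s ^ l)) ^ (j + 1))⁻¹)
        + (i + 1) * a (i + 1))| ≤ K * s := by
    intro i
    by_cases hi : i < k
    · obtain ⟨β, hβ⟩ := ih i hi (hi.trans hk)
      exact ⟨β, fun _ => hβ⟩
    · exact ⟨fun _ _ => 0, fun h => absurd h hi⟩
  choose β hβ using ih'
  -- The exponent is that of `ρ^{-(k+1)}`. With this choice the prefactor `c / (i + 1)` of the
  -- recursion is `-1` at `i = k`.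
  obtain ⟨p, hpc, hp0, hps, hpt⟩ := exists_exp_taylor n (-(k + 1 : ℝ))
  have hpos : ∀ a, 0 < p 0 (headCoeff n a) := fun a => by rw [hp0]; positivity
  have hext : ∀ b : Fin (n + 1) → ℝ, ∃ a : ℕ → ℝ, headCoeff n a = b := fun b =>
    ⟨fun l => if h : l < n + 1 then b ⟨l, h⟩ else 0, funext fun l => dif_pos l.2⟩
  have hp0' : ∀ b, p 0 b ≠ 0 := fun b => by
    obtain ⟨a, rfl⟩ := hext b
    exact (hpos a).ne'
  -- Obtained from `ρ^{-(k+1)} = p_0 s^{-(k+1)} + ∑_{i<k} p_{k-i} s^{-(i+1)} + p_{k+1} + O(s)`: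
  -- solve for `s^{-(k+1)}` and substitute the inductive expansions of the lower inverse powers.
  refine ⟨fun j b => (p 0 b)⁻¹ * ((if j = k then 1 else 0)
    - ∑ i ∈ Finset.range k, p (k - i) b * β i j b), fun j => ?_, fun B => ?_⟩
  · refine ((hpc 0).inv₀ hp0').mul (continuous_const.sub (continuous_finsetSum _ fun i hi => ?_))
    exact (hpc _).mul ((hβ i (Finset.mem_range.1 hi)).1 j)
  · obtain ⟨K₀, hK₀, htay⟩ := hpt B (k + 2)
    have hK₁ : ∀ i, ∃ K, 0 ≤ K ∧ (i < k → ∀ a : ℕ → ℝ, (∀ l < n + 1, |a l| ≤ B) →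
        ∀ s ∈ Ioc (0 : ℝ) (1 / 2),
        |(s ^ (i + 1))⁻¹ - ((∑ j ∈ Finset.range n, β i j (headCoeff n a)
          * ((s * Real.exp (∑ l ∈ Finset.range (n + 1), a l * s ^ l)) ^ (j + 1))⁻¹)
        + (i + 1) * a (i + 1))| ≤ K * s) := by
      intro i
      by_cases hi : i < k
      · obtain ⟨K, h0, hK⟩ := (hβ i hi).2 B
        exact ⟨K, h0, fun _ => hK⟩
      · exact ⟨0, le_rfl, fun h => absurd h hi⟩
    choose K₁ hK₁0 hK₁ using hK₁
    have hK₂ : ∀ i, ∃ K, 0 ≤ K ∧ ∀ a : ℕ → ℝ, (∀ l < n + 1, |a l| ≤ B) →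
      |p i (headCoeff n a)| ≤ K := fun i => exists_bound_comp_headCoeff (hpc i) B
    choose K₂ hK₂0 hK₂ using hK₂
    obtain ⟨K₃, hK₃0, hK₃⟩ := exists_bound_comp_headCoeff (β := fun b => (p 0 b)⁻¹)
      ((hpc 0).inv₀ hp0') B
    refine ⟨K₃ * (K₀ + ∑ i ∈ Finset.range k, K₂ (k - i) * K₁ i),
      mul_nonneg hK₃0 (add_nonneg hK₀ (Finset.sum_nonneg fun i _ => mul_nonneg (hK₂0 _) (hK₁0 _))),
      fun a ha s hs => ?_⟩
    have hs0 : 0 < s := hs.1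
    set b := headCoeff n a with hb
    set e := Real.exp (∑ l ∈ Finset.range (n + 1), a l * s ^ l) with he
    set T := fun i : ℕ => ∑ j ∈ Finset.range n, β i j b * ((s * e) ^ (j + 1))⁻¹ with hT
    have hepow : Real.exp (-(k + 1 : ℝ) * ∑ l ∈ Finset.range (n + 1), a l * s ^ l)
        = (e ^ (k + 1))⁻¹ := by
      rw [he, ← Real.exp_nat_mul, ← Real.exp_neg]
      congr 1
      push_cast
      ring
    have h1 := htay a ha s ⟨hs0.le, hs.2⟩
    rw [hepow] at h1
    have h2 : |((s * e) ^ (k + 1))⁻¹ - (p 0 b * (s ^ (k + 1))⁻¹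
        + (∑ i ∈ Finset.range k, p (k - i) b * (s ^ (i + 1))⁻¹) + p (k + 1) b)| ≤ K₀ * s := by
      have e1 : ((s * e) ^ (k + 1))⁻¹ - (p 0 b * (s ^ (k + 1))⁻¹
        + (∑ i ∈ Finset.range k, p (k - i) b * (s ^ (i + 1))⁻¹) + p (k + 1) b)
        = (s ^ (k + 1))⁻¹ * ((e ^ (k + 1))⁻¹ - ∑ i ∈ Finset.range (k + 2), p i b * s ^ i) := by
        rw [Finset.sum_range_succ, Finset.sum_range_succ',
          mul_sub, mul_add, mul_add, Finset.mul_sum, mul_pow, mul_inv]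
        have e2 : ∑ i ∈ Finset.range k, p (k - i) b * (s ^ (i + 1))⁻¹
            = ∑ i ∈ Finset.range k, (s ^ (k + 1))⁻¹ * (p (k - 1 - i + 1) b * s ^ (k - 1 - i + 1)) := by
          refine Finset.sum_congr rfl fun i hi => ?_
          have hik := Finset.mem_range.1 hi
          have e3 : k - 1 - i + 1 = k - i := by omega
          have e4 : s ^ (k + 1) = s ^ (k - i) * s ^ (i + 1) := by
            rw [← pow_add]; congr 1; omega
          rw [e3, e4]
          field_simp
        rw [e2, Finset.sum_range_reflect
          (fun i => (s ^ (k + 1))⁻¹ * (p (i + 1) b * s ^ (i + 1))) k]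
        have e5 : (s ^ (k + 1))⁻¹ * (p (k + 1) b * s ^ (k + 1)) = p (k + 1) b := by
          field_simp
        rw [e5]
        ring
      rw [e1, abs_mul, abs_of_pos (by positivity : 0 < (s ^ (k + 1))⁻¹)]
      calc (s ^ (k + 1))⁻¹ * _ ≤ (s ^ (k + 1))⁻¹ * (K₀ * s ^ (k + 2)) := by gcongr
        _ = K₀ * s := by rw [pow_succ s (k + 1)]; field_simp
    -- The crux: the recursion expresses `p_{k+1}` so that the constants `(i+1) a_{i+1} p_{k-i}`
    -- from the lower powers cancel, leaving exactly `(k+1) a_{k+1}` after division by `p_0`.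
    have h3 : p (k + 1) b = -((k + 1) * a (k + 1) * p 0 b)
        - ∑ i ∈ Finset.range k, (i + 1) * a (i + 1) * p (k - i) b := by
      rw [hps a k hk, Finset.sum_range_succ, Nat.sub_self]
      have : (k + 1 : ℝ) ≠ 0 := by positivity
      field_simp
      ring
    have h4 : |∑ i ∈ Finset.range k, p (k - i) b * ((s ^ (i + 1))⁻¹ - (T i + (i + 1) * a (i + 1)))|
        ≤ (∑ i ∈ Finset.range k, K₂ (k - i) * K₁ i) * s := by
      rw [Finset.sum_mul]
      refine (Finset.abs_sum_le_sum_abs _ _).trans (Finset.sum_le_sum fun i hi => ?_)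
      rw [abs_mul, mul_assoc]
      exact mul_le_mul (hK₂ _ a ha) (hK₁ i (Finset.mem_range.1 hi) a ha s hs) (abs_nonneg _) (hK₂0 _)
    have h5 : (∑ j ∈ Finset.range n, ((p 0 b)⁻¹ * ((if j = k then 1 else 0)
        - ∑ i ∈ Finset.range k, p (k - i) b * β i j b)) * ((s * e) ^ (j + 1))⁻¹)
        = (p 0 b)⁻¹ * (((s * e) ^ (k + 1))⁻¹ - ∑ i ∈ Finset.range k, p (k - i) b * T i) := by
      simp only [mul_assoc, ← Finset.mul_sum, sub_mul, Finset.sum_sub_distrib, ite_mul, one_mul,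
        zero_mul, Finset.sum_ite_eq', Finset.mem_range, hk, if_true, hT]
      congr 2
      simp only [Finset.sum_mul, Finset.mul_sum]
      rw [Finset.sum_comm]
      simp only [mul_assoc]
    have h6 : (s ^ (k + 1))⁻¹ - ((∑ j ∈ Finset.range n, ((p 0 b)⁻¹ * ((if j = k then 1 else 0)
        - ∑ i ∈ Finset.range k, p (k - i) b * β i j b)) * ((s * e) ^ (j + 1))⁻¹)
        + (k + 1) * a (k + 1))
        = (p 0 b)⁻¹ * (-(((s * e) ^ (k + 1))⁻¹ - (p 0 b * (s ^ (k + 1))⁻¹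
        + (∑ i ∈ Finset.range k, p (k - i) b * (s ^ (i + 1))⁻¹) + p (k + 1) b))
        - ∑ i ∈ Finset.range k, p (k - i) b * ((s ^ (i + 1))⁻¹ - (T i + (i + 1) * a (i + 1)))) := by
      rw [h5, h3]
      have hne : p 0 b ≠ 0 := hp0' b
      have e7 : ∑ i ∈ Finset.range k, p (k - i) b * ((s ^ (i + 1))⁻¹ - (T i + (i + 1) * a (i + 1)))
          = ∑ i ∈ Finset.range k, p (k - i) b * (s ^ (i + 1))⁻¹
            - ∑ i ∈ Finset.range k, p (k - i) b * T i
            - ∑ i ∈ Finset.range k, (i + 1) * a (i + 1) * p (k - i) b := by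
        rw [← Finset.sum_sub_distrib, ← Finset.sum_sub_distrib]
        exact Finset.sum_congr rfl fun i _ => by ring
      rw [e7]
      field_simp
      ring
    rw [h6, abs_mul, mul_assoc, add_mul]
    refine mul_le_mul (hK₃ a ha) ((abs_sub _ _).trans ?_) (abs_nonneg _) hK₃0
    rw [abs_neg]
    exact add_le_add h2 h4

end PowerExpansion

/-! ### Finite parts of one-dimensional integrals -/

section SliceIntegral

/-- The function `s e^{a(s)}`, `a(s) = ∑_{l ≤ n} a_l s^l + c s^{n+1}`. -/
def expRadius (n : ℕ) (a : ℕ → ℝ) (c s : ℝ) : ℝ :=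
  s * Real.exp ((∑ l ∈ Finset.range (n + 1), a l * s ^ l) + c * s ^ (n + 1))

/-- The antiderivative of `-s^{-k-1}`. -/
def inversePrimitive (k : ℕ) (s : ℝ) : ℝ := if k = 0 then -Real.log s else (s ^ k)⁻¹ / k

variable {n : ℕ} {a : ℕ → ℝ} {B C c s : ℝ}

theorem abs_sum_le_of_bounded (m : ℕ) (ha : ∀ l < m, |a l| ≤ B) (hs : s ∈ Icc (0 : ℝ) 1) :
    |∑ l ∈ Finset.range m, a l * s ^ l| ≤ m * B := by
  refine (Finset.abs_sum_le_sum_abs _ _).trans ?_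
  have : ∀ l ∈ Finset.range m, |a l * s ^ l| ≤ B := by
    intro l hl
    have h1 := ha l (Finset.mem_range.1 hl)
    have h2 : s ^ l ≤ 1 := pow_le_one₀ hs.1 hs.2
    have h3 : 0 ≤ s ^ l := pow_nonneg hs.1 l
    rw [abs_mul, abs_of_nonneg h3]
    nlinarith [abs_nonneg (a l)]
  simpa using Finset.sum_le_sum this

/-- The extra `c s^{n+1}` in the exponent changes `ρ^{-(j+1)}` by a multiple of `s^{n-j}`, which is
`O(s)` because `j < n`. So the upper and lower barriers have the same expansion. -/
theorem abs_inv_expRadius_sub_le {j : ℕ} (hj : j < n) (ha : ∀ l < n + 1, |a l| ≤ B) (hc : |c| ≤ C)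
    (hs : s ∈ Ioc (0 : ℝ) 1) (hsC : (n * C) * s ≤ 1) :
    |((expRadius n a c s) ^ (j + 1))⁻¹
      - ((s * Real.exp (∑ l ∈ Finset.range (n + 1), a l * s ^ l)) ^ (j + 1))⁻¹|
      ≤ Real.exp (n * ((n + 1) * B)) * (2 * (n * C)) * s := by
  have hs0 : 0 < s := hs.1
  have hB : 0 ≤ B := (abs_nonneg _).trans (ha 0 (Nat.succ_pos n))
  have hC : 0 ≤ C := (abs_nonneg _).trans hc
  set q := ∑ l ∈ Finset.range (n + 1), a l * s ^ l with hq
  have hqB : |q| ≤ (n + 1) * B := by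
    have := abs_sum_le_of_bounded (n + 1) ha ⟨hs0.le, hs.2⟩
    push_cast at this
    exact this
  have hjn : ((j : ℝ) + 1) ≤ n := by exact_mod_cast hj
  set x := -((j + 1) * (c * s ^ (n + 1))) with hx
  have hxb : |x| ≤ n * C * s ^ (n + 1) := by
    rw [hx, abs_neg, abs_mul, abs_mul, abs_of_pos (by positivity : (0 : ℝ) < j + 1),
      abs_of_pos (by positivity : 0 < s ^ (n + 1)), mul_assoc]
    gcongr
  have hx1 : |x| ≤ 1 := by
    refine hxb.trans (le_trans ?_ hsC)
    have : s ^ (n + 1) ≤ s := pow_le_of_le_one hs0.le hs.2 (by omega)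
    gcongr
  have e1 : (expRadius n a c s ^ (j + 1))⁻¹ - ((s * Real.exp q) ^ (j + 1))⁻¹
      = (s ^ (j + 1))⁻¹ * (Real.exp (-((j + 1) * q)) * (Real.exp x - 1)) := by
    have h1 : ∀ y, (Real.exp y ^ (j + 1))⁻¹ = Real.exp (-((j + 1) * y)) := fun y => by
      rw [← Real.exp_nat_mul, ← Real.exp_neg]
      push_cast
      rfl
    simp only [expRadius, mul_pow, mul_inv, h1, ← hq, mul_sub, ← Real.exp_add, hx, mul_one]
    congr 3
    ring
  rw [e1, abs_mul, abs_mul, abs_of_pos (by positivity : 0 < (s ^ (j + 1))⁻¹), abs_of_pos (Real.exp_pos _)]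
  have h2 : Real.exp (-((j + 1) * q)) ≤ Real.exp (n * ((n + 1) * B)) := by
    refine Real.exp_le_exp.2 ?_
    calc -((j + 1) * q) = (j + 1) * (-q) := by ring
      _ ≤ (j + 1) * ((n + 1) * B) := by gcongr; exact (neg_le_abs q).trans hqB
      _ ≤ _ := by gcongr
  have h3 : |Real.exp x - 1| ≤ 2 * (n * C * s ^ (n + 1)) :=
    (Real.abs_exp_sub_one_le hx1).trans (by gcongr)
  have h4 : (s ^ (j + 1))⁻¹ * s ^ (n + 1) ≤ s := by
    have : s ^ (n + 1) = s ^ (j + 1) * s ^ (n - j) := by rw [← pow_add]; congr 1; omega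
    rw [this, inv_mul_cancel_left₀ (by positivity)]
    exact pow_le_of_le_one hs0.le hs.2 (by omega)
  calc (s ^ (j + 1))⁻¹ * (Real.exp (-((j + 1) * q)) * |Real.exp x - 1|)
      ≤ (s ^ (j + 1))⁻¹ * (Real.exp (n * ((n + 1) * B)) * (2 * (n * C * s ^ (n + 1)))) := by gcongr
    _ = Real.exp (n * ((n + 1) * B)) * (2 * (n * C)) * ((s ^ (j + 1))⁻¹ * s ^ (n + 1)) := by ring
    _ ≤ _ := by gcongr

/-- Treats the logarithm and the inverse powers together: after division by `k`, the constant term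
is `a_k` in both cases. The functions `β` do not depend on `c`. -/
theorem exists_inversePrimitive_expansion (n k : ℕ) (hk : k ≤ n) :
    ∃ β : ℕ → (Fin (n + 1) → ℝ) → ℝ, (∀ j, Continuous (β j)) ∧
    ∀ B C, 0 ≤ B → 0 ≤ C → ∃ K s₀, 0 ≤ K ∧ 0 < s₀ ∧ ∀ (a : ℕ → ℝ) (c : ℝ),
      (∀ l < n + 1, |a l| ≤ B) → |c| ≤ C → ∀ s ∈ Ioc (0 : ℝ) s₀,
      |inversePrimitive k s - ((∑ j ∈ Finset.range n,
          β j (headCoeff n a) * ((expRadius n a c s) ^ (j + 1))⁻¹)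
        + (if k = 0 then -Real.log (expRadius n a c s) else 0) + a k)| ≤ K * s := by
  rcases k with _ | k
  · refine ⟨fun _ _ => 0, fun _ => continuous_const, fun B C hB hC => ⟨n * B + C, 1, by positivity,
      one_pos, fun a c ha hc s hs => ?_⟩⟩
    have hs0 : 0 < s := hs.1
    simp only [inversePrimitive, if_true, zero_mul, Finset.sum_const_zero, zero_add, expRadius]
    rw [Real.log_mul hs0.ne' (Real.exp_pos _).ne', Real.log_exp, Finset.sum_range_succ']
    have e1 : -Real.log s - (-(Real.log s + (∑ l ∈ Finset.range n, a (l + 1) * s ^ (l + 1)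
        + a 0 * s ^ 0 + c * s ^ (n + 1))) + a 0)
        = (∑ l ∈ Finset.range n, a (l + 1) * s ^ l + c * s ^ n) * s := by
      rw [add_mul, Finset.sum_mul]
      simp only [pow_succ, pow_zero, mul_one]
      simp only [mul_assoc]
      ring
    rw [e1, abs_mul, abs_of_pos hs0]
    gcongr
    refine (abs_add_le _ _).trans (add_le_add ?_ ?_)
    · exact abs_sum_le_of_bounded n (a := fun l => a (l + 1)) (fun l hl => ha _ (by omega))
        ⟨hs0.le, hs.2⟩
    · rw [abs_mul, abs_of_pos (by positivity : 0 < s ^ n)]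
      have : s ^ n ≤ 1 := pow_le_one₀ hs0.le hs.2
      nlinarith [abs_nonneg c]
  · obtain ⟨β, hβ, hexp⟩ := exists_inverse_power_expansion n k hk
    refine ⟨fun j b => β j b / (k + 1), fun j => (hβ j).div_const _, fun B C hB hC => ?_⟩
    obtain ⟨K, hK, hexp⟩ := hexp B
    have hKβ : ∀ j, ∃ K, 0 ≤ K ∧ ∀ a : ℕ → ℝ, (∀ l < n + 1, |a l| ≤ B) →
      |β j (headCoeff n a)| ≤ K := fun j => exists_bound_comp_headCoeff (hβ j) B
    choose Kβ hKβ0 hKβ using hKβ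
    set L := Real.exp (n * ((n + 1) * B)) * (2 * (n * C)) with hL
    have hL0 : 0 ≤ L := by positivity
    have hS0 : 0 ≤ ∑ j ∈ Finset.range n, Kβ j := Finset.sum_nonneg fun j _ => hKβ0 j
    refine ⟨K + (∑ j ∈ Finset.range n, Kβ j) * L, min (1 / 2) (1 / (n * C + 1)), by positivity,
      by positivity, fun a c ha hc s hs => ?_⟩
    have hs0 : 0 < s := hs.1
    have hs1 : s ≤ 1 / 2 := hs.2.trans (min_le_left _ _)
    have hsC : (n * C) * s ≤ 1 := by
      have := hs.2.trans (min_le_right _ _)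
      rw [le_div_iff₀ (by positivity)] at this
      nlinarith
    have h1 := hexp a ha s ⟨hs0, hs1⟩
    have h2 : |∑ j ∈ Finset.range n, β j (headCoeff n a) * ((expRadius n a c s ^ (j + 1))⁻¹
        - ((s * Real.exp (∑ l ∈ Finset.range (n + 1), a l * s ^ l)) ^ (j + 1))⁻¹)|
        ≤ (∑ j ∈ Finset.range n, Kβ j) * L * s := by
      rw [Finset.sum_mul, Finset.sum_mul]
      refine (Finset.abs_sum_le_sum_abs _ _).trans (Finset.sum_le_sum fun j hj => ?_)
      rw [abs_mul, mul_assoc]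
      exact mul_le_mul (hKβ j a ha) (abs_inv_expRadius_sub_le (Finset.mem_range.1 hj) ha hc
        ⟨hs0, hs1.trans (by norm_num)⟩ hsC) (abs_nonneg _) (hKβ0 j)
    have hk0 : (0 : ℝ) < k + 1 := by positivity
    have e1 : inversePrimitive (k + 1) s - ((∑ j ∈ Finset.range n,
          β j (headCoeff n a) / (k + 1) * ((expRadius n a c s) ^ (j + 1))⁻¹)
        + (if k + 1 = 0 then -Real.log (expRadius n a c s) else 0) + a (k + 1))
        = ((s ^ (k + 1))⁻¹ - ((∑ j ∈ Finset.range n, β j (headCoeff n a)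
          * ((s * Real.exp (∑ l ∈ Finset.range (n + 1), a l * s ^ l)) ^ (j + 1))⁻¹)
        + (k + 1) * a (k + 1)) - ∑ j ∈ Finset.range n, β j (headCoeff n a)
          * ((expRadius n a c s ^ (j + 1))⁻¹
        - ((s * Real.exp (∑ l ∈ Finset.range (n + 1), a l * s ^ l)) ^ (j + 1))⁻¹)) / (k + 1) := by
      simp only [inversePrimitive, Nat.succ_ne_zero, if_false, mul_sub, Finset.sum_sub_distrib,
        div_mul_eq_mul_div, ← Finset.sum_div]
      push_cast
      field_simp
      ring
    rw [e1, abs_div, abs_of_pos hk0]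
    refine (div_le_self (abs_nonneg _) (by linarith [Nat.cast_nonneg (α := ℝ) k])).trans ?_
    refine (abs_sub _ _).trans ?_
    exact (add_le_add h1 h2).trans_eq (by ring)

theorem hasDerivAt_expRadius (n : ℕ) (a : ℕ → ℝ) (c s : ℝ) :
    HasDerivAt (expRadius n a c) (Real.exp ((∑ l ∈ Finset.range (n + 1), a l * s ^ l)
      + c * s ^ (n + 1)) * (1 + ((∑ l ∈ Finset.range n, ((l + 1) * a (l + 1)) * s ^ l)
        + (n + 1) * c * s ^ n) * s)) s := by
  have h1 : ∀ l ∈ Finset.range (n + 1),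
      HasDerivAt (fun s : ℝ => a l * s ^ l) (a l * (l * s ^ (l - 1))) s :=
    fun l _ => (hasDerivAt_pow l s).const_mul (a l)
  have h2 := ((hasDerivAt_id s).mul (((HasDerivAt.fun_sum h1).add
    ((hasDerivAt_pow (n + 1) s).const_mul c)).exp))
  refine h2.congr_deriv ?_
  rw [Finset.sum_range_succ' (fun l => a l * (l * s ^ (l - 1)))]
  simp only [id, Nat.cast_zero, zero_mul, mul_zero, add_zero, Nat.add_sub_cancel, Pi.add_apply]
  have h3 : ∑ l ∈ Finset.range n, a (l + 1) * (((l + 1 : ℕ) : ℝ) * s ^ l)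
      = ∑ l ∈ Finset.range n, ((l + 1) * a (l + 1)) * s ^ l :=
    Finset.sum_congr rfl fun l _ => by push_cast; ring
  rw [h3]
  push_cast
  ring

theorem strictMonoOn_expRadius (n : ℕ) {B C : ℝ} (hB : 0 ≤ B) (hC : 0 ≤ C) : ∃ s₀, 0 < s₀ ∧
    ∀ (a : ℕ → ℝ) (c : ℝ), (∀ l < n + 1, |a l| ≤ B) → |c| ≤ C →
      StrictMonoOn (expRadius n a c) (Icc 0 s₀) := by
  set L := n * ((n + 1) * B) + (n + 1) * C with hL
  have hL0 : 0 ≤ L := by positivity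
  -- The derivative is a positive factor times `1 + X s` with `|X| ≤ L`, hence positive for `s < 1 /
  -- (L + 1)`.
  refine ⟨min 1 (1 / (L + 1)), by positivity, fun a c ha hc => ?_⟩
  refine strictMonoOn_of_deriv_pos (convex_Icc _ _)
    (fun s _ => (hasDerivAt_expRadius n a c s).continuousAt.continuousWithinAt) fun s hs => ?_
  rw [interior_Icc] at hs
  have hs0 : 0 < s := hs.1
  have hs1 : s ≤ 1 := hs.2.le.trans (min_le_left _ _)
  rw [(hasDerivAt_expRadius n a c s).deriv]
  refine mul_pos (Real.exp_pos _) ?_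
  set X := (∑ l ∈ Finset.range n, ((l + 1) * a (l + 1)) * s ^ l) + (n + 1) * c * s ^ n with hX
  have hXL : |X| ≤ L := by
    refine (abs_add_le _ _).trans (add_le_add ?_ ?_)
    · refine abs_sum_le_of_bounded n (a := fun l => (l + 1) * a (l + 1)) (fun l hl => ?_) ⟨hs0.le, hs1⟩
      rw [abs_mul, abs_of_pos (by positivity : (0 : ℝ) < l + 1)]
      have h1 : (l : ℝ) + 1 ≤ n + 1 := by
        have : (l : ℝ) ≤ n := by exact_mod_cast hl.le
        linarith
      exact mul_le_mul h1 (ha _ (by omega)) (abs_nonneg _) (by positivity)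
    · rw [abs_mul, abs_mul, abs_of_pos (by positivity : (0 : ℝ) < n + 1),
        abs_of_pos (by positivity : 0 < s ^ n)]
      have : s ^ n ≤ 1 := pow_le_one₀ hs0.le hs1
      calc (n + 1) * |c| * s ^ n ≤ (n + 1) * C * 1 := by gcongr
        _ = _ := mul_one _
  have h2 : s * (L + 1) < 1 := by
    have := hs.2.trans_le (min_le_right _ _)
    rwa [lt_div_iff₀ (by positivity)] at this
  have h3 := (abs_le.1 hXL).1
  nlinarith

theorem le_expRadius {B C : ℝ} (ha : ∀ l < n + 1, |a l| ≤ B) (hc : |c| ≤ C)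
    (hs : s ∈ Icc (0 : ℝ) 1) : s ≤ Real.exp ((n + 1) * B + C) * expRadius n a c s ∧
      expRadius n a c s ≤ Real.exp ((n + 1) * B + C) * s := by
  have h1 : |(∑ l ∈ Finset.range (n + 1), a l * s ^ l) + c * s ^ (n + 1)| ≤ (n + 1) * B + C := by
    refine (abs_add_le _ _).trans (add_le_add ?_ ?_)
    · have := abs_sum_le_of_bounded (n + 1) ha hs
      push_cast at this
      exact this
    · rw [abs_mul, abs_of_nonneg (pow_nonneg hs.1 _)]
      have : s ^ (n + 1) ≤ 1 := pow_le_one₀ hs.1 hs.2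
      nlinarith [abs_nonneg c, pow_nonneg hs.1 (n + 1)]
  rw [abs_le] at h1
  have hs0 := hs.1
  unfold expRadius
  constructor
  · rw [mul_left_comm, ← Real.exp_add]
    exact le_mul_of_one_le_right hs0 (Real.one_le_exp (by linarith))
  · rw [mul_comm s]
    exact mul_le_mul_of_nonneg_right (Real.exp_le_exp.2 h1.2) hs0

theorem hasDerivAt_inversePrimitive (k : ℕ) {s : ℝ} (hs : 0 < s) :
    HasDerivAt (fun s => -inversePrimitive k s) (s ^ (k + 1))⁻¹ s := by
  rcases k with _ | k
  · simpa [inversePrimitive] using Real.hasDerivAt_log hs.ne'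
  · have h1 := (((hasDerivAt_pow (k + 1) s).inv (by positivity)).div_const ((k + 1 : ℕ) : ℝ)).neg
    have h2 : (fun s => -inversePrimitive (k + 1) s)
        = -(fun s : ℝ => ((fun x : ℝ => x ^ (k + 1))⁻¹ s) / ((k + 1 : ℕ) : ℝ)) := by
      funext s
      simp [inversePrimitive]
    rw [h2]
    refine h1.congr_deriv ?_
    have : ((k + 1 : ℕ) : ℝ) ≠ 0 := by positivity
    field_simp
    simp
    ring

theorem integral_Ioo_inv_pow (k : ℕ) {b s₁ : ℝ} (hb : 0 < b) (hbs : b ≤ s₁) :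
    ∫ s in Ioo b s₁, (s ^ (k + 1))⁻¹ = inversePrimitive k b - inversePrimitive k s₁ := by
  rw [← integral_Ioc_eq_integral_Ioo, ← intervalIntegral.integral_of_le hbs]
  have hpos : ∀ s ∈ uIcc b s₁, 0 < s := fun s hs => by
    rw [uIcc_of_le hbs] at hs
    exact hb.trans_le hs.1
  rw [intervalIntegral.integral_eq_sub_of_hasDerivAt
    (fun s hs => hasDerivAt_inversePrimitive k (hpos s hs))]
  · ring
  · refine ContinuousOn.intervalIntegrable fun s hs => ?_
    have := hpos s hs
    exact ((continuousAt_id.pow (k + 1)).inv₀ (by simpa using this.ne')).continuousWithinAt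

theorem expRadius_zero (n : ℕ) (a : ℕ → ℝ) (c : ℝ) : expRadius n a c 0 = 0 := by
  simp [expRadius]

theorem exists_slice_eq_Ioo {s₁ ε : ℝ} (hs₁ : 0 < s₁) (h : StrictMonoOn (expRadius n a c) (Icc 0 s₁))
    (hε : 0 < ε) (hε' : ε < expRadius n a c s₁) :
    ∃ b ∈ Ioo 0 s₁, expRadius n a c b = ε ∧ {s | s ∈ Ioo 0 s₁ ∧ ε < expRadius n a c s} = Ioo b s₁ := by
  obtain ⟨b, hb, hbε⟩ := intermediate_value_Ioo hs₁.le
    (fun s _ => (hasDerivAt_expRadius n a c s).continuousAt.continuousWithinAt)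
    (by rw [expRadius_zero]; exact ⟨hε, hε'⟩ : ε ∈ Ioo (expRadius n a c 0) (expRadius n a c s₁))
  refine ⟨b, hb, hbε, ?_⟩
  ext s
  constructor
  · rintro ⟨hs, hsε⟩
    refine ⟨?_, hs.2⟩
    rw [← hbε] at hsε
    exact (h.lt_iff_lt (Ioo_subset_Icc_self hb) (Ioo_subset_Icc_self hs)).1 hsε
  · intro hs
    have hs' : s ∈ Ioo 0 s₁ := ⟨hb.1.trans hs.1, hs.2⟩
    refine ⟨hs', ?_⟩
    rw [← hbε]
    exact h (Ioo_subset_Icc_self hb) (Ioo_subset_Icc_self hs') hs.1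

/-- Finite part of the integral of `s^{-k-1}` over `{s e^{a(s)} > ε}`. -/
theorem exists_slice_integral_expansion (n k : ℕ) (hk : k ≤ n) :
    ∃ β : ℕ → (Fin (n + 1) → ℝ) → ℝ, (∀ j, Continuous (β j)) ∧
    ∀ B C, 0 ≤ B → 0 ≤ C → ∃ s₀, 0 < s₀ ∧ ∀ s₁, 0 < s₁ → s₁ ≤ s₀ → ∃ K ε₀, 0 ≤ K ∧ 0 < ε₀ ∧
      ∀ (a : ℕ → ℝ) (c : ℝ), (∀ l < n + 1, |a l| ≤ B) → |c| ≤ C → ∀ ε ∈ Ioo 0 ε₀,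
      |(∫ s in {s | s ∈ Ioo 0 s₁ ∧ ε < expRadius n a c s}, (s ^ (k + 1))⁻¹)
        - ((∑ j ∈ Finset.range n, β j (headCoeff n a) * (ε ^ (j + 1))⁻¹)
        + (if k = 0 then -Real.log ε else 0) + (a k - inversePrimitive k s₁))| ≤ K * ε := by
  obtain ⟨β, hβ, h⟩ := exists_inversePrimitive_expansion n k hk
  refine ⟨β, hβ, fun B C hB hC => ?_⟩
  obtain ⟨K, s₂, hK, hs₂, h⟩ := h B C hB hC
  obtain ⟨s₃, hs₃, hmono⟩ := strictMonoOn_expRadius n hB hC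
  set R := Real.exp ((n + 1) * B + C) with hR
  have hR0 : 0 < R := Real.exp_pos _
  -- Since `s ≤ R ρ`, the bound `ε < s₁ / R` ensures that the level `ε` is reached before `s₁`, and
  -- `b ≤ R ε` at the crossing turns an `O(b)` error into `O(ε)`.
  refine ⟨min (min s₂ s₃) 1, by positivity, fun s₁ hs₁ hs₁' =>
    ⟨K * R, s₁ / R, by positivity, by positivity, fun a c ha hc ε hε => ?_⟩⟩
  have hs₁1 : s₁ ≤ 1 := hs₁'.trans (min_le_right _ _)
  have hm : StrictMonoOn (expRadius n a c) (Icc 0 s₁) := (hmono a c ha hc).mono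
    (Icc_subset_Icc_right (hs₁'.trans ((min_le_left _ _).trans (min_le_right _ _))))
  have hε' : ε < expRadius n a c s₁ := by
    have h1 := (le_expRadius ha hc ⟨hs₁.le, hs₁1⟩).1
    have h2 : ε * R < s₁ := by
      have := hε.2
      rwa [lt_div_iff₀ hR0] at this
    by_contra hcon
    rw [not_lt] at hcon
    nlinarith
  obtain ⟨b, hb, hbε, hset⟩ := exists_slice_eq_Ioo hs₁ hm hε.1 hε'
  have hbR := (le_expRadius ha hc ⟨hb.1.le, hb.2.le.trans hs₁1⟩).1
  rw [hbε] at hbR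
  rw [hset, integral_Ioo_inv_pow k hb.1 hb.2.le]
  have h1 := h a c ha hc b ⟨hb.1, hb.2.le.trans
    (hs₁'.trans ((min_le_left _ _).trans (min_le_left _ _)))⟩
  rw [hbε] at h1
  calc _ = _ := by
        congr 1
        ring
    _ ≤ K * b := h1
    _ ≤ K * R * ε := by rw [mul_assoc]; gcongr

end SliceIntegral

/-! ### Integration over the boundary -/

section FamilyIntegral

variable {N : Type*} [MeasurableSpace N] {n : ℕ} {a : ℕ → N → ℝ} {B C c ε s₁ : ℝ}

/-- The product measure on `N × (0, s₁)`. -/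
def collarMeasure (μ : Measure N) (s₁ : ℝ) : Measure (N × ℝ) := μ.prod (volume.restrict (Ioo 0 s₁))

/-- The superlevel set of `s e^{a(x, s)}`. -/
def superlevel (n : ℕ) (a : ℕ → N → ℝ) (c ε : ℝ) : Set (N × ℝ) :=
  {p | ε < expRadius n (fun k => a k p.1) c p.2}

theorem measurable_expRadius (ha : ∀ k, Measurable (a k)) (c : ℝ) :
    Measurable fun p : N × ℝ => expRadius n (fun k => a k p.1) c p.2 := by
  unfold expRadius
  refine measurable_snd.mul (Measurable.exp (Measurable.add ?_ ?_))
  · exact Finset.measurable_fun_sum _ fun k _ => ((ha k).comp measurable_fst).mul (measurable_snd.pow_const k)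
  · exact (measurable_snd.pow_const _).const_mul c

theorem measurableSet_superlevel (ha : ∀ k, Measurable (a k)) (c ε : ℝ) :
    MeasurableSet (superlevel n a c ε) :=
  measurableSet_lt measurable_const (measurable_expRadius ha c)

theorem collarMeasure_eq (μ : Measure N) [SFinite μ] (s₁ : ℝ) :
    collarMeasure μ s₁ = (μ.prod volume).restrict (univ ×ˢ Ioo 0 s₁) := by
  rw [collarMeasure, ← Measure.prod_restrict, Measure.restrict_univ]

theorem ae_collarMeasure (μ : Measure N) [SFinite μ] (s₁ : ℝ) :
    ∀ᵐ p ∂(collarMeasure μ s₁), p.2 ∈ Ioo 0 s₁ := by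
  rw [collarMeasure_eq]
  filter_upwards [ae_restrict_mem (MeasurableSet.univ.prod measurableSet_Ioo)] with p hp using hp.2

instance (μ : Measure N) [IsFiniteMeasure μ] : IsFiniteMeasure (collarMeasure μ s₁) := by
  unfold collarMeasure; infer_instance

/-- On the superlevel set `s` is at least `ε / R`, so the singular integrand is bounded on a finite
measure space. -/
theorem integrableOn_superlevel (μ : Measure N) [IsFiniteMeasure μ] (ha : ∀ k, Measurable (a k))
    (hB : ∀ k < n + 1, ∀ x, |a k x| ≤ B) (hc : |c| ≤ C) (hs₁ : s₁ ≤ 1) (hε : 0 < ε) {v : N → ℝ}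
    (hv : Measurable v) {Bv : ℝ} (hBv : ∀ x, |v x| ≤ Bv) (k : ℕ) :
    IntegrableOn (fun p : N × ℝ => v p.1 * (p.2 ^ (k + 1))⁻¹) (superlevel n a c ε)
      (collarMeasure μ s₁) := by
  set R := Real.exp ((n + 1) * B + C) with hR
  have hR0 : 0 < R := Real.exp_pos _
  refine Measure.integrableOn_of_bounded (M := Bv * ((ε / R) ^ (k + 1))⁻¹)
    (measure_lt_top _ _).ne ?_ ?_
  · exact ((hv.comp measurable_fst).mul ((measurable_snd.pow_const _).inv)).aestronglyMeasurable
  · filter_upwards [ae_restrict_mem (measurableSet_superlevel ha c ε),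
      ae_restrict_of_ae (ae_collarMeasure μ s₁)] with p hp hps
    have hs : p.2 ∈ Icc (0 : ℝ) 1 := ⟨hps.1.le, hps.2.le.trans hs₁⟩
    have h1 := (le_expRadius (fun k hk => hB k hk p.1) hc hs).2
    have h2 : ε / R ≤ p.2 := by
      rw [div_le_iff₀ hR0, mul_comm]
      exact (le_of_lt hp).trans h1
    have h0 : 0 < p.2 := hps.1
    rw [Real.norm_eq_abs, abs_mul, abs_of_pos (by positivity : 0 < (p.2 ^ (k + 1))⁻¹)]
    have := hBv p.1
    have hBv0 : 0 ≤ Bv := (abs_nonneg _).trans this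
    gcongr

theorem integral_slice_superlevel (ha : ∀ k, Measurable (a k)) (v : N → ℝ) (k : ℕ) (x : N) :
    ∫ s in Ioo 0 s₁, (superlevel n a c ε).indicator (fun p : N × ℝ => v p.1 * (p.2 ^ (k + 1))⁻¹) (x, s)
      = v x * ∫ s in {s : ℝ | s ∈ Ioo 0 s₁ ∧ ε < expRadius n (fun k => a k x) c s},
          (s ^ (k + 1))⁻¹ := by
  have hm := measurableSet_superlevel (n := n) ha c ε
  have hmx : MeasurableSet {s | ε < expRadius n (fun k => a k x) c s} := measurable_prodMk_left hm
  have h1 : (fun s => (superlevel n a c ε).indicator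
      (fun p : N × ℝ => v p.1 * (p.2 ^ (k + 1))⁻¹) (x, s))
      = {s | ε < expRadius n (fun k => a k x) c s}.indicator (fun s => v x * (s ^ (k + 1))⁻¹) := by
    funext s
    by_cases h : ε < expRadius n (fun k => a k x) c s <;> simp [indicator, superlevel, h]
  rw [h1, integral_indicator hmx, Measure.restrict_restrict hmx, integral_const_mul]
  congr 3
  ext s
  simp [and_comm]

theorem setIntegral_superlevel (μ : Measure N) [IsFiniteMeasure μ] (ha : ∀ k, Measurable (a k))
    (hB : ∀ k < n + 1, ∀ x, |a k x| ≤ B) (hc : |c| ≤ C) (hs₁ : s₁ ≤ 1) (hε : 0 < ε) {v : N → ℝ}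
    (hv : Measurable v) {Bv : ℝ} (hBv : ∀ x, |v x| ≤ Bv) (k : ℕ) :
    ∫ p in superlevel n a c ε, v p.1 * (p.2 ^ (k + 1))⁻¹ ∂(collarMeasure μ s₁)
      = ∫ x, v x * (∫ s in {s : ℝ | s ∈ Ioo 0 s₁ ∧ ε < expRadius n (fun k => a k x) c s},
          (s ^ (k + 1))⁻¹) ∂μ := by
  have hm := measurableSet_superlevel (n := n) ha c ε
  have hint := (integrable_indicator_iff hm).2
    (integrableOn_superlevel μ ha hB hc hs₁ hε hv hBv k)
  rw [← integral_indicator hm, collarMeasure, integral_prod _ hint]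
  exact integral_congr_ae (Eventually.of_forall fun x => integral_slice_superlevel ha v k x)

/-- As `ε → 0` the superlevel sets exhaust the collar, and dominated convergence applies. -/
theorem tendsto_setIntegral_superlevel (μ : Measure N) [IsFiniteMeasure μ]
    (ha : ∀ k, Measurable (a k)) {g : N × ℝ → ℝ} (hg : Integrable g (collarMeasure μ s₁)) :
    Tendsto (fun ε => ∫ p in superlevel n a c ε, g p ∂(collarMeasure μ s₁)) (𝓝[>] 0)
      (𝓝 (∫ p, g p ∂(collarMeasure μ s₁))) := by
  have h : (fun ε => ∫ p in superlevel n a c ε, g p ∂(collarMeasure μ s₁))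
      = fun ε => ∫ p, (superlevel n a c ε).indicator g p ∂(collarMeasure μ s₁) := by
    funext ε
    rw [integral_indicator (measurableSet_superlevel ha c ε)]
  rw [h]
  refine tendsto_integral_filter_of_dominated_convergence (fun p => ‖g p‖) ?_ ?_ hg.norm ?_
  · exact Eventually.of_forall fun ε =>
      hg.aestronglyMeasurable.indicator (measurableSet_superlevel ha c ε)
  · exact Eventually.of_forall fun ε => Eventually.of_forall fun p => norm_indicator_le_norm_self _ _
  · filter_upwards [ae_collarMeasure μ s₁] with p hp
    have h0 : 0 < expRadius n (fun k => a k p.1) c p.2 := mul_pos hp.1 (Real.exp_pos _)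
    refine tendsto_const_nhds.congr' ?_
    filter_upwards [mem_nhdsWithin_of_mem_nhds (gt_mem_nhds h0)] with ε hε
    rw [indicator_of_mem]
    exact hε

/-- The slice expansion is uniform over coefficients bounded by `B` and `C`, so it may be integrated
against `v`. The range of `s₁` is fixed before `μ`, `a` and `c`, so that one `s₁` serves both
barriers. -/
theorem exists_family_integral_expansion (n k : ℕ) (hk : k ≤ n) :
    ∃ β : ℕ → (Fin (n + 1) → ℝ) → ℝ, (∀ j, Continuous (β j)) ∧
    ∀ B C, 0 ≤ B → 0 ≤ C → ∀ᶠ s₁ in 𝓝[>] (0 : ℝ), ∀ (μ : Measure N) [IsFiniteMeasure μ]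
      (a : ℕ → N → ℝ) (c : ℝ) (v : N → ℝ) (Bv : ℝ), (∀ k, Measurable (a k)) →
      (∀ l < n + 1, ∀ x, |a l x| ≤ B) → |c| ≤ C → Measurable v → (∀ x, |v x| ≤ Bv) →
      Tendsto (fun ε => (∫ p in superlevel n a c ε, v p.1 * (p.2 ^ (k + 1))⁻¹ ∂(collarMeasure μ s₁))
        - ((∑ j ∈ Finset.range n, (∫ x, v x * β j (headCoeff n fun l => a l x) ∂μ) * (ε ^ (j + 1))⁻¹)
          + (∫ x, v x ∂μ) * (if k = 0 then -Real.log ε else 0))) (𝓝[>] 0)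
        (𝓝 ((∫ x, v x * a k x ∂μ) - (∫ x, v x ∂μ) * inversePrimitive k s₁)) := by
  obtain ⟨β, hβ, h⟩ := exists_slice_integral_expansion n k hk
  refine ⟨β, hβ, fun B C hB hC => ?_⟩
  obtain ⟨s₀, hs₀, h⟩ := h B C hB hC
  filter_upwards [Ioc_mem_nhdsGT (lt_min hs₀ one_pos)] with s₁ hs₁ μ _ a c v Bv ha haB hc hv hBv
  obtain ⟨K, ε₀, hK, hε₀, h⟩ := h s₁ hs₁.1 (hs₁.2.trans (min_le_left _ _))
  have hs₁1 : s₁ ≤ 1 := hs₁.2.trans (min_le_right _ _)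
  have hvi : Integrable v μ := Integrable.of_bound hv.aestronglyMeasurable Bv
    (Eventually.of_forall hBv)
  have hai : Integrable (fun x => v x * a k x) μ := by
    refine hvi.mul_bdd (c := B) (ha k).aestronglyMeasurable ?_
    exact Eventually.of_forall fun x => haB k (by omega) x
  have hβm : ∀ j, Measurable (fun x => β j (headCoeff n fun l => a l x)) := fun j =>
    (hβ j).measurable.comp (measurable_pi_lambda _ fun l => ha l)
  have hβi : ∀ j, Integrable (fun x => v x * β j (headCoeff n fun l => a l x)) μ := by
    intro j
    obtain ⟨K, -, hK⟩ := exists_bound_comp_headCoeff (hβ j) B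
    refine hvi.mul_bdd (c := K) (hβm j).aestronglyMeasurable ?_
    exact Eventually.of_forall fun x => hK _ fun l hl => haB l hl x
  rw [tendsto_iff_norm_sub_tendsto_zero]
  have hlim : Tendsto (fun ε : ℝ => Bv * K * ε * μ.real univ) (𝓝[>] 0) (𝓝 0) := by
    have : Tendsto (fun ε : ℝ => Bv * K * ε * μ.real univ) (𝓝 0) (𝓝 (Bv * K * 0 * μ.real univ)) :=
      Continuous.tendsto (by fun_prop) 0
    simp only [mul_zero, zero_mul] at this
    exact this.mono_left nhdsWithin_le_nhds
  refine squeeze_zero' (Eventually.of_forall fun _ => norm_nonneg _) ?_ hlim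
  filter_upwards [Ioo_mem_nhdsGT hε₀] with ε hε
  set I : N → ℝ := fun x => ∫ s in {s | s ∈ Ioo 0 s₁ ∧ ε < expRadius n (fun k => a k x) c s},
          (s ^ (k + 1))⁻¹ with hI
  set J : N → ℝ := fun x => (∑ j ∈ Finset.range n, β j (headCoeff n fun l => a l x) * (ε ^ (j + 1))⁻¹)
        + (if k = 0 then -Real.log ε else 0) + (a k x - inversePrimitive k s₁) with hJ
  have hIJ : ∀ x, |v x * I x - v x * J x| ≤ Bv * K * ε := by
    intro x
    rw [← mul_sub, abs_mul, mul_assoc]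
    exact mul_le_mul (hBv x) (h (fun l => a l x) c (fun l hl => haB l hl x) hc ε hε) (abs_nonneg _)
      ((abs_nonneg _).trans (hBv x))
  have hJe : (fun x => v x * J x) = fun x => (∑ j ∈ Finset.range n,
      (v x * β j (headCoeff n fun l => a l x)) * (ε ^ (j + 1))⁻¹)
      + v x * (if k = 0 then -Real.log ε else 0) + (v x * a k x - v x * inversePrimitive k s₁) := by
    funext x
    simp only [hJ, mul_add, mul_sub, Finset.mul_sum, mul_assoc]
  have i1 : Integrable (fun x => ∑ j ∈ Finset.range n,
      (v x * β j (headCoeff n fun l => a l x)) * (ε ^ (j + 1))⁻¹) μ :=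
    integrable_finsetSum _ fun j _ => (hβi j).mul_const _
  have i2 : Integrable (fun x => v x * (if k = 0 then -Real.log ε else 0)) μ := hvi.mul_const _
  have i3 : Integrable (fun x => v x * inversePrimitive k s₁) μ := hvi.mul_const _
  have hJi : Integrable (fun x => v x * J x) μ := by
    rw [hJe]
    exact (i1.add i2).add (hai.sub i3)
  have hIi : Integrable (fun x => v x * I x) μ := by
    have hm := measurableSet_superlevel (n := n) ha c ε
    have hint := ((integrable_indicator_iff hm).2
      (integrableOn_superlevel μ ha haB hc hs₁1 hε.1 hv hBv k)).integral_prod_left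
    exact hint.congr (Eventually.of_forall fun x => integral_slice_superlevel ha v k x)
  rw [setIntegral_superlevel μ ha haB hc hs₁1 hε.1 hv hBv k]
  have hJint : ∫ x, v x * J x ∂μ = (∑ j ∈ Finset.range n,
      (∫ x, v x * β j (headCoeff n fun l => a l x) ∂μ) * (ε ^ (j + 1))⁻¹)
      + (∫ x, v x ∂μ) * (if k = 0 then -Real.log ε else 0)
      + ((∫ x, v x * a k x ∂μ) - (∫ x, v x ∂μ) * inversePrimitive k s₁) := by
    rw [hJe, integral_add (f := fun x => (∑ j ∈ Finset.range n,
        (v x * β j (headCoeff n fun l => a l x)) * (ε ^ (j + 1))⁻¹)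
        + v x * (if k = 0 then -Real.log ε else 0))
      (g := fun x => v x * a k x - v x * inversePrimitive k s₁) (i1.add i2) (hai.sub i3),
      integral_add i1 i2, integral_sub hai i3,
      integral_finsetSum _ fun j _ => (hβi j).mul_const _]
    simp only [integral_mul_const]
  have hfin : (∫ x, v x * I x ∂μ) - ((∑ j ∈ Finset.range n,
      (∫ x, v x * β j (headCoeff n fun l => a l x) ∂μ) * (ε ^ (j + 1))⁻¹)
      + (∫ x, v x ∂μ) * (if k = 0 then -Real.log ε else 0))
      - ((∫ x, v x * a k x ∂μ) - (∫ x, v x ∂μ) * inversePrimitive k s₁)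
      = ∫ x, (v x * I x - v x * J x) ∂μ := by
    rw [integral_sub hIi hJi, hJint]
    ring
  rw [hfin]
  exact norm_integral_le_of_norm_le_const (Eventually.of_forall hIJ)

end FamilyIntegral

/-! ### Integration of the full volume density -/

section DensityIntegral

variable {N : Type*} [MeasurableSpace N] {n : ℕ} {a v : ℕ → N → ℝ} {D : N × ℝ → ℝ} {C s₁ : ℝ}

/-- The difference of `s^{-n-1} D` and its singular part `s^{-n-1} ∑ v_j s^j`. -/
def densityRemainder (n : ℕ) (v : ℕ → N → ℝ) (D : N × ℝ → ℝ) (p : N × ℝ) : ℝ :=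
  (p.2 ^ (n + 1))⁻¹ * D p - ∑ j ∈ Finset.range (n + 1), v j p.1 * (p.2 ^ (n - j + 1))⁻¹

/-- The contribution of the collar `N × (0, s₁)` to the renormalized volume which does not depend
on the conformal factor. -/
def collarConstant (n : ℕ) (μ : Measure N) (v : ℕ → N → ℝ) (D : N × ℝ → ℝ) (s₁ : ℝ) : ℝ :=
  (∫ p, densityRemainder n v D p ∂(collarMeasure μ s₁))
    - ∑ j ∈ Finset.range (n + 1), (∫ x, v j x ∂μ) * inversePrimitive (n - j) s₁

theorem densityRemainder_eq (p : N × ℝ) (hp : 0 < p.2) :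
    densityRemainder n v D p = (p.2 ^ (n + 1))⁻¹ *
      (D p - ∑ j ∈ Finset.range (n + 1), v j p.1 * p.2 ^ j) := by
  rw [densityRemainder, mul_sub, Finset.mul_sum]
  congr 1
  refine Finset.sum_congr rfl fun j hj => ?_
  have hjn : j ≤ n := Nat.lt_succ_iff.1 (Finset.mem_range.1 hj)
  have : p.2 ^ (n + 1) = p.2 ^ (n - j + 1) * p.2 ^ j := by rw [← pow_add]; congr 1; omega
  rw [this]
  field_simp

theorem measurable_densityRemainder (hv : ∀ j < n + 1, Measurable (v j)) (hD : Measurable D) :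
    Measurable (densityRemainder n v D) := by
  unfold densityRemainder
  refine ((measurable_snd.pow_const _).inv.mul hD).sub (Finset.measurable_fun_sum _ fun j hj => ?_)
  exact ((hv j (Finset.mem_range.1 hj)).comp measurable_fst).mul (measurable_snd.pow_const _).inv

/-- After the singular part is removed the integrand is `O(|log s|)`, which is integrable at 0. -/
theorem integrable_densityRemainder (μ : Measure N) [IsFiniteMeasure μ]
    (hv : ∀ j < n + 1, Measurable (v j)) (hD : Measurable D) {CD s₀ : ℝ}
    (hDv : ∀ (x : N) (s : ℝ), 0 < s → s < s₀ →
      |D (x, s) - ∑ j ∈ Finset.range (n + 1), v j x * s ^ j| ≤ CD * (s ^ (n + 1) * |Real.log s|))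
    (hs₁ : 0 < s₁) (hs₁' : s₁ ≤ s₀) :
    Integrable (densityRemainder n v D) (collarMeasure μ s₁) := by
  have hlog : Integrable Real.log (volume.restrict (Ioo 0 s₁)) := by
    have h := (intervalIntegral.intervalIntegrable_log' (a := 0) (b := s₁))
    rw [intervalIntegrable_iff_integrableOn_Ioo_of_le hs₁.le] at h
    exact h
  have hdom : Integrable (fun p : N × ℝ => CD * |Real.log p.2|) (collarMeasure μ s₁) :=
    Integrable.mul_prod (integrable_const (μ := μ) CD) hlog.abs
  refine hdom.mono' (measurable_densityRemainder hv hD).aestronglyMeasurable ?_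
  filter_upwards [ae_collarMeasure μ s₁] with p hp
  have h0 : 0 < p.2 := hp.1
  rw [densityRemainder_eq p h0, Real.norm_eq_abs, abs_mul,
    abs_of_pos (by positivity : 0 < (p.2 ^ (n + 1))⁻¹)]
  calc (p.2 ^ (n + 1))⁻¹ * _ ≤ (p.2 ^ (n + 1))⁻¹ * (CD * (p.2 ^ (n + 1) * |Real.log p.2|)) := by
        gcongr
        exact hDv p.1 p.2 h0 (hp.2.trans_le hs₁')
    _ = CD * |Real.log p.2| := by field_simp

/-- The term `v_j s^j` of the density meets the finite part with `k = n - j`. The numbers `q` and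
`E` are chosen before `c`, so both barriers share all divergent terms as well as the limit. -/
theorem exists_density_integral_expansion (μ : Measure N) [IsFiniteMeasure μ]
    (hv : ∀ j < n + 1, Measurable (v j)) (hvb : ∀ j < n + 1, ∃ B, ∀ x, |v j x| ≤ B)
    (hD : Measurable D) {CD s₀ : ℝ} (hs₀ : 0 < s₀)
    (hDv : ∀ (x : N) (s : ℝ), 0 < s → s < s₀ →
      |D (x, s) - ∑ j ∈ Finset.range (n + 1), v j x * s ^ j| ≤ CD * (s ^ (n + 1) * |Real.log s|))
    (ha : ∀ k, Measurable (a k)) (hab : ∀ k, ∃ B, ∀ x, |a k x| ≤ B) (hC : 0 ≤ C) :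
    ∀ᶠ s₁ in 𝓝[>] (0 : ℝ), (∀ c, |c| ≤ C → ∀ ε, 0 < ε → IntegrableOn
        (fun p => (p.2 ^ (n + 1))⁻¹ * D p) (superlevel n a c ε) (collarMeasure μ s₁)) ∧
      ∃ (q : ℕ → ℝ) (E : ℝ), ∀ c, |c| ≤ C → Tendsto (fun ε : ℝ =>
        (∫ p in superlevel n a c ε, (p.2 ^ (n + 1))⁻¹ * D p ∂(collarMeasure μ s₁))
          - ((∑ j ∈ Finset.range n, q j / ε ^ (n - j)) + E * Real.log (1 / ε))) (𝓝[>] 0)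
        (𝓝 (collarConstant n μ v D s₁
          + ∫ x, ∑ j ∈ Finset.range (n + 1), v j x * a (n - j) x ∂μ)) := by
  choose Ba hBa using hab
  set B := ∑ k ∈ Finset.range (n + 1), |Ba k| with hB
  have hB0 : 0 ≤ B := Finset.sum_nonneg fun _ _ => abs_nonneg _
  have hBa' : ∀ k < n + 1, ∀ x, |a k x| ≤ B := fun k hk x =>
    ((hBa k x).trans (le_abs_self _)).trans
      (Finset.single_le_sum (f := fun k => |Ba k|) (fun _ _ => abs_nonneg _) (Finset.mem_range.2 hk))
  have hfam := fun j => exists_family_integral_expansion (N := N) n (n - j) (Nat.sub_le n j)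
  choose β hβc hβ using hfam
  have hev : ∀ᶠ s₁ in 𝓝[>] (0 : ℝ), ∀ j ∈ Finset.range (n + 1), _ :=
    (Finset.eventually_all _).2 fun j _ => hβ j B C hB0 hC
  filter_upwards [hev, Ioc_mem_nhdsGT (lt_min hs₀ one_pos)] with s₁ hs₁fam hs₁
  have hs₁1 : s₁ ≤ 1 := hs₁.2.trans (min_le_right _ _)
  have hR := integrable_densityRemainder μ hv hD hDv hs₁.1 (hs₁.2.trans (min_le_left _ _))
  have hsplit : (fun p : N × ℝ => (p.2 ^ (n + 1))⁻¹ * D p) = fun p => densityRemainder n v D p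
      + ∑ j ∈ Finset.range (n + 1), v j p.1 * (p.2 ^ (n - j + 1))⁻¹ := by
    funext p
    simp [densityRemainder]
  have hterm : ∀ c, |c| ≤ C → ∀ ε, 0 < ε → ∀ j ∈ Finset.range (n + 1), IntegrableOn
      (fun p : N × ℝ => v j p.1 * (p.2 ^ (n - j + 1))⁻¹) (superlevel n a c ε)
      (collarMeasure μ s₁) := by
    intro c hc ε hε j hj
    obtain ⟨Bv, hBv⟩ := hvb j (Finset.mem_range.1 hj)
    exact integrableOn_superlevel μ ha hBa' hc hs₁1 hε (hv j (Finset.mem_range.1 hj)) hBv _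
  -- Here `q_m` multiplies `ε^{-(n-m)}`, which is the term of index `n - 1 - m` in the family
  -- expansion. Only `j = n` feeds the logarithm.
  refine ⟨fun c hc ε hε => ?_, fun m => ∑ j ∈ Finset.range (n + 1),
    ∫ x, v j x * β j (n - 1 - m) (headCoeff n fun l => a l x) ∂μ,
    ∑ j ∈ Finset.range (n + 1), if n - j = 0 then ∫ x, v j x ∂μ else 0, fun c hc => ?_⟩
  · rw [hsplit]
    exact hR.integrableOn.add (integrable_finsetSum _ fun j hj => hterm c hc ε hε j hj)
  · have h1 := tendsto_setIntegral_superlevel (n := n) (c := c) μ ha hR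
    have h2 := tendsto_finsetSum (Finset.range (n + 1)) fun j hj => by
      obtain ⟨Bv, hBv⟩ := hvb j (Finset.mem_range.1 hj)
      exact hs₁fam j hj μ a c (v j) Bv ha hBa' hc (hv j (Finset.mem_range.1 hj)) hBv
    have hint : ∀ j ∈ Finset.range (n + 1), Integrable (fun x => v j x * a (n - j) x) μ := by
      intro j hj
      obtain ⟨Bv, hBv⟩ := hvb j (Finset.mem_range.1 hj)
      refine (Integrable.of_bound (hv j (Finset.mem_range.1 hj)).aestronglyMeasurable Bv
        (Eventually.of_forall hBv)).mul_bdd (c := B) (ha _).aestronglyMeasurable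
        (Eventually.of_forall fun x => hBa' (n - j) (by omega) x)
    have hlim : collarConstant n μ v D s₁ + ∫ x, ∑ j ∈ Finset.range (n + 1), v j x * a (n - j) x ∂μ
        = (∫ p, densityRemainder n v D p ∂(collarMeasure μ s₁))
        + ∑ j ∈ Finset.range (n + 1), ((∫ x, v j x * a (n - j) x ∂μ)
          - (∫ x, v j x ∂μ) * inversePrimitive (n - j) s₁) := by
      rw [integral_finsetSum _ hint, Finset.sum_sub_distrib, collarConstant]
      ring
    rw [hlim]
    refine (h1.add h2).congr' ?_
    filter_upwards [self_mem_nhdsWithin] with ε hε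
    rw [hsplit, integral_add hR.integrableOn (integrable_finsetSum _ fun j hj => hterm c hc ε hε j hj),
      integral_finsetSum _ fun j hj => hterm c hc ε hε j hj, Finset.sum_sub_distrib,
      Finset.sum_add_distrib]
    have e1 : ∑ j ∈ Finset.range n, (∑ i ∈ Finset.range (n + 1),
        ∫ x, v i x * β i (n - 1 - j) (headCoeff n fun l => a l x) ∂μ) / ε ^ (n - j)
        = ∑ i ∈ Finset.range (n + 1), ∑ j ∈ Finset.range n,
          (∫ x, v i x * β i j (headCoeff n fun l => a l x) ∂μ) * (ε ^ (j + 1))⁻¹ := by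
      rw [Finset.sum_comm, ← Finset.sum_range_reflect]
      refine Finset.sum_congr rfl fun j hj => ?_
      have hj' := Finset.mem_range.1 hj
      have e3 : n - 1 - (n - 1 - j) = j := by omega
      have e4 : n - (n - 1 - j) = j + 1 := by omega
      rw [e3, e4, Finset.sum_div]
      rfl
    have e2 : (∑ j ∈ Finset.range (n + 1), if n - j = 0 then ∫ x, v j x ∂μ else 0) * Real.log (1 / ε)
        = ∑ j ∈ Finset.range (n + 1), (∫ x, v j x ∂μ) * (if n - j = 0 then -Real.log ε else 0) := by
      rw [Finset.sum_mul]
      refine Finset.sum_congr rfl fun j _ => ?_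
      split_ifs <;> simp
    rw [e1, e2]
    ring

end DensityIntegral

/-! ### Volume of subsets of the collar -/

section CollarVolume

variable {n : ℕ}
  {M : Type*} [TopologicalSpace M] [ChartedSpace (EuclideanHalfSpace (n + 1)) M]
  [IsManifold (𝓡∂ (n + 1)) ∞ M] [MeasurableSpace M] [BorelSpace M]
  {N : Type*} [TopologicalSpace N] [ChartedSpace (EuclideanSpace ℝ (Fin n)) N]
  [MeasurableSpace N] [BorelSpace N]
  {gbar : SmoothMetric (𝓡∂ (n + 1)) M} {ι : N → M} {δ : ℝ} {Φ : PartialEquiv (N × ℝ) M}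
  {u : M → ℝ} {D : N × ℝ → ℝ} {s₁ : ℝ} {ν : Measure M} {μ : Measure N}

theorem measure_image_collar (hΦ : IsGeodesicCollar gbar ι δ Φ) {F : N × ℝ → ℝ≥0∞}
    [SFinite μ] (h : ν.restrict (Φ '' (univ ×ˢ Ioo 0 δ)) =
      Measure.map Φ (((μ.prod volume).restrict (univ ×ˢ Ioo 0 δ)).withDensity F))
    {A : Set (N × ℝ)} (hA : MeasurableSet A) (hAs : A ⊆ univ ×ˢ Ioo 0 δ) :
    ν (Φ '' A) = ∫⁻ p in A, F p ∂(μ.prod volume) := by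
  have hS : MeasurableSet (univ ×ˢ Ioo 0 δ : Set (N × ℝ)) := MeasurableSet.univ.prod measurableSet_Ioo
  have hAm : MeasurableSet (Φ '' A) := measurableSet_image_collar hΦ hA
    (hAs.trans (prod_mono le_rfl Ioo_subset_Ico_self))
  have hae : AEMeasurable Φ (((μ.prod volume).restrict (univ ×ˢ Ioo 0 δ)).withDensity F) :=
    ((hΦ.smooth.continuousOn.mono (prod_mono le_rfl Ioo_subset_Ico_self)).aemeasurable hS).mono_ac
      (withDensity_absolutelyContinuous _ _)
  have hinj : Φ ⁻¹' (Φ '' A) ∩ (univ ×ˢ Ioo 0 δ) = A := by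
    refine subset_antisymm ?_ fun p hp => ⟨mem_image_of_mem _ hp, hAs hp⟩
    rintro p ⟨⟨q, hq, hqp⟩, hp⟩
    have hsub : (univ ×ˢ Ioo 0 δ : Set (N × ℝ)) ⊆ Φ.source := by
      rw [hΦ.source]; exact prod_mono le_rfl Ioo_subset_Ico_self
    rwa [← Φ.injOn (hsub (hAs hq)) (hsub hp) hqp]
  rw [← Measure.restrict_eq_self ν (image_mono hAs), h, Measure.map_apply_of_aemeasurable hae hAm,
    withDensity_apply', Measure.restrict_restrict' hS, hinj]

theorem measure_image_inter_collar (hΦ : IsGeodesicCollar gbar ι δ Φ) [IsFiniteMeasure μ]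
    (h : ν.restrict (Φ '' (univ ×ˢ Ioo 0 δ)) =
      Measure.map Φ (((μ.prod volume).restrict (univ ×ˢ Ioo 0 δ)).withDensity
        fun p => ENNReal.ofReal ((p.2 ^ (n + 1))⁻¹ * D p)))
    (hD0 : ∀ᵐ p ∂(collarMeasure μ s₁), 0 ≤ D p) (hs₁ : s₁ ≤ δ) {U : Set (N × ℝ)}
    (hU : MeasurableSet U)
    (hint : IntegrableOn (fun p => (p.2 ^ (n + 1))⁻¹ * D p) U (collarMeasure μ s₁)) :
    ν (Φ '' (U ∩ univ ×ˢ Ioo 0 s₁))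
      = ENNReal.ofReal (∫ p in U, (p.2 ^ (n + 1))⁻¹ * D p ∂(collarMeasure μ s₁)) := by
  have hS : MeasurableSet (univ ×ˢ Ioo 0 s₁ : Set (N × ℝ)) :=
    MeasurableSet.univ.prod measurableSet_Ioo
  rw [measure_image_collar hΦ h (hU.inter hS)
    (inter_subset_right.trans (prod_mono le_rfl (Ioo_subset_Ioo_right hs₁))),
    ofReal_integral_eq_lintegral_ofReal hint, collarMeasure_eq, Measure.restrict_restrict hU]
  filter_upwards [ae_restrict_of_ae hD0, ae_restrict_of_ae (ae_collarMeasure μ s₁)] with p hp hps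
  have : 0 < p.2 := hps.1
  positivity

/-- The measure sees `D` only through `ENNReal.ofReal`, so the image of `{D < 0}` has volume zero.
Hence that set is null for the product measure. Without this, the volume could not be written as a
Bochner integral of `s^{-n-1} D`. -/
theorem ae_density_nonneg [IsManifold (𝓡 n) ∞ N] [CompactSpace N]
    (hΦ : IsGeodesicCollar gbar ι δ Φ)
    [IsFiniteMeasure (riemannianVolume (𝓡 n) (inducedMetric gbar ι))]
    (hι : range ι = (𝓡∂ (n + 1)).boundary M)
    (hu : Continuous u) (hu0 : ∀ p ∈ (𝓡∂ (n + 1)).interior M, u p ≠ 0)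
    (hD : Measurable D)
    (h : (riemannianVolume (𝓡∂ (n + 1)) (singularMetric gbar u)).restrict (Φ '' (univ ×ˢ Ioo 0 δ)) =
      Measure.map Φ ((((riemannianVolume (𝓡 n) (inducedMetric gbar ι)).prod volume).restrict
        (univ ×ˢ Ioo 0 δ)).withDensity fun p => ENNReal.ofReal ((p.2 ^ (n + 1))⁻¹ * D p)))
    (hs₁ : s₁ ≤ δ) :
    ∀ᵐ p ∂(collarMeasure (riemannianVolume (𝓡 n) (inducedMetric gbar ι)) s₁), 0 ≤ D p := by
  set A : Set (N × ℝ) := {p | D p < 0} ∩ univ ×ˢ Ioo 0 δ with hA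
  have hAm : MeasurableSet A := (measurableSet_lt hD measurable_const).inter
    (MeasurableSet.univ.prod measurableSet_Ioo)
  have h0 : riemannianVolume (𝓡∂ (n + 1)) (singularMetric gbar u) (Φ '' A) = 0 := by
    rw [measure_image_collar hΦ h hAm inter_subset_right]
    refine (setLIntegral_congr_fun hAm fun p hp => ?_).trans (lintegral_zero)
    have hp2 : 0 < p.2 := hp.2.2.1
    have hpD : D p < 0 := hp.1
    exact ENNReal.ofReal_of_nonpos (mul_nonpos_of_nonneg_of_nonpos (by positivity) hpD.le)
  have h1 := prod_eq_zero_of_image hΦ hι hu hu0 hAm inter_subset_right h0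
  rw [collarMeasure_eq, ae_restrict_iff' (MeasurableSet.univ.prod measurableSet_Ioo)]
  refine measure_mono_null (fun p hp => ?_) h1
  simp only [mem_compl_iff, mem_ofPred_eq, Classical.not_imp, not_le] at hp
  exact ⟨hp.2, mem_univ _, hp.1.2.1, hp.1.2.2.trans_le hs₁⟩

end CollarVolume

/-! ### Expansion of the volume and its derivative in `t` -/

section Expansion

variable {n : ℕ}
  {M : Type*} [TopologicalSpace M] [ChartedSpace (EuclideanHalfSpace (n + 1)) M]
  [IsManifold (𝓡∂ (n + 1)) ∞ M] [MeasurableSpace M] [BorelSpace M]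
  {N : Type*} [TopologicalSpace N] [ChartedSpace (EuclideanSpace ℝ (Fin n)) N]
  [IsManifold (𝓡 n) ∞ N] [MeasurableSpace N] [BorelSpace N]
  {gbar : SmoothMetric (𝓡∂ (n + 1)) M} {ι : N → M} {δ : ℝ} {Φ : PartialEquiv (N × ℝ) M}
  {u w : M → ℝ} {v : ℕ → N → ℝ}

theorem distBoundary_eq_zero (g : SmoothMetric (𝓡∂ (n + 1)) M) {p : M}
    (hp : p ∈ (𝓡∂ (n + 1)).boundary M) : distBoundary g p = 0 := by
  let _ : RiemannianBundle (fun x : M => TangentSpace (𝓡∂ (n + 1)) x) := ⟨g.toRiemannianMetric⟩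
  unfold distBoundary
  exact le_antisymm (iInf₂_le_of_le p hp Manifold.riemannianEDist_self.le) (zero_le)

/-- The volume expansion for `e^{2tw} ḡ`, with its constant term. -/
theorem exists_isRenormalizedVolume [T2Space M] [CompactSpace M] [CompactSpace N]
    [IsFiniteMeasure (riemannianVolume (𝓡 n) (inducedMetric gbar ι))] (hιc : Continuous ι)
    (hι : range ι = (𝓡∂ (n + 1)).boundary M) (hΦ : IsGeodesicCollar gbar ι δ Φ)
    (hu : Continuous u) (hu0 : ∀ p ∈ (𝓡∂ (n + 1)).interior M, u p ≠ 0)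
    (hv : IsRenormalizedVolumeCoeffs (singularMetric gbar u) gbar ι δ Φ v)
    (hw : ContMDiff (𝓡∂ (n + 1)) 𝓘(ℝ, ℝ) ∞ w) {a : ℕ → ℝ → N → ℝ}
    (ha : HasDistanceExpansion gbar δ Φ hw univ a) :
    ∃ κ : ℝ → ℝ, ∀ t, ∀ᶠ s₁ in 𝓝[>] (0 : ℝ),
      IsRenormalizedVolume n (singularMetric gbar u)
        (gbar.conformal (fun p => t * w p) (contMDiff_const.mul hw))
        (κ s₁ + ∫ x, ∑ j ∈ Finset.range (n + 1), v j x * a (n - j) t x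
          ∂(riemannianVolume (𝓡 n) (inducedMetric gbar ι))) := by
  set μ := riemannianVolume (𝓡 n) (inducedMetric gbar ι) with hμ
  set ν := riemannianVolume (𝓡∂ (n + 1)) (singularMetric gbar u) with hν
  obtain ⟨D, hD, hdens, CD, s₀, hs₀, hDv⟩ := hv.expansion
  have hvc : ∀ j < n + 1, Continuous (v j) := fun j hj => (hv.smooth j (Nat.lt_succ_iff.1 hj)).continuous
  have hvb : ∀ j < n + 1, ∃ B, ∀ x, |v j x| ≤ B := fun j hj => by
    obtain ⟨B, hB⟩ := isCompact_univ.exists_bound_of_continuousOn (hvc j hj).continuousOn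
    exact ⟨B, fun x => hB x (mem_univ x)⟩
  set O : ℝ → Set M := fun s₁ => Φ '' (univ ×ˢ (Ico 0 δ ∩ Iio s₁)) with hO
  -- The volume outside the collar plus the finite part inside it, neither involving `t`. Only the
  -- range of admissible `s₁` depends on `t`.
  refine ⟨fun s₁ => (ν (O s₁)ᶜ).toReal + collarConstant n μ v D s₁, fun t => ?_⟩
  set g := gbar.conformal (fun p => t * w p) (contMDiff_const.mul hw) with hg
  obtain ⟨C, s₂, hC, hs₂, hs₂δ, hbound⟩ := ha.bound t
  have hexp := exists_density_integral_expansion μ (fun j hj => (hvc j hj).measurable) hvb hD hs₀ hDv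
    (fun k => ha.measurable k t)
    (fun k => (ha.bounded k t).imp fun _ hB x => hB x (mem_univ x)) hC
  filter_upwards [hexp, Ioc_mem_nhdsGT hs₂] with s₁ ⟨hint, q, E, hlim⟩ hs₁
  have hs₁δ : s₁ < δ := hs₁.2.trans_lt hs₂δ
  have hD0 : ∀ᵐ p ∂(collarMeasure μ s₁), 0 ≤ D p :=
    ae_density_nonneg hΦ hι hu hu0 hD hdens hs₁δ.le
  have hOo : IsOpen (O s₁) := isOpen_image_collar hΦ s₁
  have hOfin : ν (O s₁)ᶜ < ⊤ := by
    refine riemannianVolume_singularMetric_lt_top gbar u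
      ((𝓡∂ (n + 1)).isOpen_interior (n := ∞) (by simp)) hu.continuousOn hu0
      hOo.isClosed_compl.isCompact ?_
    rw [← ModelWithCorners.compl_boundary]
    refine compl_subset_compl.2 ?_
    rw [← hι]
    rintro _ ⟨x, rfl⟩
    exact ⟨(x, 0), ⟨mem_univ _, left_mem_Ico.2 hΦ.pos, hs₁.1⟩, hΦ.zero x⟩
  set W : ℝ → Set M := fun ε => {p | ENNReal.ofReal ε < distBoundary g p} with hW
  set A : ℝ → ℝ → Set (N × ℝ) := fun c ε => superlevel n (fun k => a k t) c ε ∩ univ ×ˢ Ioo 0 s₁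
    with hA
  -- Inside the collar, `{r̂ > ε}` is trapped between the superlevel sets of the two barriers.
  have hlow : ∀ ε, Φ '' A (-C) ε ⊆ W ε ∩ O s₁ := by
    rintro ε _ ⟨⟨x, s⟩, ⟨hp, -, hs⟩, rfl⟩
    have hs' : s ∈ Ioo 0 s₂ := ⟨hs.1, hs.2.trans_le hs₁.2⟩
    refine ⟨lt_of_lt_of_le ?_ (hbound x (mem_univ x) s hs').1,
      mem_image_of_mem _ ⟨mem_univ _, ⟨hs.1.le, hs.2.trans hs₁δ⟩, hs.2⟩⟩
    rw [ENNReal.ofReal_lt_ofReal_iff (mul_pos hs.1 (Real.exp_pos _)), sub_eq_add_neg, ← neg_mul]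
    exact hp
  have hupp : ∀ ε, 0 < ε → W ε ∩ O s₁ ⊆ Φ '' A C ε := by
    rintro ε hε _ ⟨hp, ⟨⟨x, s⟩, ⟨-, hsδ, hs⟩, rfl⟩⟩
    -- Points with `s = 0` lie on `∂M`, where the distance vanishes, so they do not belong to `{r̂ >
    -- ε}`.
    have hs0 : 0 < s := by
      refine lt_of_le_of_ne hsδ.1 fun h0 => ?_
      subst h0
      have : distBoundary g (Φ (x, 0)) = 0 := by
        refine distBoundary_eq_zero g ?_
        rw [← hι, hΦ.zero]
        exact mem_range_self x
      simp [hW, this] at hp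
    have hs' : s ∈ Ioo 0 s₂ := ⟨hs0, lt_of_lt_of_le hs hs₁.2⟩
    refine mem_image_of_mem _ ⟨?_, mem_univ _, hs0, hs⟩
    have h1 := lt_of_lt_of_le hp (hbound x (mem_univ x) s hs').2
    rwa [ENNReal.ofReal_lt_ofReal_iff (mul_pos hs0 (Real.exp_pos _))] at h1
  have hvol : ∀ c, |c| ≤ C → ∀ ε, 0 < ε → ν (Φ '' A c ε) = ENNReal.ofReal
      (∫ p in superlevel n (fun k => a k t) c ε, (p.2 ^ (n + 1))⁻¹ * D p ∂(collarMeasure μ s₁)) :=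
    fun c hc ε hε => measure_image_inter_collar hΦ hdens hD0 hs₁δ.le
      (measurableSet_superlevel (fun k => ha.measurable k t) c ε) (hint c hc ε hε)
  have hnonneg : ∀ c ε, 0 ≤ ∫ p in superlevel n (fun k => a k t) c ε, (p.2 ^ (n + 1))⁻¹ * D p
      ∂(collarMeasure μ s₁) := fun c ε => by
    refine integral_nonneg_of_ae ?_
    filter_upwards [ae_restrict_of_ae hD0, ae_restrict_of_ae (ae_collarMeasure μ s₁)] with p hp hps
    have : 0 < p.2 := hps.1
    simp only [Pi.zero_apply]
    positivity
  have hCabs : |C| ≤ C := (abs_of_nonneg hC).le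
  have hCabs' : |-C| ≤ C := by rw [abs_neg]; exact hCabs
  have hWO : ∀ ε, 0 < ε → ν (W ε ∩ O s₁) < ⊤ := fun ε hε => by
    refine (measure_mono (hupp ε hε)).trans_lt ?_
    rw [hvol C hCabs ε hε]
    exact ENNReal.ofReal_lt_top
  have hWfin : ∀ ε, 0 < ε → ν (W ε) < ⊤ := fun ε hε => by
    rw [← measure_inter_add_sdiff (W ε) hOo.measurableSet]
    exact ENNReal.add_lt_top.2 ⟨hWO ε hε, (measure_mono fun p hp => hp.2).trans_lt hOfin⟩
  refine ⟨fun ε hε => (hWfin ε hε).ne, q, E, ?_⟩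
  obtain ⟨c₀, hc₀, hfar⟩ := exists_le_distBoundary_of_notMem hιc hΦ hι g hs₁.1
  have hWeq : ∀ ε ∈ Ioo 0 c₀, (ν (W ε)).toReal = (ν (W ε ∩ O s₁)).toReal + (ν (O s₁)ᶜ).toReal := by
    intro ε hε
    have h1 : W ε \ O s₁ = (O s₁)ᶜ := by
      refine subset_antisymm (fun p hp => hp.2) fun p hp => ⟨?_, hp⟩
      exact ((ENNReal.ofReal_lt_ofReal_iff hc₀).2 hε.2).trans_le (hfar p hp)
    rw [← measure_inter_add_sdiff (W ε) hOo.measurableSet, h1,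
      ENNReal.toReal_add (hWO ε hε.1).ne hOfin.ne]
  have hlower : ∀ ε, 0 < ε → ∫ p in superlevel n (fun k => a k t) (-C) ε,
      (p.2 ^ (n + 1))⁻¹ * D p ∂(collarMeasure μ s₁) ≤ (ν (W ε ∩ O s₁)).toReal := fun ε hε => by
    rw [← ENNReal.ofReal_le_iff_le_toReal (hWO ε hε).ne, ← hvol (-C) hCabs' ε hε]
    exact measure_mono (hlow ε)
  have hupper : ∀ ε, 0 < ε → (ν (W ε ∩ O s₁)).toReal ≤ ∫ p in superlevel n (fun k => a k t) C ε,
      (p.2 ^ (n + 1))⁻¹ * D p ∂(collarMeasure μ s₁) := fun ε hε => by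
    refine ENNReal.toReal_le_of_le_ofReal (hnonneg C ε) ?_
    rw [← hvol C hCabs ε hε]
    exact measure_mono (hupp ε hε)
  have hl := (hlim (-C) hCabs').const_add (ν (O s₁)ᶜ).toReal
  have hu := (hlim C hCabs).const_add (ν (O s₁)ᶜ).toReal
  rw [← add_assoc] at hl hu
  -- The bounds with `-C` and `C` have the same subtracted terms and the same limit, so the true
  -- volume is squeezed.
  refine tendsto_of_tendsto_of_tendsto_of_le_of_le' hl hu ?_ ?_
  · filter_upwards [Ioo_mem_nhdsGT hc₀] with ε hε
    change _ ≤ (ν (W ε)).toReal - _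
    rw [hWeq ε hε]
    have := hlower ε hε.1
    linarith
  · filter_upwards [Ioo_mem_nhdsGT hc₀] with ε hε
    change (ν (W ε)).toReal - _ ≤ _
    rw [hWeq ε hε]
    have := hupper ε hε.1
    linarith

/-- Differentiation under the integral, dominated by the uniform Lipschitz bound in `t`. Reversing
the sum turns `v_j a_{n-j}` into the pairing of `v_{n-j}` with the `j`-th normal derivative. -/
theorem hasDerivAt_integral_coeff {μ : Measure N} [IsFiniteMeasure μ] {a : ℕ → ℝ → N → ℝ}
    {hw : ContMDiff (𝓡∂ (n + 1)) 𝓘(ℝ, ℝ) ∞ w}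
    (ha : HasDistanceExpansion gbar δ Φ hw univ a)
    (hv : ∀ j < n + 1, Measurable (v j)) (hvb : ∀ j < n + 1, ∃ B, ∀ x, |v j x| ≤ B) :
    HasDerivAt (fun t => ∫ x, ∑ j ∈ Finset.range (n + 1), v j x * a (n - j) t x ∂μ)
      (∫ x, ∑ j ∈ Finset.range (n + 1),
        v (n - j) x / (j + 1).factorial * normalDeriv Φ δ w j x ∂μ) 0 := by
  set F : ℝ → N → ℝ := fun t x => ∑ j ∈ Finset.range (n + 1), v j x * a (n - j) t x with hF
  set F' : N → ℝ := fun x => ∑ j ∈ Finset.range (n + 1),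
    v (n - j) x / (j + 1).factorial * normalDeriv Φ δ w j x with hF'
  have hFm : ∀ t, Measurable (F t) := fun t => Finset.measurable_fun_sum _ fun j hj =>
    (hv j (Finset.mem_range.1 hj)).mul (ha.measurable _ t)
  have hd : ∀ x, HasDerivAt (fun t => F t x) (F' x) 0 := by
    intro x
    have h1 : HasDerivAt (fun t => F t x) (∑ j ∈ Finset.range (n + 1),
        v j x * (normalDeriv Φ δ w (n - j) x / (n - j + 1).factorial)) 0 :=
      HasDerivAt.fun_sum fun j _ => (ha.hasDerivAt (n - j) (by omega) x (mem_univ x)).const_mul _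
    convert h1 using 1
    rw [← Finset.sum_range_reflect]
    refine Finset.sum_congr rfl fun j hj => ?_
    have hj' := Finset.mem_range.1 hj
    have e1 : n + 1 - 1 - j = n - j := by omega
    have e2 : n - (n - j) = j := by omega
    rw [e1, e2]
    ring
  -- Measurability is inherited as a pointwise limit of difference quotients, with no separate study
  -- of the normal derivatives in `x`.
  have hF'm : Measurable F' := by
    refine measurable_of_tendsto_metrizable' (𝓝[≠] (0 : ℝ))
      (f := fun t x => t⁻¹ * (F t x - F 0 x)) (fun t => ((hFm t).sub (hFm 0)).const_mul _) ?_
    refine tendsto_pi_nhds.2 fun x => ?_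
    simpa using (hasDerivAt_iff_tendsto_slope_zero.1 (hd x))
  choose! Bv hBv using hvb
  choose Bl hBl using ha.lipschitz
  choose Ba hBa using fun k => ha.bounded k 0
  have hint0 : Integrable (F 0) μ := by
    refine integrable_finsetSum _ fun j hj => ?_
    exact (Integrable.of_bound (hv j (Finset.mem_range.1 hj)).aestronglyMeasurable (Bv j)
      (Eventually.of_forall (hBv j (Finset.mem_range.1 hj)))).mul_bdd (c := Ba (n - j))
      (ha.measurable _ 0).aestronglyMeasurable
      (Eventually.of_forall fun x => hBa (n - j) x (mem_univ x))
  have hlip : ∀ x, ∀ t ∈ Metric.ball (0 : ℝ) 1, ‖F t x - F 0 x‖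
      ≤ (∑ j ∈ Finset.range (n + 1), Bv j * Bl (n - j)) * ‖t - 0‖ := by
    intro x t ht
    have ht' : |t| ≤ 1 := by
      rw [mem_ball_zero_iff] at ht
      exact ht.le
    rw [sub_zero, Real.norm_eq_abs, Real.norm_eq_abs, Finset.sum_mul, hF, ← Finset.sum_sub_distrib]
    refine (Finset.abs_sum_le_sum_abs _ _).trans (Finset.sum_le_sum fun j hj => ?_)
    have h1 := hBv j (Finset.mem_range.1 hj) x
    rw [← mul_sub, abs_mul, mul_assoc]
    exact mul_le_mul h1 (hBl (n - j) t ht' x (mem_univ x)) (abs_nonneg _) ((abs_nonneg _).trans h1)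
  have key := hasFDerivAt_integral_of_dominated_loc_of_lip' (𝕜 := ℝ) (μ := μ) (F := F) (x₀ := 0)
    (F' := fun x => ContinuousLinearMap.toSpanSingleton ℝ (F' x))
    (bound := fun _ => ∑ j ∈ Finset.range (n + 1), Bv j * Bl (n - j))
    (Metric.ball_mem_nhds 0 one_pos) (fun t _ => (hFm t).aestronglyMeasurable) hint0 ?_
    (Eventually.of_forall hlip) (integrable_const _)
    (Eventually.of_forall fun x => (hd x).hasFDerivAt)
  · have h2 := key.2.hasDerivAt
    rw [ContinuousLinearMap.integral_apply key.1] at h2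
    simpa using h2
  · have hc : Continuous fun y : ℝ => ContinuousLinearMap.toSpanSingleton ℝ y :=
      (ContinuousLinearMap.toSpanSingletonCLE (𝕜 := ℝ) (E := ℝ)).continuous
    exact hc.comp_aestronglyMeasurable hF'm.aestronglyMeasurable

end Expansion

end RenormVol

end

/-! ### The variation formula -/

theorem proposition4p1 {n : ℕ}
    {M : Type*} [TopologicalSpace M] [ChartedSpace (EuclideanHalfSpace (n + 1)) M]
    [IsManifold (𝓡∂ (n + 1)) ∞ M] [T2Space M] [CompactSpace M] [ConnectedSpace M]
    [MeasurableSpace M] [BorelSpace M]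
    {N : Type*} [TopologicalSpace N] [ChartedSpace (EuclideanSpace ℝ (Fin n)) N]
    [IsManifold (𝓡 n) ∞ N] [MeasurableSpace N] [BorelSpace N]
    (ι : N → M) (hι : Manifold.IsSmoothEmbedding (𝓡 n) (𝓡∂ (n + 1)) ∞ ι)
    (hι_range : range ι = (𝓡∂ (n + 1)).boundary M)
    (gbar : RenormVol.SmoothMetric (𝓡∂ (n + 1)) M)
    (δ : ℝ) (Φ : PartialEquiv (N × ℝ) M) (hΦ : RenormVol.IsGeodesicCollar gbar ι δ Φ)
    (u : M → ℝ) (hu : RenormVol.IsAsymptoticallyHyperbolic gbar u)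
    (v : ℕ → N → ℝ)
    (hv : RenormVol.IsRenormalizedVolumeCoeffs (RenormVol.singularMetric gbar u) gbar ι δ Φ v)
    (w : M → ℝ) (hw : ContMDiff (𝓡∂ (n + 1)) 𝓘(ℝ, ℝ) ∞ w) :
    (∀ t : ℝ, RenormVol.IsRenormalizedVolume n (RenormVol.singularMetric gbar u)
      (gbar.conformal (fun p => t * w p) (contMDiff_const.mul hw))
      (RenormVol.renormalizedVolume n (RenormVol.singularMetric gbar u)
        (gbar.conformal (fun p => t * w p) (contMDiff_const.mul hw)))) ∧
    HasDerivAt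
      (fun t : ℝ => RenormVol.renormalizedVolume n (RenormVol.singularMetric gbar u)
        (gbar.conformal (fun p => t * w p) (contMDiff_const.mul hw)))
      (∫ x : N, ∑ j ∈ Finset.range (n + 1),
          v (n - j) x / (j + 1).factorial * RenormVol.normalDeriv Φ δ w j x
        ∂(RenormVol.riemannianVolume (𝓡 n) (RenormVol.inducedMetric gbar ι)))
      0 := by
  have hιc : Continuous ι := hι.isEmbedding.continuous
  have hclosed : IsClosed (range ι) :=
    hι_range ▸ (𝓡∂ (n + 1)).isClosed_boundary (n := ∞) (by simp)
  have : CompactSpace N :=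
    (Topology.IsClosedEmbedding.mk hι.isEmbedding hclosed).compactSpace
  have := RenormVol.isFiniteMeasure_riemannianVolume_inducedMetric gbar hι.contMDiff
  obtain ⟨a, ha⟩ := RenormVol.exists_hasDistanceExpansion hΦ hι_range hw
  obtain ⟨κ, hκ⟩ := RenormVol.exists_isRenormalizedVolume hιc hι_range hΦ hu.continuous
    (fun p hp => (hu.pos p hp).ne') hv hw ha
  set V : ℝ → ℝ := fun t => RenormVol.renormalizedVolume n (RenormVol.singularMetric gbar u)
    (gbar.conformal (fun p => t * w p) (contMDiff_const.mul hw)) with hV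
  set J : ℝ → ℝ := fun t => ∫ x, ∑ j ∈ Finset.range (n + 1), v j x * a (n - j) t x
    ∂(RenormVol.riemannianVolume (𝓡 n) (RenormVol.inducedMetric gbar ι)) with hJ
  have hspec : ∀ t : ℝ, RenormVol.IsRenormalizedVolume n (RenormVol.singularMetric gbar u)
      (gbar.conformal (fun p => t * w p) (contMDiff_const.mul hw)) (V t) := fun t =>
    Classical.epsilon_spec ((hκ t).exists.elim fun _ h => ⟨_, h⟩)
  -- For each `t` some small `s` is admissible both for `t` and for `0`. As `κ s` is the same number
  -- in the two expansions, uniqueness of the constant term shows that `V - J` is constant.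
  have hVJ : V = fun t => V 0 - J 0 + J t := by
    funext t
    obtain ⟨s, ht, h0⟩ := ((hκ t).and (hκ 0)).exists
    have e1 : V t = κ s + J t := (hspec t).unique ht
    have e2 : V 0 = κ s + J 0 := (hspec 0).unique h0
    linarith
  refine ⟨hspec, ?_⟩
  have hvc : ∀ j < n + 1, Continuous (v j) :=
    fun j hj => (hv.smooth j (Nat.lt_succ_iff.1 hj)).continuous
  rw [hVJ]
  refine (RenormVol.hasDerivAt_integral_coeff ha (fun j hj => (hvc j hj).measurable)
    fun j hj => ?_).const_add _
  obtain ⟨B, hB⟩ := isCompact_univ.exists_bound_of_continuousOn (hvc j hj).continuousOn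
  exact ⟨B, fun x => hB x (mem_univ x)⟩
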